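/- Cluster Vertex Deletion is the following decision problem: given a finite simple undirected graph $G$ and an integer $k\ge 0$, does there exist a set $S$ of at most $k$ vertices of $G$ such that $G\setminus S$ is a cluster graph, i.e. a disjoint union of cliques? **Theorem.** Cluster Vertex Deletion can be solved in $\mathcal{O}(1.9102^k\,(n+m))$ time and polynomial space on an input $(G,k)$ with $|V(G)|=n\ge 1$ and $|E(G)|=m$. Here the model is the unit-cost random access machine with memory access, addition, subtraction and tests, and with words of $\mathcal{O}(\log(n+m+k+2))$ bits; the graph is given by $n$, $m$ and a list of its edges in arbitrary order. A single program decides all instances, in at most $C\cdot 1.9102^k\,(n+m)$ steps for a constant $C$, and uses a number of memory words that is bounded by a polynomial in $n+m$. (For $n=0$ the program also halts with the right answer within the space bound.) -/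

import Mathlib

namespace ClusterVD

/-! ### The problem -/

/-- A cluster graph: a disjoint union of cliques, i.e. every connected component is a clique. -/
def IsClusterGraph {V : Type*} (H : SimpleGraph V) : Prop :=
  ∀ u v : V, H.Reachable u v → u ≠ v → H.Adj u v

/-- `(G, k)` is a yes-instance of Cluster Vertex Deletion: some set `S` of at most `k` vertices
leaves a cluster graph when it is deleted. -/
def HasClusterDeletion {V : Type*} (G : SimpleGraph V) (k : ℕ) : Prop :=
  ∃ S : Finset V, S.card ≤ k ∧ IsClusterGraph (G.induce {v : V | v ∉ S})

/-! ### The machine: a random access machine with structured programs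

A machine has registers `reg 0, reg 1, …` (a program mentions only finitely many of them) and a
memory `mem 0, mem 1, …`; registers and memory cells hold natural numbers ("words"). -/

/-- The state of the machine. -/
structure State where
  /-- the contents of the registers -/
  reg : ℕ → ℕ
  /-- the contents of the memory cells -/
  mem : ℕ → ℕ

/-- Arithmetic expressions: constants, registers, indirect memory reads, sums and
(truncated) differences. -/
inductive Expr where
  | const (c : ℕ)
  | reg (i : ℕ)
  | load (e : Expr)
  | add (e f : Expr)
  | sub (e f : Expr)

/-- The value of an expression. -/
def Expr.eval (s : State) : Expr → ℕ
  | .const c => c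
  | .reg i => s.reg i
  | .load e => s.mem (e.eval s)
  | .add e f => e.eval s + f.eval s
  | .sub e f => e.eval s - f.eval s

/-- The number of elementary operations needed to evaluate an expression (unit cost). -/
def Expr.cost : Expr → ℕ
  | .const _ => 1
  | .reg _ => 1
  | .load e => e.cost + 1
  | .add e f => e.cost + f.cost + 1
  | .sub e f => e.cost + f.cost + 1

/-- The evaluation of an expression is possible on a machine with memory cells `0, …, M - 1` and
words smaller than `W`: all numbers that occur are smaller than `W`, and all memory cells that
are read have addresses smaller than `M`. -/
def Expr.Fits (W M : ℕ) (s : State) : Expr → Prop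
  | .const c => c < W
  | .reg i => s.reg i < W
  | .load e => e.Fits W M s ∧ e.eval s < M ∧ s.mem (e.eval s) < W
  | .add e f => e.Fits W M s ∧ f.Fits W M s ∧ e.eval s + f.eval s < W
  | .sub e f => e.Fits W M s ∧ f.Fits W M s

/-- Programs. `assign i e` puts the value of `e` into register `i`; `store a e` puts the value of
`e` into the memory cell whose address is the value of `a`; `ite e p q` runs `p` if the value of
`e` is nonzero, and `q` otherwise; `loop e p` runs `p` as long as the value of `e` is nonzero. -/
inductive Prog where
  | nop
  | assign (i : ℕ) (e : Expr)
  | store (a e : Expr)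
  | seq (p q : Prog)
  | ite (e : Expr) (p q : Prog)
  | loop (e : Expr) (p : Prog)

/-- `Exec W M p s t s'`: on a machine with memory cells `0, …, M - 1` and words smaller than `W`,
the program `p`, started in the state `s`, halts after `t` steps in the state `s'`, without
ever producing a number that is not smaller than `W` and without ever accessing a memory cell
whose address is not smaller than `M`. (A run that violates these limits has no derivation.) -/
inductive Exec (W M : ℕ) : Prog → State → ℕ → State → Prop
  | nop (s : State) : Exec W M .nop s 1 s
  | assign (i : ℕ) (e : Expr) (s : State) (he : e.Fits W M s) :
      Exec W M (.assign i e) s (e.cost + 1) ⟨Function.update s.reg i (e.eval s), s.mem⟩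
  | store (a e : Expr) (s : State) (ha : a.Fits W M s) (he : e.Fits W M s) (hM : a.eval s < M) :
      Exec W M (.store a e) s (a.cost + e.cost + 1)
        ⟨s.reg, Function.update s.mem (a.eval s) (e.eval s)⟩
  | seq (p q : Prog) (s₀ s₁ s₂ : State) (t₁ t₂ : ℕ)
      (hp : Exec W M p s₀ t₁ s₁) (hq : Exec W M q s₁ t₂ s₂) :
      Exec W M (.seq p q) s₀ (t₁ + t₂) s₂
  | ite_true (e : Expr) (p q : Prog) (s s' : State) (t : ℕ) (he : e.Fits W M s)
      (hv : e.eval s ≠ 0) (hp : Exec W M p s t s') :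
      Exec W M (.ite e p q) s (e.cost + 1 + t) s'
  | ite_false (e : Expr) (p q : Prog) (s s' : State) (t : ℕ) (he : e.Fits W M s)
      (hv : e.eval s = 0) (hq : Exec W M q s t s') :
      Exec W M (.ite e p q) s (e.cost + 1 + t) s'
  | loop_false (e : Expr) (p : Prog) (s : State) (he : e.Fits W M s) (hv : e.eval s = 0) :
      Exec W M (.loop e p) s (e.cost + 1) s
  | loop_true (e : Expr) (p : Prog) (s₀ s₁ s₂ : State) (t₁ t₂ : ℕ) (he : e.Fits W M s₀)
      (hv : e.eval s₀ ≠ 0) (hp : Exec W M p s₀ t₁ s₁) (hl : Exec W M (.loop e p) s₁ t₂ s₂) :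
      Exec W M (.loop e p) s₀ (e.cost + 1 + t₁ + t₂) s₂

/-! ### The input -/

/-- `l` lists every edge of `G` exactly once, in some order, each with its two endpoints in
some order. -/
def IsEdgeList {n : ℕ} (G : SimpleGraph (Fin n)) (l : List (Fin n × Fin n)) : Prop :=
  (l.map fun e => s(e.1, e.2)).Nodup ∧
    ∀ e : Sym2 (Fin n), e ∈ l.map (fun e => s(e.1, e.2)) ↔ e ∈ G.edgeSet

/-- The input as a list of words: the number of vertices, the number of edges, the parameter,
and then the two endpoints of each edge. -/
def inputWords (n : ℕ) (l : List (Fin n × Fin n)) (k : ℕ) : List ℕ :=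
  n :: l.length :: k :: l.flatMap fun e => [(e.1 : ℕ), (e.2 : ℕ)]

/-- The state in which a program is started: the input stands in the first memory cells, all other
memory cells and all registers are zero. -/
def startState (n : ℕ) (l : List (Fin n × Fin n)) (k : ℕ) : State where
  reg := fun _ => 0
  mem := fun a => (inputWords n l k).getD a 0

end ClusterVD

/-! Fix a vertex v of the remaining graph. Two vertices are in conflict at v when together with v
they induce a path on three vertices; the conflicts are the edges of an auxiliary graph H on the
first and second neighbourhood of v. A solution that keeps v has to destroy all edges of H, and once
they are gone the closed neighbourhood of v is a clique and a component of its own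
(`Clus.of_not_conf`). Keeping v therefore means solving vertex cover on H: take w in N(v) and delete
either w or all vertices in conflict with w (`solvable_branch`).

The alternative, deleting v, is restricted by an exchange argument (`exists_keep_of_covers`): if one
vertex c meets all conflicts that survive in a solution without v, then c can be given up in place
of v. Hence v may be kept when H is a star (`solvable_star`); the vertices with the same closed
neighbourhood as v are deleted together with v; and if w and c cover H, then w may be kept in the
branch without v (`solvable_split`). Two triangles sharing the vertex v form a special case, where
deleting v alone is optimal (`solvable_butterfly`).

The search tree has at most 1000 · 1.9102^k nodes (`bounded_free`). Deleting v costs one unit of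
budget and leads to a tree smaller by a factor of about 0.5235, so the branch that keeps v has to do
with less than 0.4765. The vertex v is chosen as a leaf or, when no unsettled leaf exists, with a
degree maximal among its neighbours; in the latter case at least half of the conflicts of every
neighbour are inside N(v) (`two_mul_hout_le`). After the deletion of w an inner conflict partner of
w has fewer conflicts, which makes the next branching cheap. This gives the factor 0.4375 when some
vertex has three conflicts (`bounded_of_hdeg_three`) and in the generic case where all vertices of
N(v) have two (`bounded_of_pairs`). In the exceptional cases the loss is made up on the other side:
twins cost a second unit of budget, and if H has three edges, then w is kept and still has conflicts
(`hasConf_of_esum_eq_six`). `bounded_split` puts the cases together.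

A node is processed in linear time. All decisions depend on neighbour counts, their sums and their
maxima, each found in one pass over the vertices or the edges: the numbers of conflicts come from
`hdeg_eq`, stars and the other shapes of H are told from sums (`covers_iff`,
`exists_covers_of_esum`, `butterfly_iff`), and cluster graphs are recognised from degrees and least
elements of closed neighbourhoods (`clus_of_eq`). The search is depth first with an explicit stack.
The vertex sets on the stack grow strictly towards the bottom, so there are at most n + 1 of them
(`Valid.length_le`) and the space is polynomial. The program is written in a small language with
arrays and counted loops, which is compiled to the random access machine; `exec_search` combines
correctness, running time and the size of the tree. -/

namespace ClusterVD

set_option linter.unusedSectionVars false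

/-! ### Conflicts at a vertex. -/

section Combinatorics

variable {V : Type*} [DecidableEq V] (G : SimpleGraph V) [DecidableRel G.Adj]

/-- The vertices of `B` induce a graph without induced path on three vertices. -/
def Clus (B : Finset V) : Prop :=
  ∀ x ∈ B, ∀ y ∈ B, ∀ z ∈ B, G.Adj x y → G.Adj y z → x ≠ z → G.Adj x z

/-- For a neighbour `x` of `v`: the vertices `v`, `x`, `y` induce a path on three vertices. -/
def Conf (v x y : V) : Prop := y ≠ v ∧ y ≠ x ∧ (G.Adj v y ↔ ¬ G.Adj x y)

instance (v x y : V) : Decidable (Conf G v x y) := by unfold Conf; infer_instance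

/-- The neighbours of `v` in `A`. -/
def nb (A : Finset V) (v : V) : Finset V := A.filter (G.Adj v)

/-- The vertices of `A` in conflict with the neighbour `x` of `v`. -/
def hn (A : Finset V) (v x : V) : Finset V := A.filter (Conf G v x)

/-- The number of conflicts of `x`. -/
def hdeg (A : Finset V) (v x : V) : ℕ := (hn G A v x).card

/-- The number of conflicts of `x` with vertices that are not neighbours of `v`. -/
def hout (A : Finset V) (v x : V) : ℕ := ((hn G A v x).filter fun y => ¬ G.Adj v y).card

/-- Twice the number of conflicts at `v`. -/
def esum (A : Finset V) (v : V) : ℕ := ∑ x ∈ nb G A v, (hdeg G A v x + hout G A v x)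

/-- The neighbours of `v` without conflicts. -/
def twins (A : Finset V) (v : V) : Finset V := (nb G A v).filter fun x => hdeg G A v x = 0

variable {G}

theorem mem_nb {A : Finset V} {v x : V} : x ∈ nb G A v ↔ x ∈ A ∧ G.Adj v x := by simp [nb]

theorem mem_hn {A : Finset V} {v x y : V} : y ∈ hn G A v x ↔ y ∈ A ∧ Conf G v x y := by simp [hn]

theorem mem_twins {A : Finset V} {v x : V} :
    x ∈ twins G A v ↔ x ∈ nb G A v ∧ hn G A v x = ∅ := by
  simp [twins, hdeg]

theorem Conf.symm {v x y : V} (hx : G.Adj v x) (hy : G.Adj v y) (h : Conf G v x y) :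
    Conf G v y x := by
  obtain ⟨-, h2, h3⟩ := h
  refine ⟨hx.ne', h2.symm, ?_⟩
  rw [G.adj_comm y x]
  tauto

theorem Clus.not_conf {B : Finset V} (h : Clus G B) {v x y : V} (hv : v ∈ B) (hx : x ∈ B)
    (hy : y ∈ B) (ha : G.Adj v x) : ¬ Conf G v x y := by
  rintro ⟨h1, h2, h3⟩
  by_cases hvy : G.Adj v y
  · exact h3.1 hvy (h x hx v hv y hy ha.symm hvy h2.symm)
  · have : G.Adj x y := by tauto
    exact hvy (h v hv x hx y hy ha this h1.symm)

/-- Without conflicts, `v` and each of its neighbours in `B` have the same closed neighbourhood in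
`B`. An induced path on three vertices either meets this closed neighbourhood, and then lies in a
clique, or avoids it and lies in `C`. -/
theorem Clus.of_not_conf {B C : Finset V} {v : V}
    (h : ∀ x ∈ B, G.Adj v x → ∀ y ∈ B, ¬ Conf G v x y) (hC : Clus G C)
    (hBC : ∀ y ∈ B, y ≠ v → ¬ G.Adj v y → y ∈ C) : Clus G B := by
  have key : ∀ x ∈ B, G.Adj v x → ∀ y ∈ B, y ≠ v → y ≠ x → (G.Adj v y ↔ G.Adj x y) := by
    intro x hx hvx y hy h1 h2
    have := h x hx hvx y hy
    unfold Conf at this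
    tauto
  intro x hx y hy z hz hxy hyz hxz
  by_cases hyv : y = v
  · subst hyv
    exact (key x hx hxy.symm z hz hyz.ne' hxz.symm).1 hyz
  by_cases hxv : x = v
  · subst hxv
    exact (key y hy hxy z hz hxz.symm hyz.ne').2 hyz
  by_cases hzv : z = v
  · subst hzv
    exact ((key y hy hyz.symm x hx hxz hxy.ne).2 hxy.symm).symm
  by_cases hvy : G.Adj v y
  · have hvx := (key y hy hvy x hx hxv hxy.ne).2 hxy.symm
    have hvz := (key y hy hvy z hz hzv hyz.ne').2 hyz
    exact (key x hx hvx z hz hzv hxz.symm).1 hvz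
  · have hvx : ¬ G.Adj v x := fun hvx => hvy ((key x hx hvx y hy hyv hxy.ne').2 hxy)
    have hvz : ¬ G.Adj v z := fun hvz => hvy ((key z hz hvz y hy hyv hyz.ne).2 hyz.symm)
    exact hC x (hBC x hx hxv hvx) y (hBC y hy hyv hvy) z (hBC z hz hzv hvz) hxy hyz hxz

/-! ### Nodes of the search tree and branching rules. -/

/-- How a node of the search tree is to be processed: without a distinguished vertex, with a
chosen vertex, or with a vertex that must not be deleted. -/
inductive Mode (V : Type*) where
  | free
  | fresh (v : V)
  | kept (v : V)

/-- A node of the search tree: the remaining vertices, the budget and the mode. -/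
structure Node (V : Type*) where
  alive : Finset V
  budget : ℕ
  mode : Mode V

/-- The set `B` of remaining vertices is a solution for the node. -/
def Node.Solves (G : SimpleGraph V) (s : Node V) (B : Finset V) : Prop :=
  B ⊆ s.alive ∧ s.alive.card ≤ B.card + s.budget ∧ Clus G B ∧
    match s.mode with
    | .free => True
    | .fresh _ => True
    | .kept v => v ∈ B

/-- The node is a yes-instance. -/
def Node.Solvable (G : SimpleGraph V) (s : Node V) : Prop := ∃ B, s.Solves G B

/-- The distinguished vertex remains. -/
def Node.Wf (s : Node V) : Prop :=
  match s.mode with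
  | .free => True
  | .fresh v => v ∈ s.alive
  | .kept v => v ∈ s.alive

theorem solvable_free {A : Finset V} {k : ℕ} :
    (Node.mk A k .free).Solvable G ↔ ∃ B ⊆ A, A.card ≤ B.card + k ∧ Clus G B := by
  simp [Node.Solvable, Node.Solves]

theorem solvable_fresh {A : Finset V} {k : ℕ} {v : V} :
    (Node.mk A k (.fresh v)).Solvable G ↔ ∃ B ⊆ A, A.card ≤ B.card + k ∧ Clus G B := by
  simp [Node.Solvable, Node.Solves]

theorem solvable_kept {A : Finset V} {k : ℕ} {v : V} :
    (Node.mk A k (.kept v)).Solvable G ↔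
      ∃ B ⊆ A, A.card ≤ B.card + k ∧ Clus G B ∧ v ∈ B := by
  simp [Node.Solvable, Node.Solves]

variable (G)

/-- `w` has conflicts; it has exactly one if some neighbour of `v` has exactly one, and it has the
largest number of conflicts otherwise. -/
def Pref (A : Finset V) (v w : V) : Prop :=
  w ∈ nb G A v ∧ 0 < hdeg G A v w ∧
    (hdeg G A v w = 1 ∨ ∀ x ∈ nb G A v, hdeg G A v x ≠ 1 ∧ hdeg G A v x ≤ hdeg G A v w)

/-- The neighbourhood of `v` is a component together with `v`, and consists of two cliques of
size two. -/
def Butterfly (A : Finset V) (v : V) : Prop :=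
  (nb G A v).card = 4 ∧ ∀ x ∈ nb G A v, hdeg G A v x = 2 ∧ hout G A v x = 0

/-- Every conflict involves `w` or `c`. -/
def Covers (A : Finset V) (v w c : V) : Prop :=
  ∀ x ∈ nb G A v, ∀ y ∈ hn G A v x, x = w ∨ y = w ∨ x = c ∨ y = c

/-- The vertex `v` is suitable for branching: it has degree one, or no endpoint of an edge of a
larger component has degree one and the degree of `v` is maximal among its neighbours. -/
def Suitable (A : Finset V) (v : V) : Prop :=
  (nb G A v).card = 1 ∨
    ((∀ x ∈ nb G A v, (nb G A x).card ≤ (nb G A v).card) ∧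
      ∀ a ∈ A, ∀ b ∈ nb G A a, (nb G A a).card = 1 → (nb G A b).card = 1)

/-- One step of the branching algorithm: either the node is accepted, or it is replaced by a list
of nodes. -/
inductive Step : Node V → Option (List (Node V)) → Prop
  | accept (A : Finset V) (k : ℕ) (h : Clus G A) : Step ⟨A, k, .free⟩ none
  | pick (A : Finset V) (k : ℕ) (v : V) (hv : v ∈ A)
      (hc : ∃ x ∈ nb G A v, (hn G A v x).Nonempty) (hs : Suitable G A v) :
      Step ⟨A, k, .free⟩ (some [⟨A, k, .fresh v⟩])
  | star (A : Finset V) (k : ℕ) (v y : V) (h : Covers G A v y y) :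
      Step ⟨A, k, .fresh v⟩ (some [⟨A, k, .kept v⟩])
  | butterfly (A : Finset V) (k : ℕ) (v w : V) (h : Butterfly G A v) (hw : w ∈ nb G A v) :
      Step ⟨A, k, .fresh v⟩ (some [⟨A, k, .kept w⟩])
  | split (A : Finset V) (k : ℕ) (v w : V) (m : Mode V) (hw : Pref G A v w)
      (hstar : ∀ y ∈ nb G A v, ¬ Covers G A v y y) (hb : ¬ Butterfly G A v)
      (hm : (m = .kept w ∧ ∃ c, Covers G A v w c) ∨
        (m = .free ∧ esum G A v ≠ 2 * (hdeg G A v w + 1))) :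
      Step ⟨A, k, .fresh v⟩ (some
        ((if 1 + (twins G A v).card ≤ k then
          [⟨A \ insert v (twins G A v), k - (1 + (twins G A v).card), m⟩] else []) ++
        [⟨A, k, .kept v⟩]))
  | release (A : Finset V) (k : ℕ) (v : V) (h : ∀ x ∈ nb G A v, hn G A v x = ∅) :
      Step ⟨A, k, .kept v⟩ (some [⟨A, k, .free⟩])
  | branch (A : Finset V) (k : ℕ) (v w : V) (hw : Pref G A v w) :
      Step ⟨A, k, .kept v⟩ (some
        ((if hdeg G A v w ≤ k then
          [⟨A \ hn G A v w, k - hdeg G A v w, .kept v⟩] else []) ++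
        (if 2 ≤ hdeg G A v w ∧ 1 ≤ k then [⟨A.erase w, k - 1, .kept v⟩] else [])))

/-! ### Correctness of the branching rules by exchange arguments. -/

variable {G}

/-- The exchange: `v` enters `B` and `c` leaves it. All conflicts at `v` inside `B` involve `c`, so
none is left, and the size does not drop. -/
theorem exists_keep_of_covers {A B : Finset V} {v c : V} (hBA : B ⊆ A) (hB : Clus G B)
    (hv : v ∈ A) (hvB : v ∉ B)
    (h : ∀ x ∈ nb G A v, x ∈ B → ∀ y ∈ hn G A v x, y ∈ B → x = c ∨ y = c) :
    ∃ C ⊆ A, B.card ≤ C.card ∧ Clus G C ∧ v ∈ C := by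
  have hvc : ∀ x ∈ insert v (B.erase c), x ≠ v → x ∈ B ∧ x ≠ c := by
    intro x hx hxv
    simp only [Finset.mem_insert, Finset.mem_erase] at hx
    tauto
  refine ⟨insert v (B.erase c), ?_, ?_, ?_, by simp⟩
  · intro x hx
    by_cases hxv : x = v
    · exact hxv ▸ hv
    · exact hBA (hvc x hx hxv).1
  · rw [Finset.card_insert_of_notMem (by simp [hvB])]
    have := Finset.pred_card_le_card_erase (s := B) (a := c)
    omega
  · refine Clus.of_not_conf (v := v) (C := B) ?_ hB ?_
    · intro x hx hvx y hy hxy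
      have h1 := hvc x hx hvx.ne'
      have h2 := hvc y hy hxy.1
      rcases h x (mem_nb.2 ⟨hBA h1.1, hvx⟩) h1.1 y (mem_hn.2 ⟨hBA h2.1, hxy⟩) h2.1 with h | h
      · exact h1.2 h
      · exact h2.2 h
    · intro y hy hyv _
      exact (hvc y hy hyv).1

theorem solvable_of_accept {A : Finset V} {k : ℕ} (h : Clus G A) :
    (Node.mk A k .free).Solvable G :=
  solvable_free.2 ⟨A, subset_rfl, by omega, h⟩

theorem solvable_star {A : Finset V} {k : ℕ} {v y : V} (hv : v ∈ A) (h : Covers G A v y y) :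
    (∃ B ⊆ A, A.card ≤ B.card + k ∧ Clus G B) ↔ (Node.mk A k (.kept v)).Solvable G := by
  rw [solvable_kept]
  constructor
  · rintro ⟨B, hBA, hk, hB⟩
    by_cases hvB : v ∈ B
    · exact ⟨B, hBA, hk, hB, hvB⟩
    obtain ⟨C, hC, hcard, hC', hvC⟩ := exists_keep_of_covers (c := y) hBA hB hv hvB
      (fun x hx _ z hz _ => by have := h x hx z hz; tauto)
    exact ⟨C, hC, by omega, hC', hvC⟩
  · rintro ⟨B, hBA, hk, hB, -⟩
    exact ⟨B, hBA, hk, hB⟩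

/-- If a solution omits `v` but contains a twin of `v`, then `v` can be added for free; otherwise
all twins are deleted with `v`. If moreover `w` is deleted and `w`, `c` cover all conflicts, then
the surviving conflicts all involve `c`, and `c` is exchanged for `v`. So in the branch without `v`
the vertex `w` may be assumed to stay. -/
theorem solvable_split {A : Finset V} {k : ℕ} {v w : V} {m : Mode V} (hv : v ∈ A)
    (hw : Pref G A v w)
    (hm : (m = .kept w ∧ ∃ c, Covers G A v w c) ∨ m = .free) :
    (Node.mk A k (.fresh v)).Solvable G ↔
      (1 + (twins G A v).card ≤ k ∧
        (Node.mk (A \ insert v (twins G A v)) (k - (1 + (twins G A v).card)) m).Solvable G) ∨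
      (Node.mk A k (.kept v)).Solvable G := by
  have hT : insert v (twins G A v) ⊆ A := by
    intro x hx
    rcases Finset.mem_insert.1 hx with rfl | hx
    · exact hv
    · exact (mem_nb.1 (mem_twins.1 hx).1).1
  have hvT : v ∉ twins G A v := fun h => (mem_nb.1 (mem_twins.1 h).1).2.ne rfl
  have hcard : (insert v (twins G A v)).card = 1 + (twins G A v).card := by
    rw [Finset.card_insert_of_notMem hvT]; omega
  have hsd := Finset.card_sdiff_add_card_eq_card hT
  rw [solvable_fresh]
  constructor
  · rintro ⟨B, hBA, hk, hB⟩
    by_cases hvB : v ∈ B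
    · exact Or.inr (solvable_kept.2 ⟨B, hBA, hk, hB, hvB⟩)
    by_cases hTB : ∃ t ∈ twins G A v, t ∈ B
    · obtain ⟨t, ht, htB⟩ := hTB
      right
      rw [solvable_kept]
      obtain ⟨hta, htc⟩ := mem_twins.1 ht
      obtain ⟨htA, hvt⟩ := mem_nb.1 hta
      have twin : ∀ y ∈ A, y ≠ v → y ≠ t → (G.Adj v y ↔ G.Adj t y) := by
        intro y hy h1 h2
        have : y ∉ hn G A v t := by rw [htc]; simp
        rw [mem_hn] at this
        unfold Conf at this
        tauto
      -- The surviving twin `t` sees the same vertices as `v`, so a conflict at `v` inside `B` would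
      -- be one at `t`. As no conflict survives, the choice of `c` is immaterial; with `c := v`,
      -- which is not in `B`, nothing is removed.
      obtain ⟨C, hC, hcard, hC', hvC⟩ := exists_keep_of_covers (c := v) hBA hB hv hvB (by
        intro x hx hxB y hy hyB
        exfalso
        obtain ⟨hxA, hvx⟩ := mem_nb.1 hx
        obtain ⟨hyA, hyc⟩ := mem_hn.1 hy
        have hxt : x ≠ t := by
          rintro rfl
          rw [htc] at hy
          simp at hy
        have hty : y ≠ t := by
          rintro rfl
          have : x ∈ hn G A v y := mem_hn.2 ⟨hxA, hyc.symm hvx hvt⟩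
          rw [htc] at this
          simp at this
        refine hB.not_conf htB hxB hyB ((twin x hxA hvx.ne' hxt).1 hvx) ⟨hty, hyc.2.1, ?_⟩
        rw [← twin y hyA hyc.1 hty]
        exact hyc.2.2)
      exact ⟨C, hC, by omega, hC', hvC⟩
    · have hBT : B ⊆ A \ insert v (twins G A v) := by
        intro x hx
        simp only [Finset.mem_sdiff, Finset.mem_insert, not_or]
        exact ⟨hBA hx, fun h => hvB (h ▸ hx), fun h => hTB ⟨x, h, hx⟩⟩
      have hle := Finset.card_le_card hBT
      rcases hm with ⟨rfl, c, hc⟩ | rfl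
      · by_cases hwB : w ∈ B
        · exact Or.inl ⟨by omega, solvable_kept.2 ⟨B, hBT, by omega, hB, hwB⟩⟩
        · right
          rw [solvable_kept]
          obtain ⟨C, hC, hcard, hC', hvC⟩ := exists_keep_of_covers (c := c) hBA hB hv hvB
            (fun x hx hxB z hz hzB => by
              rcases hc x hx z hz with rfl | rfl | h | h
              · exact absurd hxB hwB
              · exact absurd hzB hwB
              · exact Or.inl h
              · exact Or.inr h)
          exact ⟨C, hC, by omega, hC', hvC⟩
      · exact Or.inl ⟨by omega, solvable_free.2 ⟨B, hBT, by omega, hB⟩⟩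
  · rintro (⟨hk, B, hBA, hk', hB, -⟩ | ⟨B, hBA, hk, hB, -⟩)
    · simp only at hBA hk'
      exact ⟨B, hBA.trans Finset.sdiff_subset, by omega, hB⟩
    · exact ⟨B, hBA, hk, hB⟩

/-- Each neighbour of `v` has two inner conflicts among the three others, hence exactly one
neighbour in N(v), and none outside. So `v` and N(v) form a component of two triangles sharing `v`.
A solution without `w` has at most four of these five vertices, and they can be replaced by the four
vertices of N(v). -/
theorem solvable_butterfly {A : Finset V} {k : ℕ} {v w : V} (h : Butterfly G A v)
    (hw : w ∈ nb G A v) :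
    (Node.mk A k (.fresh v)).Solvable G ↔ (Node.mk A k (.kept w)).Solvable G := by
  rw [solvable_kept, solvable_fresh]
  obtain ⟨hcard, hall⟩ := h
  have hvn : v ∉ nb G A v := fun h => (mem_nb.1 h).2.ne rfl
  have hout0 : ∀ x ∈ nb G A v, ∀ y ∈ hn G A v x, G.Adj v y := by
    intro x hx y hy
    by_contra hvy
    have := (hall x hx).2
    rw [hout, Finset.card_eq_zero] at this
    have hmem : y ∈ (hn G A v x).filter fun y => ¬ G.Adj v y := Finset.mem_filter.2 ⟨hy, hvy⟩
    rw [this] at hmem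
    simp at hmem
  have hone : ∀ x ∈ nb G A v, ((nb G A v).filter fun y => G.Adj x y).card = 1 := by
    intro x hx
    have h1 : (nb G A v).filter (fun y => ¬ G.Adj x y) = insert x (hn G A v x) := by
      ext y
      simp only [Finset.mem_filter, Finset.mem_insert]
      constructor
      · rintro ⟨hy, hxy⟩
        by_cases hyx : y = x
        · exact Or.inl hyx
        · right
          rw [mem_nb] at hy
          exact mem_hn.2 ⟨hy.1, hy.2.ne', hyx, by tauto⟩
      · rintro (rfl | hy)
        · exact ⟨hx, G.irrefl⟩
        · have := hout0 x hx y hy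
          rw [mem_hn] at hy
          exact ⟨mem_nb.2 ⟨hy.1, this⟩, hy.2.2.2.1 this⟩
    have h2 : (insert x (hn G A v x)).card = 3 := by
      rw [Finset.card_insert_of_notMem (by simp [mem_hn, Conf])]
      have := (hall x hx).1
      unfold hdeg at this
      omega
    have h3 := Finset.card_filter_add_card_filter_not (s := nb G A v) (fun y => G.Adj x y)
    rw [h1, h2] at h3
    omega
  have huniq : ∀ x ∈ nb G A v, ∀ y ∈ nb G A v, ∀ z ∈ nb G A v, G.Adj x y → G.Adj x z → y = z := by
    intro x hx y hy z hz hxy hxz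
    have := hone x hx
    rw [Finset.card_eq_one] at this
    obtain ⟨a, ha⟩ := this
    have h1 : y ∈ (nb G A v).filter fun y => G.Adj x y := Finset.mem_filter.2 ⟨hy, hxy⟩
    have h2 : z ∈ (nb G A v).filter fun y => G.Adj x y := Finset.mem_filter.2 ⟨hz, hxz⟩
    rw [ha, Finset.mem_singleton] at h1 h2
    rw [h1, h2]
  have hclosed : ∀ x ∈ nb G A v, ∀ y ∈ A, G.Adj x y → y ≠ v → y ∈ nb G A v := by
    intro x hx y hy hxy hyv
    by_contra hyn
    have hvy : ¬ G.Adj v y := fun h => hyn (mem_nb.2 ⟨hy, h⟩)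
    exact hvy (hout0 x hx y (mem_hn.2 ⟨hy, hyv, hxy.ne', by tauto⟩))
  constructor
  · rintro ⟨B, hBA, hk, hB⟩
    by_cases hwB : w ∈ B
    · exact ⟨B, hBA, hk, hB, hwB⟩
    refine ⟨(B \ insert v (nb G A v)) ∪ nb G A v, ?_, ?_, ?_, by simp [hw]⟩
    · intro x hx
      simp only [Finset.mem_union, Finset.mem_sdiff] at hx
      rcases hx with hx | hx
      · exact hBA hx.1
      · exact (mem_nb.1 hx).1
    · rw [Finset.card_union_of_disjoint]
      · have h1 : B \ insert v (nb G A v) ∪ (insert v (nb G A v)).erase w ⊇ B := by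
          intro x hx
          simp only [Finset.mem_union, Finset.mem_sdiff, Finset.mem_erase]
          by_cases hxn : x ∈ insert v (nb G A v)
          · exact Or.inr ⟨fun h => hwB (h ▸ hx), hxn⟩
          · exact Or.inl ⟨hx, hxn⟩
        have h2 := (Finset.card_le_card h1).trans (Finset.card_union_le _ _)
        rw [Finset.card_erase_of_mem (by simp [hw]), Finset.card_insert_of_notMem hvn] at h2
        omega
      · rw [Finset.disjoint_left]
        intro x hx hx'
        simp only [Finset.mem_sdiff, Finset.mem_insert] at hx
        tauto
    · have hsplit : ∀ x ∈ B \ insert v (nb G A v) ∪ nb G A v,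
          x ∈ nb G A v ∨ (x ∈ B ∧ x ≠ v ∧ x ∉ nb G A v) := by
        intro x hx
        simp only [Finset.mem_union, Finset.mem_sdiff, Finset.mem_insert] at hx
        tauto
      intro x hx y hy z hz hxy hyz hxz
      rcases hsplit y hy with hy | hy
      · rcases hsplit x hx with hx | hx
        · rcases hsplit z hz with hz | hz
          · exact absurd (huniq y hy x hx z hz hxy.symm hyz) hxz
          · exact absurd (hclosed y hy z (hBA hz.1) hyz hz.2.1) hz.2.2
        · exact absurd (hclosed y hy x (hBA hx.1) hxy.symm hx.2.1) hx.2.2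
      · rcases hsplit x hx with hx | hx
        · exact absurd (hclosed x hx y (hBA hy.1) hxy hy.2.1) hy.2.2
        · rcases hsplit z hz with hz | hz
          · exact absurd (hclosed z hz y (hBA hy.1) hyz.symm hy.2.1) hy.2.2
          · exact hB x hx.1 y hy.1 z hz.1 hxy hyz hxz
  · rintro ⟨B, hBA, hk, hB, -⟩
    exact ⟨B, hBA, hk, hB⟩

/-- If `w` stays next to `v`, then everything in conflict with it goes. If `w` has a single conflict
`y`, the case of deleting `w` is superfluous, since `y` can be exchanged for `w`. -/
theorem solvable_branch {A : Finset V} {k : ℕ} {v w : V} (hw : Pref G A v w) :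
    (Node.mk A k (.kept v)).Solvable G ↔
      (hdeg G A v w ≤ k ∧
        (Node.mk (A \ hn G A v w) (k - hdeg G A v w) (.kept v)).Solvable G) ∨
      ((2 ≤ hdeg G A v w ∧ 1 ≤ k) ∧ (Node.mk (A.erase w) (k - 1) (.kept v)).Solvable G) := by
  simp only [solvable_kept]
  obtain ⟨hwn, hpos, -⟩ := hw
  obtain ⟨hwA, hvw⟩ := mem_nb.1 hwn
  have hsub : hn G A v w ⊆ A := Finset.filter_subset _ _
  have hsd := Finset.card_sdiff_add_card_eq_card hsub
  have her := Finset.card_erase_add_one hwA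
  have hcn : (hn G A v w).card = hdeg G A v w := rfl
  constructor
  · rintro ⟨B, hBA, hk, hB, hvB⟩
    have keep : ∀ C ⊆ A, A.card ≤ C.card + k → Clus G C → v ∈ C → w ∈ C →
        (hdeg G A v w ≤ k ∧ ∃ B ⊆ A \ hn G A v w,
          (A \ hn G A v w).card ≤ B.card + (k - hdeg G A v w) ∧ Clus G B ∧ v ∈ B) := by
      intro C hCA hkC hC hvC hwC
      have : C ⊆ A \ hn G A v w := by
        intro x hx
        rw [Finset.mem_sdiff]
        exact ⟨hCA hx, fun h => hC.not_conf hvC hwC hx hvw (mem_hn.1 h).2⟩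
      have hle := Finset.card_le_card this
      exact ⟨by omega, C, this, by omega, hC, hvC⟩
    by_cases hwB : w ∈ B
    · exact Or.inl (keep B hBA hk hB hvB hwB)
    have hBe : B ⊆ A.erase w := fun x hx =>
      Finset.mem_erase.2 ⟨fun h => hwB (h ▸ hx), hBA hx⟩
    have hle := Finset.card_le_card hBe
    by_cases h2 : 2 ≤ hdeg G A v w
    · exact Or.inr ⟨⟨h2, by omega⟩, B, hBe, by omega, hB, hvB⟩
    left
    obtain ⟨y, hy⟩ := Finset.card_eq_one.1 (show (hn G A v w).card = 1 by omega)
    have hyA : y ∈ hn G A v w := by simp [hy]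
    have hyv : y ≠ v := (mem_hn.1 hyA).2.1
    have hmem : ∀ x ∈ insert w (B.erase y), x = w ∨ (x ∈ B ∧ x ≠ y) := by
      intro x hx
      simp only [Finset.mem_insert, Finset.mem_erase] at hx
      tauto
    have hsubA : insert w (B.erase y) ⊆ A := by
      intro x hx
      rcases hmem x hx with rfl | hx
      · exact hwA
      · exact hBA hx.1
    have hyw : y ≠ w := (mem_hn.1 hyA).2.2.1
    have hwy : ∀ x ∈ insert w (B.erase y), ¬ Conf G v w x := by
      intro x hx hc
      have : x ∈ hn G A v w := mem_hn.2 ⟨hsubA hx, hc⟩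
      rw [hy, Finset.mem_singleton] at this
      rcases hmem x hx with rfl | hx
      · exact hyw this.symm
      · exact hx.2 this
    refine keep (insert w (B.erase y)) hsubA ?_ ?_ ?_ (by simp)
    · rw [Finset.card_insert_of_notMem (by simp [hwB])]
      have := Finset.pred_card_le_card_erase (s := B) (a := y)
      omega
    · refine Clus.of_not_conf (v := v) (C := B) ?_ hB ?_
      · intro x hx hvx z hz hc
        rcases hmem x hx with rfl | hxB
        · exact hwy z hz hc
        rcases hmem z hz with rfl | hzB
        · exact hwy x hx (hc.symm hvx hvw)
        · exact hB.not_conf hvB hxB.1 hzB.1 hvx hc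
      · intro x hx hxv hvx
        rcases hmem x hx with rfl | hxB
        · exact absurd hvw hvx
        · exact hxB.1
    · exact Finset.mem_insert_of_mem (Finset.mem_erase.2 ⟨hyv.symm, hvB⟩)
  · rintro (⟨hk, B, hBA, hk', hB, hvB⟩ | ⟨⟨-, hk⟩, B, hBA, hk', hB, hvB⟩)
    · exact ⟨B, hBA.trans Finset.sdiff_subset, by omega, hB, hvB⟩
    · exact ⟨B, hBA.trans (Finset.erase_subset _ _), by omega, hB, hvB⟩

theorem Step.solvable {s : Node V} {o : Option (List (Node V))} (h : Step G s o) (hs : s.Wf) :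
    s.Solvable G ↔ ∀ cs, o = some cs → ∃ c ∈ cs, c.Solvable G := by
  cases h with
  | accept A k h => simp [solvable_of_accept h]
  | pick A k v hv hc hs =>
    simp [solvable_free, solvable_fresh]
  | star A k v y h =>
    rw [solvable_fresh, solvable_star hs h]
    simp
  | butterfly A k v w h hw =>
    rw [solvable_butterfly h hw]
    simp
  | split A k v w m hw hstar hb hm =>
    rw [solvable_split hs hw (by tauto)]
    split_ifs with h <;> simp [h]
  | release A k v h =>
    -- Where there are no conflicts, any vertex covers them all.
    rw [← solvable_star (y := v) hs (by intro x hx y hy; rw [h x hx] at hy; simp at hy)]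
    simp [solvable_free]
  | branch A k v w hw =>
    rw [solvable_branch hw]
    split_ifs with h1 h2 h2 <;> simp [h1, h2]

theorem Pref.ne {A : Finset V} {v w : V} (h : Pref G A v w) : w ≠ v := (mem_nb.1 h.1).2.ne'

theorem Step.wf {s : Node V} {cs : List (Node V)} (h : Step G s (some cs)) (hs : s.Wf) :
    ∀ c ∈ cs, c.Wf := by
  generalize ho : some cs = o at h
  cases h with
  | accept A k h => simp at ho
  | pick A k v hv hc hs => simpa [Option.some.inj ho, Node.Wf] using hv
  | star A k v y h => simpa [Option.some.inj ho, Node.Wf] using hs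
  | butterfly A k v w h hw => simpa [Option.some.inj ho, Node.Wf] using (mem_nb.1 hw).1
  | split A k v w m hw hstar hb hm =>
    have h1 : (Node.mk (A \ insert v (twins G A v)) (k - (1 + (twins G A v).card)) m).Wf := by
      rcases hm with ⟨rfl, -⟩ | ⟨rfl, -⟩
      · simp only [Node.Wf, Finset.mem_sdiff, Finset.mem_insert, not_or]
        refine ⟨(mem_nb.1 hw.1).1, hw.ne, fun h => ?_⟩
        have h1 := (mem_twins.1 h).2
        have h2 := hw.2.1
        simp [hdeg, h1] at h2
      · trivial
    have h2 : (Node.mk A k (.kept v)).Wf := hs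
    rw [Option.some.inj ho]
    split_ifs <;> simp [h1, h2]
  | release A k v h => simp [Option.some.inj ho, Node.Wf]
  | branch A k v w hw =>
    have hv : v ∈ A := hs
    have h1 : (Node.mk (A \ hn G A v w) (k - hdeg G A v w) (.kept v)).Wf := by
      simp [Node.Wf, hv, mem_hn, Conf]
    have h2 : (Node.mk (A.erase w) (k - 1) (.kept v)).Wf := by
      simp [Node.Wf, hv, hw.ne.symm]
    rw [Option.some.inj ho]
    split_ifs <;> simp [h1, h2]

/-- The budgets do not grow, and the sizes of the new nodes increase strictly, up to at most the
size of the old one. -/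
theorem Step.shrink {s : Node V} {cs : List (Node V)} (h : Step G s (some cs)) (hs : s.Wf) :
    (∀ c ∈ cs, c.budget ≤ s.budget ∧ c.alive.card ≤ s.alive.card) ∧
      (cs.map fun c => c.alive.card).Pairwise (· < ·) := by
  generalize ho : some cs = o at h
  cases h with
  | accept A k h => simp at ho
  | pick A k v hv hc hs => simp [Option.some.inj ho]
  | star A k v y h => simp [Option.some.inj ho]
  | butterfly A k v w h hw => simp [Option.some.inj ho]
  | split A k v w m hw hstar hb hm =>
    have h1 : (A \ insert v (twins G A v)).card < A.card := by
      apply Finset.card_lt_card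
      rw [Finset.ssubset_iff_of_subset Finset.sdiff_subset]
      exact ⟨v, hs, by simp⟩
    rw [Option.some.inj ho]
    split_ifs <;> simp [h1, h1.le]
  | release A k v h => simp [Option.some.inj ho]
  | branch A k v w hw =>
    have hsub : hn G A v w ⊆ A := Finset.filter_subset _ _
    have hsd := Finset.card_sdiff_add_card_eq_card hsub
    have her := Finset.card_erase_add_one (mem_nb.1 hw.1).1
    have hcn : (hn G A v w).card = hdeg G A v w := rfl
    have hpos := hw.2.1
    rw [Option.some.inj ho]
    -- Both children occur only if `w` has at least two conflicts; then the first one is strictly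
    -- smaller than `A.erase w`.
    split_ifs with h1 h2 h2 <;> simp [-Finset.card_erase_of_mem] <;> omega

end Combinatorics

/-! ### Size of the search tree: kept vertices. -/

section Running

variable {V : Type*} [DecidableEq V] (G : SimpleGraph V) [DecidableRel G.Adj]

/-- Processing a stack of nodes ends after at most `b` steps, whichever steps are taken. -/
inductive Halts : List (Node V) → ℝ → Prop
  | nil (b : ℝ) (hb : 0 ≤ b) : Halts [] b
  | cons (s : Node V) (rest : List (Node V)) (b : ℝ) (hb : 1 ≤ b)
      (h : ∀ cs, Step G s (some cs) → Halts (cs ++ rest) (b - 1)) : Halts (s :: rest) b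

/-- The search tree below the node has at most `b` nodes. -/
def Bounded (s : Node V) (b : ℝ) : Prop :=
  ∀ rest c, Halts G rest c → Halts G (s :: rest) (b + c)

variable {G}

theorem Halts.mono {L : List (Node V)} {b c : ℝ} (h : Halts G L b) (hbc : b ≤ c) :
    Halts G L c := by
  induction h generalizing c with
  | nil b hb => exact .nil c (hb.trans hbc)
  | cons s rest b hb h ih =>
    exact .cons s rest c (hb.trans hbc) fun cs hcs => ih cs hcs (by linarith)

theorem Halts.nonneg {L : List (Node V)} {b : ℝ} (h : Halts G L b) : 0 ≤ b := by
  cases h with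
  | nil b hb => exact hb
  | cons s rest b hb h => linarith

theorem Bounded.mono {s : Node V} {b c : ℝ} (h : Bounded G s b) (hbc : b ≤ c) :
    Bounded G s c := fun rest d hd => (h rest d hd).mono (by linarith)

theorem Halts.append {cs : List (Node V)} {bs : List ℝ} (h : List.Forall₂ (Bounded G) cs bs)
    {rest : List (Node V)} {c : ℝ} (hr : Halts G rest c) : Halts G (cs ++ rest) (bs.sum + c) := by
  induction h with
  | nil => simpa using hr
  | cons h1 h2 ih =>
    rw [List.sum_cons, add_assoc]
    exact h1 _ _ ih

theorem Bounded.intro {s : Node V} {b : ℝ} (hb : 1 ≤ b)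
    (h : ∀ cs, Step G s (some cs) → ∃ bs : List ℝ, List.Forall₂ (Bounded G) cs bs ∧
      1 + bs.sum ≤ b) : Bounded G s b := by
  intro rest c hr
  have := hr.nonneg
  refine .cons s rest _ (by linarith) fun cs hcs => ?_
  obtain ⟨bs, h1, h2⟩ := h cs hcs
  exact (Halts.append h1 hr).mono (by linarith)

variable (G)

/-- There is a conflict. -/
def HasConf (A : Finset V) (v : V) : Prop := ∃ x ∈ nb G A v, (hn G A v x).Nonempty

variable {G}

theorem nb_sdiff (A S : Finset V) (v : V) : nb G (A \ S) v = nb G A v \ S := by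
  ext x
  simp only [mem_nb, Finset.mem_sdiff]
  tauto

theorem hn_sdiff (A S : Finset V) (v x : V) : hn G (A \ S) v x = hn G A v x \ S := by
  ext y
  simp only [mem_hn, Finset.mem_sdiff]
  tauto

/-- A conflict excludes `release`, so only `branch` applies. The bounds `b₁` and `b₂` may depend on
the vertex `w` that is branched on, and each is needed only when the budget admits the child. -/
theorem bounded_kept {A : Finset V} {k : ℕ} {v : V} {b : ℝ} (hb : 1 ≤ b) (hc : HasConf G A v)
    (h : ∀ w, Pref G A v w → ∃ b₁ b₂ : ℝ, 0 ≤ b₁ ∧ 0 ≤ b₂ ∧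
      (hdeg G A v w ≤ k →
        Bounded G ⟨A \ hn G A v w, k - hdeg G A v w, .kept v⟩ b₁) ∧
      (2 ≤ hdeg G A v w → 1 ≤ k → Bounded G ⟨A \ {w}, k - 1, .kept v⟩ b₂) ∧
      1 + b₁ + b₂ ≤ b) : Bounded G ⟨A, k, .kept v⟩ b := by
  refine Bounded.intro hb fun cs hcs => ?_
  generalize ho : some cs = o at hcs
  cases hcs with
  | release A k v h =>
    obtain ⟨x, hx, hx'⟩ := hc
    rw [h x hx] at hx'
    simp at hx'
  | branch A k v w hw =>
    obtain ⟨b₁, b₂, h1, h2, h3, h4, h5⟩ := h w hw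
    rw [Option.some.inj ho]
    simp only [Finset.sdiff_singleton_eq_erase] at h4
    split_ifs with h6 h7 h7
    · exact ⟨[b₁, b₂], by simp [h3 h6, h4 h7.1 h7.2], by simp; linarith⟩
    · exact ⟨[b₁], by simp [h3 h6], by simp; linarith⟩
    · exact ⟨[b₂], by simp [h4 h7.1 h7.2], by simp; linarith⟩
    · exact ⟨[], by simp, by simp; linarith⟩

/-- The bound for the size of the search tree. -/
noncomputable def treeBound (k : ℕ) : ℝ := 1000 * (1.9102 : ℝ) ^ k

/-- The factor 1000 absorbs the additive constants of the estimates: the last one is 0.98 U + 9 + 1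
≤ U, which needs U ≥ 500. -/
theorem le_treeBound (k : ℕ) : 1000 ≤ treeBound k := by
  have : (1 : ℝ) ≤ (1.9102 : ℝ) ^ k := one_le_pow₀ (by norm_num)
  unfold treeBound
  linarith

/-- The decimals 0.52351, 0.27407 and 0.14349 used from here on are slightly larger than 1/1.9102,
its square and its cube. -/
theorem treeBound_sub_one {k : ℕ} (h : 1 ≤ k) : treeBound (k - 1) ≤ 0.52351 * treeBound k := by
  obtain ⟨j, rfl⟩ := Nat.exists_eq_add_of_le h
  have : (0 : ℝ) ≤ (1.9102 : ℝ) ^ j := by positivity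
  simp only [treeBound, Nat.add_sub_cancel_left, pow_add]
  nlinarith

theorem treeBound_mono {j k : ℕ} (h : j ≤ k) : treeBound j ≤ treeBound k := by
  have := pow_le_pow_right₀ (show (1 : ℝ) ≤ 1.9102 by norm_num) h
  unfold treeBound
  linarith

theorem treeBound_sub_two {k d : ℕ} (hd : 2 ≤ d) (h : d ≤ k) :
    treeBound (k - d) ≤ 0.27407 * treeBound k := by
  have h1 := treeBound_sub_one (show 1 ≤ k by omega)
  have h2 := treeBound_sub_one (show 1 ≤ k - 1 by omega)
  have h3 := treeBound_mono (show k - d ≤ k - 1 - 1 by omega)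
  have := le_treeBound k
  linarith

theorem treeBound_sub_three {k d : ℕ} (hd : 3 ≤ d) (h : d ≤ k) :
    treeBound (k - d) ≤ 0.14349 * treeBound k := by
  have h1 := treeBound_sub_one (show 1 ≤ k by omega)
  have h2 := treeBound_sub_two (k := k - 1) (d := d - 1) (by omega) (by omega)
  have h3 := treeBound_mono (show k - d ≤ k - 1 - (d - 1) by omega)
  have := le_treeBound k
  linarith

variable (G)

/-- Search trees below kept nodes of budget less than `K` are small. -/
def KeptBelow (K : ℕ) : Prop :=
  ∀ k < K, ∀ (A : Finset V) (v : V), Bounded G ⟨A, k, .kept v⟩ (treeBound k + 1)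

variable {G} {K k : ℕ} {A : Finset V} {v w : V}

theorem KeptBelow.sub (h : KeptBelow G K) (hk : k ≤ K) {d : ℕ} (hd : 0 < d) (hdk : d ≤ k)
    (A : Finset V) (v : V) {b : ℝ} (hb : treeBound (k - d) + 1 ≤ b) :
    Bounded G ⟨A, k - d, .kept v⟩ b :=
  (h (k - d) (by omega) A v).mono hb

/-- In the worst case the two children lose budget 2 and 1, and 0.27407 + 0.52351 < 0.7976. A vertex
with one conflict gives a single child. -/
theorem bounded_of_hasConf (h : KeptBelow G K) (hk : k ≤ K) (hc : HasConf G A v) :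
    Bounded G ⟨A, k, .kept v⟩ (0.7976 * treeBound k + 3) := by
  have hU := le_treeBound k
  refine bounded_kept (by linarith) hc fun w hw => ?_
  have hpos := hw.2.1
  by_cases h2 : 2 ≤ hdeg G A v w
  · refine ⟨0.27407 * treeBound k + 1, 0.52351 * treeBound k + 1, by linarith, by linarith,
      fun h1 => h.sub hk hpos h1 _ _ ?_, fun _ h1 => h.sub hk one_pos h1 _ _ ?_, by linarith⟩
    · linarith [treeBound_sub_two h2 h1]
    · linarith [treeBound_sub_one h1]
  · refine ⟨0.52351 * treeBound k + 1, 0, by linarith, le_rfl,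
      fun h1 => h.sub hk hpos h1 _ _ ?_, fun h3 => absurd h3 h2, by linarith⟩
    rw [show hdeg G A v w = 1 by omega] at h1 ⊢
    linarith [treeBound_sub_one h1]

/-- With a conflict the previous estimate has room to spare. Without one, the node is released into
a free node of the same budget, which explains the `+ 1` in `KeptBelow`. -/
theorem keptBelow_of_free (h : ∀ k < K, ∀ A, Bounded G ⟨A, k, .free⟩ (treeBound k)) :
    KeptBelow G K := by
  intro k
  induction k using Nat.strong_induction_on with
  | _ k ih =>
    intro hk A v
    have hU := le_treeBound k
    by_cases hc : HasConf G A v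
    · refine (bounded_of_hasConf (K := k) (fun j hj => ih j hj (hj.trans hk)) le_rfl hc).mono ?_
      linarith
    · refine Bounded.intro (by linarith) fun cs hcs => ?_
      generalize ho : some cs = o at hcs
      cases hcs with
      | release A k v h' =>
        rw [Option.some.inj ho]
        exact ⟨[treeBound k], by simp [h k hk A], by simp; linarith⟩
      | branch A k v w hw =>
        exact absurd ⟨w, hw.1, Finset.card_pos.1 hw.2.1⟩ hc

theorem Pref.hdeg_eq_one (hw : Pref G A v w) (hx : ∃ x ∈ nb G A v, hdeg G A v x = 1) :
    hdeg G A v w = 1 := by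
  obtain ⟨x, hx, hx1⟩ := hx
  rcases hw.2.2 with h | h
  · exact h
  · exact absurd hx1 (h x hx).1

theorem hasConf_of_hdeg_eq_one (hx : ∃ x ∈ nb G A v, hdeg G A v x = 1) : HasConf G A v := by
  obtain ⟨x, hx, hx1⟩ := hx
  exact ⟨x, hx, Finset.card_pos.1 (by unfold hdeg at hx1; omega)⟩

/-- The search tree when some vertex has one conflict, in terms of the trees after the deletion
of the conflict. -/
theorem bounded_of_hdeg_eq_one_aux {b : ℝ} (hb : 0 ≤ b)
    (hx : ∃ x ∈ nb G A v, hdeg G A v x = 1)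
    (h : 1 ≤ k → ∀ u ∈ nb G A v, hdeg G A v u = 1 →
      Bounded G ⟨A \ hn G A v u, k - 1, .kept v⟩ b) :
    Bounded G ⟨A, k, .kept v⟩ (b + 1) := by
  refine bounded_kept (by linarith) (hasConf_of_hdeg_eq_one hx) fun w hw => ?_
  have h1 := hw.hdeg_eq_one hx
  refine ⟨b, 0, hb, le_rfl, fun h2 => ?_, fun h2 => by omega, by linarith⟩
  rw [h1] at h2 ⊢
  exact h h2 w hw.1 h1

theorem bounded_of_hdeg_eq_one (h : KeptBelow G K) (hk : k ≤ K)
    (hx : ∃ x ∈ nb G A v, hdeg G A v x = 1) :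
    Bounded G ⟨A, k, .kept v⟩ (0.52351 * treeBound k + 2) := by
  have hU := le_treeBound k
  refine (bounded_of_hdeg_eq_one_aux (b := 0.52351 * treeBound k + 1) (by linarith) hx
    fun h1 u hu hu1 => h.sub hk one_pos h1 _ _ ?_).mono (by linarith)
  linarith [treeBound_sub_one h1]

theorem mem_hn_comm {x y : V} (hx : x ∈ nb G A v) (hy : y ∈ hn G A v x) (hvy : G.Adj v y) :
    y ∈ nb G A v ∧ x ∈ hn G A v y := by
  obtain ⟨hxA, hvx⟩ := mem_nb.1 hx
  obtain ⟨hyA, hc⟩ := mem_hn.1 hy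
  exact ⟨mem_nb.2 ⟨hyA, hvy⟩, mem_hn.2 ⟨hxA, hc.symm hvx hvy⟩⟩

theorem ne_of_mem_hn {x y : V} (hy : y ∈ hn G A v x) : y ≠ x := (mem_hn.1 hy).2.2.1

theorem hdeg_sdiff_singleton_of_mem {x : V} (h : w ∈ hn G A v x) :
    hdeg G (A \ {w}) v x + 1 = hdeg G A v x := by
  unfold hdeg
  rw [hn_sdiff, Finset.sdiff_singleton_eq_erase, Finset.card_erase_add_one h]

theorem hasConf_of_hdeg_pos {x : V} (hx : x ∈ nb G A v) (h : 0 < hdeg G A v x) : HasConf G A v :=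
  ⟨x, hx, Finset.card_pos.1 h⟩

/-- Without vertices that have one conflict, a vertex of the neighbourhood of `v` in conflict with
`w` keeps a conflict when `w` is deleted. -/
theorem mem_nb_sdiff_singleton (hn1 : ∀ x ∈ nb G A v, hdeg G A v x ≠ 1) {y : V}
    (hw : w ∈ nb G A v) (hy : y ∈ hn G A v w) (hvy : G.Adj v y) :
    y ∈ nb G (A \ {w}) v ∧ 0 < hdeg G (A \ {w}) v y ∧
      hdeg G (A \ {w}) v y + 1 = hdeg G A v y := by
  obtain ⟨hyn, hwy⟩ := mem_hn_comm hw hy hvy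
  have h1 := hdeg_sdiff_singleton_of_mem hwy
  have h2 := hn1 y hyn
  refine ⟨?_, by omega, h1⟩
  rw [nb_sdiff]
  simp [hyn, ne_of_mem_hn hy]

/-- When `w` is deleted, its inner conflict partner `y` still has conflicts, so the smaller factor
applies once more in that branch. With three conflicts at `w` this gives 0.14349 + 0.52351 · 0.7976;
with two, `y` is left with exactly one, which gives 0.27407 + 0.52351². -/
theorem bounded_of_inner (h : KeptBelow G K) (hk : k ≤ K) (hc : HasConf G A v)
    (hin : ∀ x ∈ nb G A v, 2 ≤ hdeg G A v x → ∃ y ∈ hn G A v x, G.Adj v y) :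
    Bounded G ⟨A, k, .kept v⟩ (0.5612 * treeBound k + 5) := by
  have hU := le_treeBound k
  by_cases hx : ∃ x ∈ nb G A v, hdeg G A v x = 1
  · exact (bounded_of_hdeg_eq_one h hk hx).mono (by linarith)
  push Not at hx
  refine bounded_kept (by linarith) hc fun w hw => ?_
  have hpos := hw.2.1
  have h2 : 2 ≤ hdeg G A v w := by
    have := hx w hw.1
    omega
  obtain ⟨y, hy, hvy⟩ := hin w hw.1 h2
  obtain ⟨hy1, hy2, hy3⟩ := mem_nb_sdiff_singleton hx hw.1 hy hvy
  by_cases h3 : 3 ≤ hdeg G A v w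
  · refine ⟨0.14349 * treeBound k + 1, 0.7976 * (0.52351 * treeBound k) + 3, by linarith,
      by linarith, fun h1 => h.sub hk hpos h1 _ _ ?_, fun _ h1 => ?_, by linarith⟩
    · linarith [treeBound_sub_three h3 h1]
    · refine (bounded_of_hasConf h (by omega) (hasConf_of_hdeg_pos hy1 hy2)).mono ?_
      linarith [treeBound_sub_one h1]
  · refine ⟨0.27407 * treeBound k + 1, 0.52351 * (0.52351 * treeBound k) + 2, by linarith,
      by linarith, fun h1 => h.sub hk hpos h1 _ _ ?_, fun _ h1 => ?_, by linarith⟩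
    · linarith [treeBound_sub_two h2 h1]
    · refine (bounded_of_hdeg_eq_one h (by omega) ⟨y, hy1, ?_⟩).mono ?_
      · rcases hw.2.2 with h4 | h4
        · omega
        · have := (h4 y (by rw [nb_sdiff] at hy1; exact (Finset.mem_sdiff.1 hy1).1)).2
          omega
      · linarith [treeBound_sub_one h1]

theorem exists_adj_of_two_mul_hout {x : V} (h : 2 * hout G A v x ≤ hdeg G A v x)
    (hpos : 0 < hdeg G A v x) : ∃ y ∈ hn G A v x, G.Adj v y := by
  by_contra hcon
  push Not at hcon
  have : hout G A v x = hdeg G A v x := by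
    unfold hout hdeg
    rw [Finset.filter_true_of_mem hcon]
  omega

/-- Apart from each other and from their common neighbours, the neighbours of `v` are the inner
conflicts of `x`, and those of `x` are its outer conflicts. Comparing the degrees shows that there
are at least as many inner as outer ones. -/
theorem two_mul_hout_le {x : V} (hv : v ∈ A) (hx : x ∈ nb G A v)
    (h : (nb G A x).card ≤ (nb G A v).card) : 2 * hout G A v x ≤ hdeg G A v x := by
  obtain ⟨hxA, hvx⟩ := mem_nb.1 hx
  have h1 : nb G A v = insert x ((nb G A v).filter (G.Adj x) ∪
      (hn G A v x).filter fun y => G.Adj v y) := by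
    ext y
    simp only [mem_nb, mem_hn, Finset.mem_insert, Finset.mem_union, Finset.mem_filter, Conf]
    constructor
    · rintro ⟨hy, hvy⟩
      have := hvy.ne'
      tauto
    · rintro (rfl | h) <;> tauto
  have h2 : nb G A x = insert v ((nb G A v).filter (G.Adj x) ∪
      (hn G A v x).filter fun y => ¬ G.Adj v y) := by
    ext y
    simp only [mem_nb, mem_hn, Finset.mem_insert, Finset.mem_union, Finset.mem_filter, Conf]
    constructor
    · rintro ⟨hy, hxy⟩
      have := hxy.ne'
      tauto
    · rintro (rfl | h)
      · exact ⟨hv, hvx.symm⟩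
      · tauto
  have h3 : (nb G A v).card = ((nb G A v).filter (G.Adj x)).card +
      ((hn G A v x).filter fun y => G.Adj v y).card + 1 := by
    conv_lhs => rw [h1]
    rw [Finset.card_insert_of_notMem, Finset.card_union_of_disjoint]
    · rw [Finset.disjoint_left]
      intro y hy hy'
      simp only [mem_hn, Finset.mem_filter, Conf] at hy hy'
      tauto
    · simp [mem_hn, Conf]
  have h4 : (nb G A x).card = ((nb G A v).filter (G.Adj x)).card + hout G A v x + 1 := by
    rw [h2, Finset.card_insert_of_notMem, Finset.card_union_of_disjoint]
    · rfl
    · rw [Finset.disjoint_left]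
      intro y hy hy'
      simp only [mem_nb, Finset.mem_filter] at hy hy'
      tauto
    · simp [mem_hn, mem_nb, Conf]
  have h5 := Finset.card_filter_add_card_filter_not (s := hn G A v x) (fun y => G.Adj v y)
  unfold hdeg
  unfold hout at h4 ⊢
  omega

/-- The deletion of `w` costs any vertex at most one conflict, while at most half of the old
conflicts are outer. So a vertex with two conflicts left has an inner one among them, and
`bounded_of_inner` applies after the deletion: 0.14349 + 0.52351 · 0.5612 < 0.4375. -/
theorem bounded_of_hdeg_three (h : KeptBelow G K) (hk : k ≤ K)
    (hm : ∀ x ∈ nb G A v, 2 * hout G A v x ≤ hdeg G A v x)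
    (hn1 : ∀ x ∈ nb G A v, hdeg G A v x ≠ 1) (h3 : ∃ x ∈ nb G A v, 3 ≤ hdeg G A v x) :
    Bounded G ⟨A, k, .kept v⟩ (0.4375 * treeBound k + 7) := by
  have hU := le_treeBound k
  obtain ⟨x, hx, hx3⟩ := h3
  refine bounded_kept (by linarith) (hasConf_of_hdeg_pos hx (by omega)) fun w hw => ?_
  have hpos := hw.2.1
  have hw3 : 3 ≤ hdeg G A v w := by
    rcases hw.2.2 with h4 | h4
    · exact absurd h4 (hn1 w hw.1)
    · exact hx3.trans (h4 x hx).2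
  obtain ⟨y, hy, hvy⟩ := exists_adj_of_two_mul_hout (hm w hw.1) hpos
  obtain ⟨hy1, hy2, hy3⟩ := mem_nb_sdiff_singleton hn1 hw.1 hy hvy
  refine ⟨0.14349 * treeBound k + 1, 0.5612 * (0.52351 * treeBound k) + 5, by linarith,
    by linarith, fun h1 => h.sub hk hpos h1 _ _ ?_, fun _ h1 => ?_, by linarith⟩
  · linarith [treeBound_sub_three hw3 h1]
  · refine (bounded_of_inner h (by omega) (hasConf_of_hdeg_pos hy1 hy2) ?_).mono ?_
    · intro z hz hz2
      by_contra hcon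
      push Not at hcon
      have hzn : z ∈ nb G A v := by
        rw [nb_sdiff] at hz
        exact (Finset.mem_sdiff.1 hz).1
      have hsub : hn G (A \ {w}) v z ⊆ (hn G A v z).filter fun y => ¬ G.Adj v y := by
        intro q hq
        refine Finset.mem_filter.2 ⟨?_, hcon q hq⟩
        rw [hn_sdiff] at hq
        exact (Finset.mem_sdiff.1 hq).1
      have h5 := Finset.card_le_card hsub
      have h6 : hdeg G A v z ≤ hdeg G (A \ {w}) v z + 1 := by
        unfold hdeg
        rw [hn_sdiff]
        have := Finset.le_card_sdiff {w} (hn G A v z)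
        rw [Finset.card_singleton] at this
        omega
      have h7 := hm z hzn
      unfold hout at h7
      unfold hdeg at hz2 h6 h7
      omega
    · linarith [treeBound_sub_one h1]

variable (G) in
/-- No endpoint of an edge of a component with more than two vertices has degree one. -/
def NoLeaf (A : Finset V) : Prop :=
  ∀ a ∈ A, ∀ b ∈ nb G A a, (nb G A a).card = 1 → (nb G A b).card = 1

theorem eq_pair {x u y : V} (h2 : hdeg G A v x = 2) (huy : u ≠ y)
    (h : ∀ q ∈ hn G A v x, q = u ∨ q = y) : hn G A v x = {u, y} := by
  refine Finset.eq_of_subset_of_card_le (fun q hq => by simpa using h q hq) ?_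
  rw [Finset.card_pair huy]
  exact h2.ge

theorem hout_pair {x u y : V} (h : hn G A v x = {u, y}) (hu : G.Adj v u) (hy : ¬ G.Adj v y) :
    hout G A v x = 1 := by
  unfold hout
  rw [h, Finset.filter_insert, Finset.filter_singleton, if_neg (by simpa using hu), if_pos hy]
  simp

theorem hout_eq_zero {x : V} (h : ∀ q ∈ hn G A v x, G.Adj v q) : hout G A v x = 0 := by
  unfold hout
  rw [Finset.card_eq_zero, Finset.filter_eq_empty_iff]
  simpa using h

/-- The only neighbour of `x` is `v` when `x` is in conflict with all other neighbours of `v` and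
with no other vertex. -/
theorem nb_eq_singleton {x : V} (hv : v ∈ A) (hx : x ∈ nb G A v)
    (hall : ∀ q ∈ nb G A v, q ≠ x → q ∈ hn G A v x) (hin : ∀ q ∈ hn G A v x, G.Adj v q) :
    nb G A x = {v} := by
  obtain ⟨hxA, hvx⟩ := mem_nb.1 hx
  ext q
  rw [mem_nb, Finset.mem_singleton]
  constructor
  · rintro ⟨hq, hxq⟩
    by_contra hqv
    by_cases hvq : G.Adj v q
    · exact (mem_hn.1 (hall q (mem_nb.2 ⟨hq, hvq⟩) hxq.ne')).2.2.2.1 hvq hxq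
    · exact hvq (hin q (mem_hn.2 ⟨hq, hqv, hxq.ne', by tauto⟩))
  · rintro rfl
    exact ⟨hv, hvx.symm⟩

theorem NoLeaf.card_le_one (hl : NoLeaf G A) {x : V} (hx : x ∈ nb G A v)
    (h : nb G A x = {v}) : (nb G A v).card ≤ 1 := by
  have hvx : v ∈ nb G A x := by simp [h]
  exact (hl x (mem_nb.1 hx).1 v hvx (by simp [h])).le

/-- By `hemp` the set {u, y} covers all conflicts. Any further vertex of N(v) is then in conflict
with exactly `u` and `y`, hence is one of the two partners `w`, `z` of `u`. So N(v) lies in {w, u,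
y, z}, and the few possible shapes are checked one by one. -/
theorem exists_hdeg_eq_one_of_pairs {u y z : V} (hv : v ∈ A)
    (hall : ∀ x ∈ nb G A v, hdeg G A v x = 2)
    (he : esum G A v ≠ 6) (hb : ¬ Butterfly G A v) (hl : NoLeaf G A)
    (hw : w ∈ nb G A v) (hu : u ∈ nb G A v) (hwn : hn G A v w = {u, y}) (huy : u ≠ y)
    (hun : hn G A v u = {w, z}) (hwz : w ≠ z)
    (hemp : ∀ x ∈ nb G A v, x ≠ u → x ≠ y → ∀ q ∈ hn G A v x, q = u ∨ q = y) :
    ∃ x ∈ nb G (A \ {w, z}) v, hdeg G (A \ {w, z}) v x = 1 := by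
  have hwu : w ≠ u := (ne_of_mem_hn (show u ∈ hn G A v w by simp [hwn])).symm
  have hwy : y ≠ w := ne_of_mem_hn (show y ∈ hn G A v w by simp [hwn])
  have huz : z ≠ u := ne_of_mem_hn (show z ∈ hn G A v u by simp [hun])
  have hvw := (mem_nb.1 hw).2
  have hvu := (mem_nb.1 hu).2
  have hyA : y ∈ A := (mem_hn.1 (show y ∈ hn G A v w by simp [hwn])).1
  have hother : ∀ x ∈ nb G A v, x ≠ w → x ≠ u → x ≠ y → x = z ∧ hn G A v x = {u, y} := by
    intro x hx hxw hxu hxy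
    have h1 := eq_pair (hall x hx) huy (hemp x hx hxu hxy)
    have h2 := (mem_hn_comm hx (show u ∈ hn G A v x by simp [h1]) hvu).2
    rw [hun, Finset.mem_insert, Finset.mem_singleton] at h2
    tauto
  by_cases hvy : G.Adj v y
  · have hy : y ∈ nb G A v := mem_nb.2 ⟨hyA, hvy⟩
    have hwy' := (mem_hn_comm hw (show y ∈ hn G A v w by simp [hwn]) hvy).2
    by_cases hyz : y = z
    -- Three mutual conflicts inside N(v): `esum` counts each of them twice and is 6.
    · subst hyz
      exfalso
      apply he
      have huy' := (mem_hn_comm hu (show y ∈ hn G A v u by simp [hun]) hvy).2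
      have hN : nb G A v = {w, u, y} := by
        ext x
        simp only [Finset.mem_insert, Finset.mem_singleton]
        constructor
        · intro hx
          by_contra hcon
          push Not at hcon
          exact hcon.2.2 (hother x hx hcon.1 hcon.2.1 hcon.2.2).1
        · rintro (rfl | rfl | rfl) <;> assumption
      have hyn : hn G A v y = {w, u} := by
        symm
        apply Finset.eq_of_subset_of_card_le
        · intro q hq
          simp only [Finset.mem_insert, Finset.mem_singleton] at hq
          rcases hq with rfl | rfl <;> assumption
        · rw [Finset.card_pair hwu]
          exact (hall y hy).le
      unfold esum
      rw [hN, Finset.sum_insert (by simp [hwu, hwy.symm]), Finset.sum_insert (by simp [huy]),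
        Finset.sum_singleton, hall w hw, hall u hu, hall y hy,
        hout_eq_zero (x := w) (by simp [hwn, hvu, hvy]),
        hout_eq_zero (x := u) (by simp [hun, hvw, hvy]),
        hout_eq_zero (x := y) (by simp [hyn, hvw, hvu])]
      rfl
    · by_cases hvz : G.Adj v z
      -- The conflicts form the cycle w, u, z, y inside N(v), which is a butterfly.
      · exfalso
        have hz : z ∈ nb G A v :=
          (mem_hn_comm hu (show z ∈ hn G A v u by simp [hun]) hvz).1
        have hzn := (hother z hz hwz.symm huz (Ne.symm hyz)).2
        have hyz' := (mem_hn_comm hz (show y ∈ hn G A v z by simp [hzn]) hvy).2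
        have hyn : hn G A v y = {w, z} := by
          symm
          apply Finset.eq_of_subset_of_card_le
          · intro q hq
            simp only [Finset.mem_insert, Finset.mem_singleton] at hq
            rcases hq with rfl | rfl <;> assumption
          · rw [Finset.card_pair hwz]
            exact (hall y hy).le
        have hN : nb G A v = {w, u, y, z} := by
          ext x
          simp only [Finset.mem_insert, Finset.mem_singleton]
          constructor
          · intro hx
            by_contra hcon
            push Not at hcon
            exact hcon.2.2.2 (hother x hx hcon.1 hcon.2.1 hcon.2.2.1).1
          · rintro (rfl | rfl | rfl | rfl) <;> assumption
        refine hb ⟨?_, fun x hx => ⟨hall x hx, ?_⟩⟩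
        · rw [hN, Finset.card_insert_of_notMem, Finset.card_insert_of_notMem, Finset.card_pair hyz]
          · simp [huy, huz.symm]
          · simp [hwu, hwy.symm, hwz]
        · rw [hN] at hx
          simp only [Finset.mem_insert, Finset.mem_singleton] at hx
          rcases hx with rfl | rfl | rfl | rfl
          · exact hout_eq_zero (by simp [hwn, hvu, hvy])
          · exact hout_eq_zero (by simp [hun, hvw, hvz])
          · exact hout_eq_zero (by simp [hyn, hvw, hvz])
          · exact hout_eq_zero (by simp [hzn, hvu, hvy])
      · have hN : nb G A v = {w, u, y} := by
          ext x
          simp only [Finset.mem_insert, Finset.mem_singleton]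
          constructor
          · intro hx
            by_contra hcon
            push Not at hcon
            have := (hother x hx hcon.1 hcon.2.1 hcon.2.2).1
            exact hvz (this ▸ (mem_nb.1 hx).2)
          · rintro (rfl | rfl | rfl) <;> assumption
        obtain ⟨q, hq, hqw⟩ : ∃ q ∈ hn G A v y, q ≠ w := by
          by_contra hcon
          push Not at hcon
          have : hn G A v y ⊆ {w} := fun q hq => by simpa using hcon q hq
          have h1 := Finset.card_le_card this
          have h2 := hall y hy
          rw [Finset.card_singleton] at h1
          unfold hdeg at h2
          omega
        have hyn : hn G A v y = {w, q} := by
          symm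
          apply Finset.eq_of_subset_of_card_le
          · intro p hp
            simp only [Finset.mem_insert, Finset.mem_singleton] at hp
            rcases hp with rfl | rfl <;> assumption
          · rw [Finset.card_pair hqw.symm]
            exact (hall y hy).le
        by_cases hqz : q = z
        -- Here `w` is in conflict with all other neighbours of `v` and with nothing else, so it is
        -- a leaf at a vertex of degree three.
        · exfalso
          have := hl.card_le_one hw (nb_eq_singleton hv hw (by
            intro p hp hpw
            rw [hN] at hp
            rw [hwn]
            simp only [Finset.mem_insert, Finset.mem_singleton] at hp ⊢
            tauto) (by simp [hwn, hvu, hvy]))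
          rw [hN, Finset.card_insert_of_notMem (by simp [hwu, hwy.symm]),
            Finset.card_pair huy] at this
          omega
        · refine ⟨y, ?_, ?_⟩
          · rw [nb_sdiff]
            simp [hy, hwy, hyz]
          · unfold hdeg
            rw [hn_sdiff, hyn, Finset.card_eq_one]
            refine ⟨q, ?_⟩
            ext p
            simp only [Finset.mem_sdiff, Finset.mem_insert, Finset.mem_singleton]
            constructor
            · tauto
            · rintro rfl
              tauto
  · exfalso
    -- With `y` outside N(v) there are two shapes: N(v) = {w, u, z}, where `u` would be a leaf, or
    -- N(v) = {w, u} with the three conflicts wu, wy and uz, so that `esum` is 6.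
    by_cases hz : z ∈ nb G A v ∧ z ≠ y
    · have hvz := (mem_nb.1 hz.1).2
      have hN : nb G A v = {w, u, z} := by
        ext x
        simp only [Finset.mem_insert, Finset.mem_singleton]
        constructor
        · intro hx
          by_contra hcon
          push Not at hcon
          exact hcon.2.2 (hother x hx hcon.1 hcon.2.1
            (fun h => hvy (h ▸ (mem_nb.1 hx).2))).1
        · rintro (rfl | rfl | rfl)
          exacts [hw, hu, hz.1]
      have := hl.card_le_one hu (nb_eq_singleton hv hu (by
        intro p hp hpw
        rw [hN] at hp
        rw [hun]
        simp only [Finset.mem_insert, Finset.mem_singleton] at hp ⊢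
        tauto) (by simp [hun, hvw, hvz]))
      rw [hN, Finset.card_insert_of_notMem (by simp [hwu, hwz]),
        Finset.card_pair huz.symm] at this
      omega
    · have hvz : ¬ G.Adj v z := by
        intro hvz
        have h1 := (mem_hn_comm hu (show z ∈ hn G A v u by simp [hun]) hvz).1
        exact hz ⟨h1, fun h => hvy (h ▸ hvz)⟩
      have hN : nb G A v = {w, u} := by
        ext x
        simp only [Finset.mem_insert, Finset.mem_singleton]
        constructor
        · intro hx
          by_contra hcon
          push Not at hcon
          have := (hother x hx hcon.1 hcon.2 (fun h => hvy (h ▸ (mem_nb.1 hx).2))).1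
          exact hvz (this ▸ (mem_nb.1 hx).2)
        · rintro (rfl | rfl)
          exacts [hw, hu]
      apply he
      unfold esum
      rw [hN, Finset.sum_pair hwu, hall w hw, hall u hu, hout_pair hwn hvu hvy,
        hout_pair hun hvw hvz]

end Running

/-! ### Size of the search tree: chosen vertices and the final bound. -/

section Bounds

variable {V : Type*} [DecidableEq V] {G : SimpleGraph V} [DecidableRel G.Adj]
variable {K k : ℕ} {A : Finset V} {v w : V}

theorem hn_eq_pair_of_mem {x u : V} (h : hdeg G A v x = 2) (hu : u ∈ hn G A v x) :
    ∃ y, u ≠ y ∧ hn G A v x = {u, y} := by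
  unfold hdeg at h
  obtain ⟨a, b, hab, he⟩ := Finset.card_eq_two.1 h
  rw [he, Finset.mem_insert, Finset.mem_singleton] at hu
  rcases hu with rfl | rfl
  · exact ⟨b, hab, he⟩
  · exact ⟨a, hab.symm, by rw [he, Finset.pair_comm]⟩

theorem not_hasConf_pair {u y : V} (h : ¬ HasConf G (A \ {u, y}) v) :
    ∀ x ∈ nb G A v, x ≠ u → x ≠ y → ∀ q ∈ hn G A v x, q = u ∨ q = y := by
  intro x hx hxu hxy q hq
  by_contra hcon
  push Not at hcon
  refine h ⟨x, ?_, q, ?_⟩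
  · rw [nb_sdiff]
    simp [hx, hxu, hxy]
  · rw [hn_sdiff]
    simp [hq, hcon]

/-- A vertex with one conflict after the deletion of `w` had one more before. -/
theorem exists_pair_of_hdeg_sdiff {u : V} (hall : ∀ x ∈ nb G A v, hdeg G A v x = 2)
    (hw : w ∈ nb G A v) (hu : u ∈ nb G (A \ {w}) v) (h1 : hdeg G (A \ {w}) v u = 1) :
    u ∈ nb G A v ∧ ∃ y z, hn G A v w = {u, y} ∧ u ≠ y ∧ hn G A v u = {w, z} ∧ w ≠ z ∧
      (A \ {w}) \ hn G (A \ {w}) v u = A \ {w, z} := by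
  rw [nb_sdiff, Finset.mem_sdiff, Finset.mem_singleton] at hu
  have hwu : w ∈ hn G A v u := by
    by_contra hcon
    have h2 : hn G (A \ {w}) v u = hn G A v u := by
      rw [hn_sdiff, Finset.sdiff_singleton_eq_erase, Finset.erase_eq_of_notMem hcon]
    have h3 := hall u hu.1
    unfold hdeg at h1 h3
    rw [h2] at h1
    omega
  have huw := (mem_hn_comm hu.1 hwu (mem_nb.1 hw).2).2
  obtain ⟨z, hwz, hz⟩ := hn_eq_pair_of_mem (hall u hu.1) hwu
  obtain ⟨y, huy, hy⟩ := hn_eq_pair_of_mem (hall w hw) huw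
  refine ⟨hu.1, y, z, hy, huy, hz, hwz, ?_⟩
  rw [hn_sdiff, hz]
  ext q
  simp only [Finset.mem_sdiff, Finset.mem_insert, Finset.mem_singleton]
  tauto

/-- The inner conflict partner of `w` drops from two conflicts to one when `w` is deleted, so no
real branching follows: 0.27407 + 0.52351² < 0.5482. -/
theorem bounded_of_hdeg_two (h : KeptBelow G K) (hk : k ≤ K) (hc : HasConf G A v)
    (hm : ∀ x ∈ nb G A v, 2 * hout G A v x ≤ hdeg G A v x)
    (hall : ∀ x ∈ nb G A v, hdeg G A v x = 0 ∨ hdeg G A v x = 2) :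
    Bounded G ⟨A, k, .kept v⟩ (0.5482 * treeBound k + 5) := by
  have hU := le_treeBound k
  refine bounded_kept (by linarith) hc fun w hw => ?_
  have hpos := hw.2.1
  have h2 : hdeg G A v w = 2 := (hall w hw.1).resolve_left (by omega)
  obtain ⟨y, hy, hvy⟩ := exists_adj_of_two_mul_hout (hm w hw.1) hpos
  obtain ⟨hy1, hy2, hy3⟩ := mem_nb_sdiff_singleton (fun x hx => by have := hall x hx; omega)
    hw.1 hy hvy
  refine ⟨0.27407 * treeBound k + 1, 0.52351 * (0.52351 * treeBound k) + 2, by linarith,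
    by linarith, fun h1 => h.sub hk hpos h1 _ _ ?_, fun _ h1 => ?_, by linarith⟩
  · linarith [treeBound_sub_two h2.ge h1]
  · refine (bounded_of_hdeg_eq_one h (by omega) ⟨y, hy1, ?_⟩).mono ?_
    · have := hall y (mem_hn_comm hw.1 hy hvy).1
      omega
    · linarith [treeBound_sub_one h1]

/-- Both branches end up two units of budget lower, since the deletion of `w` leaves a vertex with
one conflict whose partner is deleted next. If conflicts remain on both sides, each side gains the
factor 0.7976 on top of about 0.274. If one side is exhausted, `exists_hdeg_eq_one_of_pairs`
supplies a vertex with one conflict on the other, and the total is about 0.274 + 0.1435. -/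
theorem bounded_of_pairs (h : KeptBelow G K) (hk : k ≤ K) (hv : v ∈ A) (hc : HasConf G A v)
    (hm : ∀ x ∈ nb G A v, 2 * hout G A v x ≤ hdeg G A v x)
    (hall : ∀ x ∈ nb G A v, hdeg G A v x = 2)
    (he : esum G A v ≠ 6) (hb : ¬ Butterfly G A v) (hl : NoLeaf G A) :
    Bounded G ⟨A, k, .kept v⟩ (0.4375 * treeBound k + 8) := by
  have hU := le_treeBound k
  refine bounded_kept (by linarith) hc fun w hw => ?_
  have h2 : hdeg G A v w = 2 := hall w hw.1
  rw [h2]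
  obtain ⟨u₀, hu₀, hvu₀⟩ := exists_adj_of_two_mul_hout (hm w hw.1) hw.2.1
  obtain ⟨hu1, hu2, hu3⟩ := mem_nb_sdiff_singleton (fun x hx => by have := hall x hx; omega)
    hw.1 hu₀ hvu₀
  have hone : ∃ x ∈ nb G (A \ {w}) v, hdeg G (A \ {w}) v x = 1 := by
    refine ⟨u₀, hu1, ?_⟩
    have := hall u₀ (mem_hn_comm hw.1 hu₀ hvu₀).1
    omega
  by_cases hrem : HasConf G (A \ hn G A v w) v
  · by_cases hall' : ∀ u ∈ nb G (A \ {w}) v, hdeg G (A \ {w}) v u = 1 →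
        HasConf G ((A \ {w}) \ hn G (A \ {w}) v u) v
    · refine ⟨0.7976 * (0.27407 * treeBound k) + 3,
        0.7976 * (0.52351 * (0.52351 * treeBound k)) + 3 + 1, by linarith,
        by linarith, fun h1 => ?_, fun _ h1 => ?_, by linarith⟩
      · refine (bounded_of_hasConf h (by omega) hrem).mono ?_
        linarith [treeBound_sub_two le_rfl h1]
      · refine bounded_of_hdeg_eq_one_aux (by linarith) hone fun h3 u hu hu1 => ?_
        refine (bounded_of_hasConf h (by omega) (hall' u hu hu1)).mono ?_
        linarith [treeBound_sub_one h1, treeBound_sub_one h3]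
    · push Not at hall'
      obtain ⟨u, hu, hu1, hnc⟩ := hall'
      obtain ⟨hun, y, z, hwy, huy, huz, hwz, hA⟩ := exists_pair_of_hdeg_sdiff hall hw.1 hu hu1
      rw [hA] at hnc
      -- Here {w, z} is the exhausted side, so `u`, `w` and `y`, `z` exchange their roles.
      have hex := exists_hdeg_eq_one_of_pairs hv hall he hb hl hun hw.1 huz hwz hwy huy
        (not_hasConf_pair hnc)
      rw [← hwy] at hex
      refine ⟨0.52351 * (0.27407 * treeBound k) + 2,
        0.52351 * (0.52351 * treeBound k) + 2, by linarith,
        by linarith, fun h1 => ?_, fun _ h1 => ?_, by linarith⟩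
      · refine (bounded_of_hdeg_eq_one h (by omega) hex).mono ?_
        linarith [treeBound_sub_two le_rfl h1]
      · refine (bounded_of_hdeg_eq_one h (by omega) hone).mono ?_
        linarith [treeBound_sub_one h1]
  · refine ⟨0.27407 * treeBound k + 1,
      0.52351 * (0.52351 * (0.52351 * treeBound k)) + 2 + 1, by linarith,
      by linarith, fun h1 => h.sub hk two_pos h1 _ _ ?_, fun _ h1 => ?_, by linarith⟩
    · linarith [treeBound_sub_two le_rfl h1]
    · refine bounded_of_hdeg_eq_one_aux (by linarith) hone fun h3 u hu hu1 => ?_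
      obtain ⟨hun, y, z, hwy, huy, huz, hwz, hA⟩ := exists_pair_of_hdeg_sdiff hall hw.1 hu hu1
      rw [hwy] at hrem
      have hex := exists_hdeg_eq_one_of_pairs hv hall he hb hl hw.1 hun hwy huy huz hwz
        (not_hasConf_pair hrem)
      rw [← hA] at hex
      refine (bounded_of_hdeg_eq_one h (by omega) hex).mono ?_
      linarith [treeBound_sub_one h1, treeBound_sub_one h3]

/-- There are three conflicts in all. If N(v) had three vertices, they would be mutually in conflict
and `w` a leaf. So N(v) = {w, u}, with outer partners `y` of `w` and `z` of `u`. Without `v`, the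
path w, y, u remains if y = z; otherwise `y` has a second neighbour `q`, as it is no leaf, and w, y,
q is an induced path. -/
theorem hasConf_of_esum_eq_six (hv : v ∈ A)
    (hm : ∀ x ∈ nb G A v, 2 * hout G A v x ≤ hdeg G A v x)
    (hall : ∀ x ∈ nb G A v, hdeg G A v x = 2) (he : esum G A v = 6) (hl : NoLeaf G A)
    (hw : w ∈ nb G A v) : HasConf G (A \ {v}) w := by
  obtain ⟨u, hu, hvu⟩ := exists_adj_of_two_mul_hout (hm w hw) (by rw [hall w hw]; omega)
  obtain ⟨hun, hwu⟩ := mem_hn_comm hw hu hvu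
  obtain ⟨y, huy, hwn⟩ := hn_eq_pair_of_mem (hall w hw) hu
  obtain ⟨z, hwz, hunz⟩ := hn_eq_pair_of_mem (hall u hun) hwu
  obtain ⟨hwA, hvw⟩ := mem_nb.1 hw
  obtain ⟨huA, -⟩ := mem_nb.1 hun
  have hwu' : w ≠ u := ne_of_mem_hn hwu
  have hsub : ({w, u} : Finset V) ⊆ nb G A v := by
    intro x hx
    simp only [Finset.mem_insert, Finset.mem_singleton] at hx
    rcases hx with rfl | rfl <;> assumption
  have hcard := Finset.card_le_card hsub
  rw [Finset.card_pair hwu'] at hcard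
  have hsum : 2 * (nb G A v).card + ∑ x ∈ nb G A v, hout G A v x = 6 := by
    rw [← he, esum, Finset.sum_add_distrib, Finset.sum_congr rfl hall, Finset.sum_const,
      smul_eq_mul, mul_comm]
  by_cases h3 : (nb G A v).card = 3
  · exfalso
    have h0 : ∑ x ∈ nb G A v, hout G A v x = 0 := by omega
    rw [Finset.sum_eq_zero_iff] at h0
    have hin : ∀ q ∈ hn G A v w, G.Adj v q := by
      intro q hq
      by_contra hvq
      have h1 := h0 w hw
      rw [hout, Finset.card_eq_zero, Finset.filter_eq_empty_iff] at h1
      exact h1 hq hvq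
    have heq : hn G A v w = (nb G A v).erase w := by
      apply Finset.eq_of_subset_of_card_le
      · intro q hq
        exact Finset.mem_erase.2 ⟨ne_of_mem_hn hq, (mem_hn_comm hw hq (hin q hq)).1⟩
      · rw [Finset.card_erase_of_mem hw, h3]
        exact (hall w hw).ge
    have := hl.card_le_one hw (nb_eq_singleton hv hw (by
      intro q hq hqw
      rw [heq]
      exact Finset.mem_erase.2 ⟨hqw, hq⟩) hin)
    omega
  have hN : {w, u} = nb G A v := by
    apply Finset.eq_of_subset_of_card_le hsub
    rw [Finset.card_pair hwu']
    omega
  have hcases : ∀ q ∈ nb G A v, q = w ∨ q = u := by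
    intro q hq
    rw [← hN] at hq
    simpa using hq
  obtain ⟨hyA, hyv, hyw, hyc⟩ := mem_hn.1 (show y ∈ hn G A v w by simp [hwn])
  obtain ⟨hzA, hzv, hzu, hzc⟩ := mem_hn.1 (show z ∈ hn G A v u by simp [hunz])
  have hvy : ¬ G.Adj v y := by
    intro hvy
    rcases hcases y (mem_nb.2 ⟨hyA, hvy⟩) with h | h
    · exact hyw h
    · exact huy h.symm
  have hwy : G.Adj w y := by tauto
  have hnwu : ¬ G.Adj w u := (mem_hn.1 hu).2.2.2.1 hvu
  have hyn : y ∈ nb G (A \ {v}) w := by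
    rw [nb_sdiff]
    simp [mem_nb, hyA, hwy, hyv]
  by_cases hyz : y = z
  · subst hyz
    have huy' : G.Adj u y := by tauto
    refine ⟨y, hyn, u, ?_⟩
    rw [hn_sdiff]
    simp only [Finset.mem_sdiff, Finset.mem_singleton, mem_hn]
    exact ⟨⟨huA, hwu'.symm, huy, by simp [hnwu, huy'.symm]⟩, hvu.ne'⟩
  · obtain ⟨q, hq, hqw⟩ : ∃ q ∈ nb G A y, q ≠ w := by
      by_contra hcon
      push Not at hcon
      have hwy' : w ∈ nb G A y := mem_nb.2 ⟨hwA, hwy.symm⟩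
      have h1 : nb G A y = {w} := by
        ext q
        rw [Finset.mem_singleton]
        exact ⟨hcon q, fun h => h ▸ hwy'⟩
      have h4 := hl y hyA w hwy' (by rw [h1, Finset.card_singleton])
      have h5 : ({v, y} : Finset V) ⊆ nb G A w := by
        intro x hx
        simp only [Finset.mem_insert, Finset.mem_singleton] at hx
        rcases hx with rfl | rfl
        · exact mem_nb.2 ⟨hv, hvw.symm⟩
        · exact mem_nb.2 ⟨hyA, hwy⟩
      have h6 := Finset.card_le_card h5
      rw [Finset.card_pair hyv.symm] at h6
      omega
    obtain ⟨hqA, hyq⟩ := mem_nb.1 hq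
    have hqv : q ≠ v := by
      rintro rfl
      exact hvy hyq.symm
    have hnwq : ¬ G.Adj w q := by
      intro hwq
      by_cases hvq : G.Adj v q
      · rcases hcases q (mem_nb.2 ⟨hqA, hvq⟩) with h | h
        · exact hqw h
        · exact hnwu (h ▸ hwq)
      · have : q ∈ hn G A v w := mem_hn.2 ⟨hqA, hqv, hqw, by tauto⟩
        rw [hwn, Finset.mem_insert, Finset.mem_singleton] at this
        rcases this with rfl | rfl
        · exact hvq hvu
        · exact G.irrefl hyq
    refine ⟨y, hyn, q, ?_⟩
    rw [hn_sdiff]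
    simp only [Finset.mem_sdiff, Finset.mem_singleton, mem_hn]
    exact ⟨⟨hqA, hqw, hyq.ne', by simp [hnwq, hyq]⟩, hqv⟩

/-- The factors for deleting and for keeping `v` add up as follows. One conflict at some vertex:
0.52351 + 0.52351 · 0.7976, as H is no star and conflicts remain after the forced deletion. Three
conflicts at some vertex: 0.52351 + 0.4375. Only zero or two conflicts, with a twin: 0.27407 +
0.5482. Always two conflicts and `esum` 6: 0.52351 · 0.7976 + 0.5482. Always two conflicts
otherwise: 0.52351 + 0.4375. -/
theorem bounded_split {m : Mode V} (h : KeptBelow G k)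
    (hf : ∀ j < k, ∀ A, Bounded G ⟨A, j, .free⟩ (treeBound j)) (hv : v ∈ A)
    (hs : Suitable G A v) (hw : Pref G A v w)
    (hstar : ∀ y ∈ nb G A v, ¬ Covers G A v y y) (hb : ¬ Butterfly G A v)
    (hm : (m = .kept w ∧ ∃ c, Covers G A v w c) ∨
        (m = .free ∧ esum G A v ≠ 2 * (hdeg G A v w + 1))) :
    ∃ b₁ b₂ : ℝ, 0 ≤ b₁ ∧ Bounded G ⟨A, k, .kept v⟩ b₂ ∧
      (1 + (twins G A v).card ≤ k →
        Bounded G ⟨A \ insert v (twins G A v), k - (1 + (twins G A v).card), m⟩ b₁) ∧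
      b₁ + b₂ ≤ 0.98 * treeBound k + 8 := by
  have hU := le_treeBound k
  -- If `v` has a single neighbour, that neighbour covers all conflicts, which `hstar` excludes.
  obtain ⟨hdegm, hl⟩ := hs.resolve_left fun h1 => by
    obtain ⟨y, hy⟩ := Finset.card_eq_one.1 h1
    refine hstar y (by simp [hy]) fun x hx z _ => Or.inl ?_
    simpa [hy] using hx
  have hmul : ∀ x ∈ nb G A v, 2 * hout G A v x ≤ hdeg G A v x := fun x hx =>
    two_mul_hout_le hv hx (hdegm x hx)
  have hc : HasConf G A v := hasConf_of_hdeg_pos hw.1 hw.2.1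
  have hgen : ∀ d, 0 < d → d ≤ k → ∀ B, Bounded G ⟨B, k - d, m⟩ (treeBound (k - d) + 1) := by
    intro d hd hdk B
    rcases hm with ⟨rfl, -⟩ | ⟨rfl, -⟩
    · exact h.sub le_rfl hd hdk B w le_rfl
    · exact (hf (k - d) (by omega) B).mono (by linarith)
  have hgen1 : ∀ B, 1 + (twins G A v).card ≤ k →
      Bounded G ⟨B, k - (1 + (twins G A v).card), m⟩ (0.52351 * treeBound k + 1) := by
    intro B hB
    refine (hgen _ (by omega) hB B).mono ?_
    have h1 := treeBound_mono (show k - (1 + (twins G A v).card) ≤ k - 1 by omega)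
    linarith [treeBound_sub_one (show 1 ≤ k by omega)]
  by_cases h1 : ∃ x ∈ nb G A v, hdeg G A v x = 1
  · refine ⟨_, 0.7976 * (0.52351 * treeBound k) + 3 + 1, by linarith, ?_, hgen1 _, by linarith⟩
    refine bounded_of_hdeg_eq_one_aux (by linarith) h1 fun hk1 u hu hu1 => ?_
    refine (bounded_of_hasConf h (by omega) ?_).mono (by linarith [treeBound_sub_one hk1])
    obtain ⟨y, hy, hvy⟩ := exists_adj_of_two_mul_hout (hmul u hu) (by omega)
    have hyn := (mem_hn_comm hu hy hvy).1
    have hun : hn G A v u = {y} := by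
      unfold hdeg at hu1
      obtain ⟨y', hy'⟩ := Finset.card_eq_one.1 hu1
      rw [hy', Finset.mem_singleton] at hy
      rw [hy', hy]
    have hcov := hstar y hyn
    unfold Covers at hcov
    push Not at hcov
    obtain ⟨x, hx, q, hq, hxy, hqy, -, -⟩ := hcov
    refine ⟨x, ?_, q, ?_⟩
    · rw [nb_sdiff, hun]
      simp [hx, hxy]
    · rw [hn_sdiff, hun]
      simp [hq, hqy]
  push Not at h1
  by_cases h3 : 3 ≤ hdeg G A v w
  · exact ⟨_, _, by linarith, bounded_of_hdeg_three h le_rfl hmul h1 ⟨w, hw.1, h3⟩, hgen1 _,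
      by linarith⟩
  have hle : ∀ x ∈ nb G A v, hdeg G A v x ≤ hdeg G A v w := by
    rcases hw.2.2 with h4 | h4
    · exact absurd h4 (h1 w hw.1)
    · exact fun x hx => (h4 x hx).2
  have hw2 : hdeg G A v w = 2 := by
    have := h1 w hw.1
    have := hw.2.1
    omega
  have hall : ∀ x ∈ nb G A v, hdeg G A v x = 0 ∨ hdeg G A v x = 2 := by
    intro x hx
    have := h1 x hx
    have := hle x hx
    omega
  by_cases hT : twins G A v = ∅
  · have hall2 : ∀ x ∈ nb G A v, hdeg G A v x = 2 := by
      intro x hx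
      refine (hall x hx).resolve_left fun h0 => ?_
      have : x ∈ twins G A v := mem_twins.2 ⟨hx, Finset.card_eq_zero.1 h0⟩
      rw [hT] at this
      simp at this
    by_cases he : esum G A v = 6
    · obtain ⟨rfl, -⟩ := hm.resolve_right fun h4 => h4.2 (by rw [he, hw2])
      refine ⟨0.7976 * (0.52351 * treeBound k) + 3, _, by linarith,
        bounded_of_hdeg_two h le_rfl hc hmul hall, fun hk1 => ?_, by linarith⟩
      simp only [hT, Finset.card_empty, add_zero, insert_empty_eq] at hk1 ⊢
      refine (bounded_of_hasConf h (by omega)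
        (hasConf_of_esum_eq_six hv hmul hall2 he hl hw.1)).mono ?_
      linarith [treeBound_sub_one hk1]
    · exact ⟨_, _, by linarith, bounded_of_pairs h le_rfl hv hc hmul hall2 he hb hl, hgen1 _,
        by linarith⟩
  · have hT1 : 0 < (twins G A v).card := Finset.card_pos.2 (Finset.nonempty_iff_ne_empty.2 hT)
    refine ⟨0.27407 * treeBound k + 1, _, by linarith,
      bounded_of_hdeg_two h le_rfl hc hmul hall, fun hk1 => ?_, by linarith⟩
    refine (hgen _ (by omega) hk1 _).mono ?_
    linarith [treeBound_sub_two (show 2 ≤ 1 + (twins G A v).card by omega) hk1]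

theorem bounded_fresh (h : KeptBelow G k)
    (hf : ∀ j < k, ∀ A, Bounded G ⟨A, j, .free⟩ (treeBound j)) (hv : v ∈ A)
    (hc : HasConf G A v) (hs : Suitable G A v) :
    Bounded G ⟨A, k, .fresh v⟩ (0.98 * treeBound k + 9) := by
  have hU := le_treeBound k
  refine Bounded.intro (by linarith) fun cs hcs => ?_
  generalize ho : some cs = o at hcs
  cases hcs with
  | star A k v y hy =>
    rw [Option.some.inj ho]
    exact ⟨[0.7976 * treeBound k + 3], by simp [bounded_of_hasConf h le_rfl hc],
      by simp; linarith⟩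
  | butterfly A k v w hb hw =>
    rw [Option.some.inj ho]
    refine ⟨[0.7976 * treeBound k + 3], ?_, by simp; linarith⟩
    have : HasConf G A w := by
      obtain ⟨hwA, hvw⟩ := mem_nb.1 hw
      obtain ⟨y, hy⟩ := Finset.card_pos.1 (show 0 < (hn G A v w).card by
        have := (hb.2 w hw).1
        unfold hdeg at this
        omega)
      have hvy : G.Adj v y := by
        by_contra hvy
        have h0 := (hb.2 w hw).2
        rw [hout, Finset.card_eq_zero, Finset.filter_eq_empty_iff] at h0
        exact h0 hy hvy
      obtain ⟨hyA, hyv, hyw, hyc⟩ := mem_hn.1 hy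
      exact ⟨v, mem_nb.2 ⟨hv, hvw.symm⟩, y, mem_hn.2 ⟨hyA, hyw, hyv, by tauto⟩⟩
    simp [bounded_of_hasConf h le_rfl this]
  | split A k v w m hw hstar hb hm =>
    obtain ⟨b₁, b₂, h1, h2, h3, h4⟩ := bounded_split h hf hv hs hw hstar hb hm
    rw [Option.some.inj ho]
    split_ifs with hk1
    · exact ⟨[b₁, b₂], by simp [h3 hk1, h2], by simp; linarith⟩
    · exact ⟨[b₂], by simp [h2], by simp; linarith⟩

theorem bounded_free (k : ℕ) (A : Finset V) :
    Bounded G ⟨A, k, .free⟩ (treeBound k) := by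
  induction k using Nat.strong_induction_on generalizing A with
  | _ k ih =>
    have hU := le_treeBound k
    refine Bounded.intro (by linarith) fun cs hcs => ?_
    generalize ho : some cs = o at hcs
    cases hcs with
    | accept A k h => simp at ho
    | pick A k v hv hc hs =>
      rw [Option.some.inj ho]
      exact ⟨[0.98 * treeBound k + 9],
        by simp [bounded_fresh (keptBelow_of_free ih) ih hv hc hs], by simp; linarith⟩

end Bounds

/-! ### A language with arrays and counted loops, and its compilation. -/

section ArrayMachine

/-- Expressions of a machine with registers and arrays: `get j e` is the entry of the array `j` at
the value of `e`. -/
inductive AExpr where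
  | const (c : ℕ)
  | reg (i : ℕ)
  | get (j : ℕ) (e : AExpr)
  | add (e f : AExpr)
  | sub (e f : AExpr)

/-- Programs of a machine with registers and arrays. `iter i b p` runs `p` with register `i`
running from `0` to the value of register `b`, exclusively. -/
inductive AProg where
  | nop
  | assign (i : ℕ) (e : AExpr)
  | store (j : ℕ) (a e : AExpr)
  | seq (p q : AProg)
  | ite (e : AExpr) (p q : AProg)
  | iter (i b : ℕ) (p : AProg)

/-- The state of a machine with registers and arrays. -/
structure AState where
  reg : ℕ → ℕ
  arr : ℕ → ℕ → ℕ

def AState.setReg (σ : AState) (i v : ℕ) : AState := ⟨Function.update σ.reg i v, σ.arr⟩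

def AState.setArr (σ : AState) (j a v : ℕ) : AState :=
  ⟨σ.reg, Function.update σ.arr j (Function.update (σ.arr j) a v)⟩

@[simp] theorem AState.setReg_reg (σ : AState) (i v k : ℕ) :
    (σ.setReg i v).reg k = if k = i then v else σ.reg k := by
  simp [AState.setReg, Function.update_apply]

@[simp] theorem AState.setReg_arr (σ : AState) (i v : ℕ) : (σ.setReg i v).arr = σ.arr := rfl

@[simp] theorem AState.setArr_reg (σ : AState) (j a v : ℕ) : (σ.setArr j a v).reg = σ.reg := rfl

@[simp] theorem AState.setArr_arr (σ : AState) (j a v k b : ℕ) :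
    (σ.setArr j a v).arr k b = if k = j ∧ b = a then v else σ.arr k b := by
  by_cases h : k = j
  · subst h
    simp [AState.setArr, Function.update_apply]
  · simp [AState.setArr, h]

/-- The word size, the memory size, a bound for the lengths of all loops, and a layout of the
arrays in the memory. -/
structure Mach where
  W : ℕ
  M : ℕ
  L : ℕ
  base : ℕ → ℕ
  len : ℕ → ℕ
  one_lt : 1 < W
  le_word : M ≤ W
  base_lt : ∀ j, base j < W
  fit : ∀ j, 0 < len j → base j + len j ≤ M
  disjoint : ∀ i j, i ≠ j → ∀ x < len i, ∀ y < len j, base i + x ≠ base j + y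

def AExpr.eval (σ : AState) : AExpr → ℕ
  | .const c => c
  | .reg i => σ.reg i
  | .get j e => σ.arr j (e.eval σ)
  | .add e f => e.eval σ + f.eval σ
  | .sub e f => e.eval σ - f.eval σ

/-- The expression can be evaluated within the bounds of the machine. -/
def AExpr.Ok (μ : Mach) (σ : AState) : AExpr → Prop
  | .const c => c < μ.W
  | .reg i => σ.reg i < μ.W
  | .get j e => e.Ok μ σ ∧ e.eval σ < μ.len j ∧ σ.arr j (e.eval σ) < μ.W
  | .add e f => e.Ok μ σ ∧ f.Ok μ σ ∧ e.eval σ + f.eval σ < μ.W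
  | .sub e f => e.Ok μ σ ∧ f.Ok μ σ

/-- Even registers of the random access machine hold the registers of the array machine; the odd
register 2j + 1 holds the base address of array j. -/
def AExpr.compile : AExpr → Expr
  | .const c => .const c
  | .reg i => .reg (2 * i)
  | .get j e => .load (.add (.reg (2 * j + 1)) e.compile)
  | .add e f => .add e.compile f.compile
  | .sub e f => .sub e.compile f.compile

def AProg.compile : AProg → Prog
  | .nop => .nop
  | .assign i e => .assign (2 * i) e.compile
  | .store j a e => .store (.add (.reg (2 * j + 1)) a.compile) e.compile
  | .seq p q => .seq p.compile q.compile
  | .ite e p q => .ite e.compile p.compile q.compile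
  | .iter i b p => .seq (.assign (2 * i) (.const 0))
      (.loop (.sub (.reg (2 * b)) (.reg (2 * i)))
        (.seq p.compile (.assign (2 * i) (.add (.reg (2 * i)) (.const 1)))))

/-- A bound for the running time when no loop runs more than `L` times. -/
def AProg.cost (L : ℕ) : AProg → ℕ
  | .nop => 1
  | .assign _ e => e.compile.cost + 1
  | .store _ a e => a.compile.cost + 2 + e.compile.cost + 1
  | .seq p q => p.cost L + q.cost L
  | .ite e p q => e.compile.cost + 1 + p.cost L + q.cost L
  | .iter _ _ p => 6 + L * (p.cost L + 8)

/-- The nesting depth of the loops. -/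
def AProg.depth : AProg → ℕ
  | .nop => 0
  | .assign _ _ => 0
  | .store _ _ _ => 0
  | .seq p q => max p.depth q.depth
  | .ite _ p q => max p.depth q.depth
  | .iter _ _ p => p.depth + 1

theorem AProg.cost_eq_of_depth {p : AProg} (h : p.depth = 0) (L : ℕ) : p.cost L = p.cost 0 := by
  induction p with
  | nop => rfl
  | assign => rfl
  | store => rfl
  | seq p q hp hq =>
    simp only [AProg.depth, Nat.max_eq_zero_iff] at h
    simp [AProg.cost, hp h.1, hq h.2]
  | ite e p q hp hq =>
    simp only [AProg.depth, Nat.max_eq_zero_iff] at h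
    simp [AProg.cost, hp h.1, hq h.2]
  | iter i b p _ => simp [AProg.depth] at h

/-- This is the source of linear time: unnested loops of length at most `L` cost O(L), with a factor
that depends only on the program. -/
theorem AProg.cost_le_of_depth {p : AProg} (h : p.depth ≤ 1) (L : ℕ) :
    p.cost L ≤ p.cost 1 * (L + 1) := by
  induction p with
  | nop => simp [AProg.cost]
  | assign i e => simp only [AProg.cost]; nlinarith
  | store j a e => simp only [AProg.cost]; nlinarith
  | seq p q hp hq =>
    simp only [AProg.depth, max_le_iff] at h
    have h1 := hp h.1
    have h2 := hq h.2
    simp only [AProg.cost]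
    nlinarith
  | ite e p q hp hq =>
    simp only [AProg.depth, max_le_iff] at h
    have h1 := hp h.1
    have h2 := hq h.2
    simp only [AProg.cost]
    nlinarith
  | iter i b p _ =>
    simp only [AProg.depth] at h
    have h0 : p.depth = 0 := by omega
    simp only [AProg.cost, AProg.cost_eq_of_depth h0 L, AProg.cost_eq_of_depth h0 1]
    nlinarith

variable {μ : Mach}

/-- The state of the array machine is represented by the state of the random access machine. -/
structure Rep (μ : Mach) (σ : AState) (s : State) : Prop where
  reg : ∀ i, s.reg (2 * i) = σ.reg i
  base : ∀ j, s.reg (2 * j + 1) = μ.base j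
  mem : ∀ j, ∀ x < μ.len j, s.mem (μ.base j + x) = σ.arr j x

theorem Mach.addr_lt (μ : Mach) {j x : ℕ} (h : x < μ.len j) : μ.base j + x < μ.M := by
  have := μ.fit j (by omega)
  omega

theorem Rep.eval {σ : AState} {s : State} (h : Rep μ σ s) {e : AExpr} (he : e.Ok μ σ) :
    e.compile.Fits μ.W μ.M s ∧ e.compile.eval s = e.eval σ := by
  induction e with
  | const c => exact ⟨he, rfl⟩
  | reg i =>
    simp only [AExpr.Ok] at he
    simp [AExpr.compile, Expr.Fits, Expr.eval, AExpr.eval, h.reg, he]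
  | get j e ih =>
    simp only [AExpr.Ok] at he
    obtain ⟨h1, h2, h3⟩ := he
    obtain ⟨h4, h5⟩ := ih h1
    have h6 := μ.addr_lt h2
    have h7 := μ.le_word
    simp only [AExpr.compile, Expr.Fits, Expr.eval, AExpr.eval, h.base, h5, h.mem j _ h2]
    exact ⟨⟨⟨μ.base_lt j, h4, by omega⟩, h6, h3⟩, trivial⟩
  | add e f he' hf' =>
    simp only [AExpr.Ok] at he
    obtain ⟨h1, h2, h3⟩ := he
    obtain ⟨h4, h5⟩ := he' h1
    obtain ⟨h6, h7⟩ := hf' h2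
    simp only [AExpr.compile, Expr.Fits, Expr.eval, AExpr.eval, h5, h7]
    exact ⟨⟨h4, h6, h3⟩, trivial⟩
  | sub e f he' hf' =>
    simp only [AExpr.Ok] at he
    obtain ⟨h1, h2⟩ := he
    obtain ⟨h4, h5⟩ := he' h1
    obtain ⟨h6, h7⟩ := hf' h2
    simp only [AExpr.compile, Expr.Fits, Expr.eval, AExpr.eval, h5, h7]
    exact ⟨⟨h4, h6⟩, trivial⟩

theorem Rep.setReg {σ : AState} {s : State} (h : Rep μ σ s) (i v : ℕ) :
    Rep μ (σ.setReg i v) ⟨Function.update s.reg (2 * i) v, s.mem⟩ := by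
  constructor
  · intro k
    simp only [Function.update_apply, AState.setReg_reg, h.reg]
    congr 1
    simp
  · intro j
    simp only [Function.update_apply, h.base]
    rw [if_neg (by omega)]
  · exact h.mem

theorem Rep.setArr {σ : AState} {s : State} (h : Rep μ σ s) {j a : ℕ} (ha : a < μ.len j) (v : ℕ) :
    Rep μ (σ.setArr j a v) ⟨s.reg, Function.update s.mem (μ.base j + a) v⟩ := by
  refine ⟨h.reg, h.base, fun k x hx => ?_⟩
  simp only [Function.update_apply, AState.setArr_arr]
  by_cases hk : k = j
  · subst hk
    by_cases hxa : x = a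
    · simp [hxa]
    · rw [if_neg (by omega), if_neg (by tauto), h.mem k x hx]
  · rw [if_neg (μ.disjoint k j hk x hx a ha), if_neg (by tauto), h.mem k x hx]

/-- The program runs to an end within the bounds of the machine and within its time bound, and
the final state satisfies `Q`. -/
def Ends (μ : Mach) (p : AProg) (σ : AState) (Q : AState → Prop) : Prop :=
  ∃ σ', (∀ s, Rep μ σ s → ∃ t s', Exec μ.W μ.M p.compile s t s' ∧ t ≤ p.cost μ.L ∧ Rep μ σ' s') ∧
    Q σ'

theorem Ends.mono {p : AProg} {σ : AState} {Q R : AState → Prop} (h : Ends μ p σ Q)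
    (hQR : ∀ σ', Q σ' → R σ') : Ends μ p σ R := by
  obtain ⟨σ', h1, h2⟩ := h
  exact ⟨σ', h1, hQR σ' h2⟩

theorem Ends.nop {σ : AState} {Q : AState → Prop} (h : Q σ) : Ends μ .nop σ Q :=
  ⟨σ, fun s hs => ⟨1, s, .nop s, le_rfl, hs⟩, h⟩

theorem Ends.assign {i : ℕ} {e : AExpr} {σ : AState} {Q : AState → Prop} (he : e.Ok μ σ)
    (h : Q (σ.setReg i (e.eval σ))) : Ends μ (.assign i e) σ Q := by
  refine ⟨_, fun s hs => ?_, h⟩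
  obtain ⟨h1, h2⟩ := hs.eval he
  refine ⟨_, _, .assign _ _ _ h1, le_rfl, ?_⟩
  rw [h2]
  exact hs.setReg i _

theorem Ends.store {j : ℕ} {a e : AExpr} {σ : AState} {Q : AState → Prop} (ha : a.Ok μ σ)
    (he : e.Ok μ σ) (hj : a.eval σ < μ.len j) (h : Q (σ.setArr j (a.eval σ) (e.eval σ))) :
    Ends μ (.store j a e) σ Q := by
  refine ⟨_, fun s hs => ?_, h⟩
  obtain ⟨h1, h2⟩ := hs.eval he
  obtain ⟨h3, h4⟩ := hs.eval ha
  have h5 := μ.addr_lt hj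
  have h6 := μ.le_word
  have h7 : (Expr.add (.reg (2 * j + 1)) a.compile).eval s = μ.base j + a.eval σ := by
    simp [Expr.eval, hs.base, h4]
  refine ⟨_, _, .store _ _ _ ?_ h1 (by rw [h7]; exact h5), ?_, ?_⟩
  · simp only [Expr.Fits, Expr.eval, hs.base, h4]
    exact ⟨μ.base_lt j, h3, by omega⟩
  · simp only [Expr.cost, AProg.cost]
    omega
  · rw [h7, h2]
    exact hs.setArr hj _

theorem Ends.seq {p q : AProg} {σ : AState} {Q : AState → Prop}
    (h : Ends μ p σ fun σ' => Ends μ q σ' Q) : Ends μ (.seq p q) σ Q := by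
  obtain ⟨σ₁, h1, σ₂, h2, h3⟩ := h
  refine ⟨σ₂, fun s hs => ?_, h3⟩
  obtain ⟨t₁, s₁, h4, h5, h6⟩ := h1 s hs
  obtain ⟨t₂, s₂, h7, h8, h9⟩ := h2 s₁ h6
  exact ⟨_, _, .seq _ _ _ _ _ _ _ h4 h7, by simp only [AProg.cost]; omega, h9⟩

theorem Ends.ite {e : AExpr} {p q : AProg} {σ : AState} {Q : AState → Prop} (he : e.Ok μ σ)
    (hp : e.eval σ ≠ 0 → Ends μ p σ Q) (hq : e.eval σ = 0 → Ends μ q σ Q) :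
    Ends μ (.ite e p q) σ Q := by
  by_cases h : e.eval σ = 0
  · obtain ⟨σ', h1, h2⟩ := hq h
    refine ⟨σ', fun s hs => ?_, h2⟩
    obtain ⟨h3, h4⟩ := hs.eval he
    obtain ⟨t, s', h5, h6, h7⟩ := h1 s hs
    exact ⟨_, _, .ite_false _ _ _ _ _ _ h3 (h4.trans h) h5, by simp only [AProg.cost]; omega, h7⟩
  · obtain ⟨σ', h1, h2⟩ := hp h
    refine ⟨σ', fun s hs => ?_, h2⟩
    obtain ⟨h3, h4⟩ := hs.eval he
    obtain ⟨t, s', h5, h6, h7⟩ := h1 s hs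
    exact ⟨_, _, .ite_true _ _ _ _ _ _ h3 (by rwa [h4]) h5, by simp only [AProg.cost]; omega, h7⟩

/-- Registers outside `R` and arrays outside `D` agree. -/
def Agree (R D : List ℕ) (σ σ' : AState) : Prop :=
  (∀ i, i ∉ R → σ'.reg i = σ.reg i) ∧ ∀ j, j ∉ D → σ'.arr j = σ.arr j

theorem Agree.refl (R D : List ℕ) (σ : AState) : Agree R D σ σ := ⟨fun _ _ => rfl, fun _ _ => rfl⟩

theorem Agree.trans {R D R' D' : List ℕ} {σ σ' σ'' : AState} (h : Agree R D σ σ')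
    (h' : Agree R' D' σ' σ'') {R'' D'' : List ℕ} (hR : R ⊆ R'') (hR' : R' ⊆ R'') (hD : D ⊆ D'')
    (hD' : D' ⊆ D'') : Agree R'' D'' σ σ'' :=
  ⟨fun i hi => (h'.1 i fun hh => hi (hR' hh)).trans (h.1 i fun hh => hi (hR hh)),
    fun j hj => (h'.2 j fun hh => hj (hD' hh)).trans (h.2 j fun hh => hj (hD hh))⟩

theorem Agree.setReg {R D : List ℕ} {σ σ' : AState} (h : Agree R D σ σ') {i : ℕ} (hi : i ∈ R)
    (v : ℕ) : Agree R D σ (σ'.setReg i v) := by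
  refine ⟨fun k hk => ?_, h.2⟩
  have : k ≠ i := fun hh => hk (hh ▸ hi)
  rw [AState.setReg_reg, if_neg this, h.1 k hk]

theorem Agree.setArr {R D : List ℕ} {σ σ' : AState} (h : Agree R D σ σ') {j : ℕ} (hj : j ∈ D)
    (a v : ℕ) : Agree R D σ (σ'.setArr j a v) := by
  refine ⟨h.1, fun k hk => ?_⟩
  have : k ≠ j := fun hh => hk (hh ▸ hj)
  rw [← h.2 k hk]
  simp [AState.setArr, this]

/-- Induction on the number `d` of rounds that remain. The compiled loop runs while the truncated
difference of bound and counter is nonzero. -/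
theorem exec_iter {i b N : ℕ} {p : AProg} (S : ℕ → AState → Prop) (hN : N ≤ μ.L) (hNW : N < μ.W)
    (hb : ∀ j ≤ N, ∀ σ, S j σ → σ.reg i = j ∧ σ.reg b = N)
    (hstep : ∀ j < N, ∀ σ, S j σ → Ends μ p σ fun σ' => σ'.reg i = j ∧ S (j + 1) (σ'.setReg i (j + 1)))
    (d : ℕ) : ∀ j σ, j + d = N → S j σ → ∃ σ', S N σ' ∧ ∀ s, Rep μ σ s → ∃ t s',
      Exec μ.W μ.M (.loop (.sub (.reg (2 * b)) (.reg (2 * i)))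
        (.seq p.compile (.assign (2 * i) (.add (.reg (2 * i)) (.const 1))))) s t s' ∧
      t ≤ 4 + d * (p.cost μ.L + 8) ∧ Rep μ σ' s' := by
  induction d with
  | zero =>
    intro j σ hj hS
    obtain rfl : j = N := by omega
    obtain ⟨h1, h2⟩ := hb j le_rfl σ hS
    refine ⟨σ, hS, fun s hs => ⟨_, s, .loop_false _ _ _ ?_ ?_, ?_, hs⟩⟩
    · simp [Expr.Fits, hs.reg, h1, h2, hNW]
    · simp [Expr.eval, hs.reg, h1, h2]
    · simp [Expr.cost]
  | succ d ih =>
    intro j σ hj hS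
    obtain ⟨h1, h2⟩ := hb j (by omega) σ hS
    obtain ⟨σ₁, h3, h4, h5⟩ := hstep j (by omega) σ hS
    obtain ⟨σ₂, h6, h7⟩ := ih (j + 1) _ (by omega) h5
    refine ⟨σ₂, h6, fun s hs => ?_⟩
    obtain ⟨t₁, s₁, h8, h9, h10⟩ := h3 s hs
    have hv : (Expr.add (.reg (2 * i)) (.const 1)).eval s₁ = j + 1 := by
      simp [Expr.eval, h10.reg, h4]
    have h11 := h10.setReg i (j + 1)
    obtain ⟨t₂, s₂, h12, h13, h14⟩ := h7 _ h11
    have hone := μ.one_lt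
    refine ⟨_, s₂, .loop_true _ _ s _ s₂ _ t₂ ?_ ?_ (.seq _ _ _ _ _ _ _ h8 (.assign _ _ _ ?_)) ?_,
      ?_, h14⟩
    · simp only [Expr.Fits, hs.reg, h1, h2]
      omega
    · simp only [Expr.eval, hs.reg, h1, h2]
      omega
    · simp only [Expr.Fits, Expr.eval, h10.reg, h4]
      omega
    · rw [hv]
      exact h12
    -- Each round costs 4 for the test and 4 for the increment besides the body; the last test costs
    -- 4 more.
    · simp only [Expr.cost]
      rw [Nat.succ_mul]
      omega

/-- The invariant `S` has to describe only what the loop changes; everything outside `R` and `D` is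
framed by `Agree`, in particular the bound in register `b`. -/
theorem Ends.iter {i b N : ℕ} {p : AProg} {σ : AState} {Q : AState → Prop} (R D : List ℕ)
    (S : ℕ → AState → Prop) (hN : N ≤ μ.L) (hNW : N < μ.W) (hiR : i ∈ R) (hbR : b ∉ R)
    (hb : σ.reg b = N) (h0 : S 0 (σ.setReg i 0))
    (hstep : ∀ j < N, ∀ σ', Agree R D σ σ' → σ'.reg i = j → S j σ' →
      Ends μ p σ' fun σ'' => Agree R D σ' σ'' ∧ σ''.reg i = j ∧ S (j + 1) (σ''.setReg i (j + 1)))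
    (hQ : ∀ σ', Agree R D σ σ' → S N σ' → Q σ') : Ends μ (.iter i b p) σ Q := by
  obtain ⟨σ', ⟨h1, h2, h3⟩, h4⟩ := exec_iter (μ := μ) (i := i) (b := b) (N := N) (p := p)
    (fun j σ' => Agree R D σ σ' ∧ σ'.reg i = j ∧ S j σ') hN hNW
    (fun j _ σ' h => ⟨h.2.1, (h.1.1 b hbR).trans hb⟩)
    (fun j hj σ' h => (hstep j hj σ' h.1 h.2.1 h.2.2).mono fun σ'' h' =>
      ⟨h'.2.1, ((h.1.trans h'.1 (List.Subset.refl _) (List.Subset.refl _) (List.Subset.refl _)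
        (List.Subset.refl _)).setReg hiR _), by simp, h'.2.2⟩)
    N 0 (σ.setReg i 0) (by omega) ⟨(Agree.refl R D σ).setReg hiR _, by simp, h0⟩
  refine ⟨σ', fun s hs => ?_, hQ σ' h1 h3⟩
  obtain ⟨t, s', h5, h6, h7⟩ := h4 _ (hs.setReg i 0)
  refine ⟨_, s', .seq _ _ _ _ _ _ _ (.assign _ _ _ ?_) h5, ?_, h7⟩
  · exact Nat.lt_trans Nat.zero_lt_one μ.one_lt
  · simp only [Expr.cost, AProg.cost]
    have := Nat.mul_le_mul_right (p.cost μ.L + 8) hN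
    omega

/-- The weakest precondition of a program without loops. -/
def AProg.pre (μ : Mach) : AProg → (AState → Prop) → AState → Prop
  | .nop, Q, σ => Q σ
  | .assign i e, Q, σ => e.Ok μ σ ∧ Q (σ.setReg i (e.eval σ))
  | .store j a e, Q, σ => a.Ok μ σ ∧ e.Ok μ σ ∧ a.eval σ < μ.len j ∧
      Q (σ.setArr j (a.eval σ) (e.eval σ))
  | .seq p q, Q, σ => p.pre μ (q.pre μ Q) σ
  | .ite e p q, Q, σ => e.Ok μ σ ∧ (e.eval σ ≠ 0 → p.pre μ Q σ) ∧ (e.eval σ = 0 → q.pre μ Q σ)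
  | .iter _ _ _, _, _ => False

theorem Ends.of_pre {p : AProg} {σ : AState} {Q : AState → Prop} (h : p.pre μ Q σ) :
    Ends μ p σ Q := by
  induction p generalizing σ Q with
  | nop => exact .nop h
  | assign i e => exact .assign h.1 h.2
  | store j a e => exact .store h.1 h.2.1 h.2.2.1 h.2.2.2
  | seq p q hp hq => exact .seq ((hp h).mono fun σ' h' => hq h')
  | ite e p q hp hq => exact .ite h.1 (fun h' => hp (h.2.1 h')) fun h' => hq (h.2.2 h')
  | iter i b p _ => exact h.elim

end ArrayMachine

/-! ### Passes over the vertices and the edges; counting neighbours. -/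

section Loops

/-- The layout of the arrays: the input, work arrays `1, …, 14` with one entry for each vertex,
and the stack. -/
structure Layout (μ : Mach) (n m k : ℕ) : Prop where
  input : 3 + 2 * m ≤ μ.len 0
  work : ∀ j, 1 ≤ j → j ≤ 14 → μ.len j = n
  stack : μ.len 15 = (n + 2) * (n + 3)
  loops : μ.L = n + m + 3
  word : 16 * ((n + m + k + 2) * (n + m + k + 2)) ≤ μ.W

/-- The numbers of vertices and edges stand in the registers 1 and 2, and the edges in array 0. -/
structure Given {n : ℕ} (l : List (Fin n × Fin n)) (σ : AState) : Prop where
  n : σ.reg 1 = n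
  m : σ.reg 2 = l.length
  fst : ∀ i (h : i < l.length), σ.arr 0 (3 + (i + i)) = l[i].1
  snd : ∀ i (h : i < l.length), σ.arr 0 (4 + (i + i)) = l[i].2

theorem Given.agree {n : ℕ} {l : List (Fin n × Fin n)} {σ σ' : AState} (h : Given l σ)
    {R D : List ℕ} (ha : Agree R D σ σ') (h1 : 1 ∉ R) (h2 : 2 ∉ R) (h0 : 0 ∉ D) : Given l σ' :=
  ⟨(ha.1 1 h1).trans h.n, (ha.1 2 h2).trans h.m, by rw [ha.2 0 h0]; exact h.fst,
    by rw [ha.2 0 h0]; exact h.snd⟩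

variable {μ : Mach} {n k : ℕ} {l : List (Fin n × Fin n)} {σ : AState} {Q : AState → Prop}

theorem Layout.lt_word {m : ℕ} (h : Layout μ n m k) {x : ℕ} (hx : x < 16 * (n + m + k + 2)) :
    x < μ.W := by
  have := h.word
  nlinarith

/-- Sets the array `j` entry by entry. -/
def mapLoop (j : ℕ) (e : AExpr) : AProg := .iter 3 1 (.store j (.reg 3) e)

theorem ends_mapLoop (hΛ : Layout μ n l.length k) (hσ : Given l σ) {j : ℕ} {e : AExpr}
    (hj : 1 ≤ j ∧ j ≤ 14) (f : ℕ → ℕ)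
    (he : ∀ x < n, ∀ σ', Agree [3] [j] σ σ' → σ'.reg 3 = x → e.Ok μ σ' ∧ e.eval σ' = f x)
    (hQ : ∀ σ', Agree [3] [j] σ σ' → (∀ x < n, σ'.arr j x = f x) → Q σ') :
    Ends μ (mapLoop j e) σ Q := by
  refine Ends.iter [3] [j] (fun i σ' => ∀ x < i, σ'.arr j x = f x) (N := n)
    (by rw [hΛ.loops]; omega) (hΛ.lt_word (by omega)) (by simp) (by simp) hσ.n (by simp) ?_ hQ
  intro x hx σ' hA hr hS
  obtain ⟨h1, h2⟩ := he x hx σ' hA hr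
  refine Ends.store ?_ h1 ?_ ⟨(Agree.refl _ _ _).setArr (by simp) _ _, hr, ?_⟩
  · simp only [AExpr.Ok, hr]
    exact hΛ.lt_word (by omega)
  · simp only [AExpr.eval, hr, hΛ.work j hj.1 hj.2]
    exact hx
  · intro y hy
    simp only [AState.setReg_arr, AState.setArr_arr, AExpr.eval, hr, h2]
    by_cases hyx : y = x
    · simp [hyx]
    · simp only [hyx, and_false, if_false]
      exact hS y (by omega)

/-- Runs `p` for each edge, with the endpoints in the registers 4 and 5. -/
def edgeLoop (p : AProg) : AProg :=
  .iter 3 2 (.seq (.assign 4 (.get 0 (.add (.const 3) (.add (.reg 3) (.reg 3)))))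
    (.seq (.assign 5 (.get 0 (.add (.const 4) (.add (.reg 3) (.reg 3))))) p))

/-- The body contains no loop and changes no register, so its effect is stated by `AProg.pre` and
the invariant speaks of the arrays only. -/
theorem ends_edgeLoop (hΛ : Layout μ n l.length k) (hσ : Given l σ) {p : AProg} (D : List ℕ)
    (h0D : 0 ∉ D) (S : ℕ → (ℕ → ℕ → ℕ) → Prop) (h0 : S 0 σ.arr)
    (hstep : ∀ j (hj : j < l.length), ∀ σ', Agree [3, 4, 5] D σ σ' → σ'.reg 4 = l[j].1 →
      σ'.reg 5 = l[j].2 → S j σ'.arr →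
      p.pre μ (fun σ'' => Agree [] D σ' σ'' ∧ S (j + 1) σ''.arr) σ')
    (hQ : ∀ σ', Agree [3, 4, 5] D σ σ' → S l.length σ'.arr → Q σ') :
    Ends μ (edgeLoop p) σ Q := by
  refine Ends.iter [3, 4, 5] D (fun i σ' => S i σ'.arr) (N := l.length)
    (by rw [hΛ.loops]; omega) (hΛ.lt_word (by omega)) (by simp) (by simp) hσ.m h0 ?_ hQ
  intro j hj σ' hA hr hS
  have hg := hσ.agree hA (by simp) (by simp) h0D
  have hin := hΛ.input
  have hw : ∀ x, x < 16 * (n + l.length + k + 2) → x < μ.W := fun x hx => hΛ.lt_word hx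
  have ha := l[j].1.isLt
  have hb := l[j].2.isLt
  refine Ends.seq (Ends.assign ?_ (Ends.seq (Ends.assign ?_ ?_)))
  · simp only [AExpr.Ok, AExpr.eval, hr, hg.fst j hj]
    exact ⟨⟨hw _ (by omega), ⟨hw _ (by omega), hw _ (by omega), hw _ (by omega)⟩,
      hw _ (by omega)⟩, by omega, hw _ (by omega)⟩
  · simp only [AExpr.Ok, AExpr.eval, AState.setReg_reg, AState.setReg_arr, Nat.reduceEqDiff,
      if_false, hr, hg.snd j hj]
    exact ⟨⟨hw _ (by omega), ⟨hw _ (by omega), hw _ (by omega), hw _ (by omega)⟩,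
      hw _ (by omega)⟩, by omega, hw _ (by omega)⟩
  · refine (Ends.of_pre (hstep j hj _ ((hA.setReg (by simp) _).setReg (by simp) _) ?_ ?_ hS)).mono ?_
    · simp [AExpr.eval, hr, hg.fst j hj]
    · simp [AExpr.eval, hr, hg.snd j hj]
    · rintro σ'' ⟨h1, h2⟩
      refine ⟨?_, ?_, h2⟩
      · exact (((Agree.refl _ D _).setReg (by simp) _).setReg (by simp) _).trans h1
          (List.Subset.refl _) (by simp) (List.Subset.refl _) (List.Subset.refl _)
      · rw [h1.1 3 (by simp)]
        simp [hr]

/-- The number of pairs in the list that join `x` to a vertex with property `P`. -/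
def joins (l : List (Fin n × Fin n)) (P : Fin n → Prop) [DecidablePred P] (x : Fin n) : ℕ :=
  (l.map fun e => (if e.1 = x ∧ P e.2 then 1 else 0) + if e.2 = x ∧ P e.1 then 1 else 0).sum

theorem joins_take_succ (P : Fin n → Prop) [DecidablePred P] (x : Fin n) {j : ℕ}
    (hj : j < l.length) : joins (l.take (j + 1)) P x = joins (l.take j) P x +
      ((if l[j].1 = x ∧ P l[j].2 then 1 else 0) + if l[j].2 = x ∧ P l[j].1 then 1 else 0) := by
  unfold joins
  rw [List.take_succ_eq_append_getElem hj, List.map_append, List.sum_append]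
  simp only [List.map_cons, List.map_nil, List.sum_cons, List.sum_nil, add_zero]

theorem joins_le (P : Fin n → Prop) [DecidablePred P] (x : Fin n) :
    joins l P x ≤ 2 * l.length := by
  unfold joins
  induction l with
  | nil => simp
  | cons e l ih =>
    simp only [List.map_cons, List.sum_cons, List.length_cons]
    split_ifs <;> omega

theorem joins_take_le (P : Fin n → Prop) [DecidablePred P] (x : Fin n) (j : ℕ) :
    joins (l.take j) P x ≤ 2 * l.length :=
  (joins_le P x).trans (by simp)

/-- Double counting: an entry of the list contributes one for each `y` with property `P` such that
it is the pair {x, y}. After exchanging the sums, the pair {x, y} occurs once or never, since the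
list has no repetitions. -/
theorem joins_eq_card {G : SimpleGraph (Fin n)} [DecidableRel G.Adj] (hl : IsEdgeList G l)
    (P : Fin n → Prop) [DecidablePred P] (x : Fin n) :
    joins l P x = (Finset.univ.filter fun y => G.Adj x y ∧ P y).card := by
  have h1 : ∀ e ∈ l, (if e.1 = x ∧ P e.2 then 1 else 0) + (if e.2 = x ∧ P e.1 then 1 else 0) =
      ∑ y, if P y ∧ s(e.1, e.2) = s(x, y) then 1 else 0 := by
    intro e he
    have hadj : G.Adj e.1 e.2 := by
      have := (hl.2 s(e.1, e.2)).1 (List.mem_map.2 ⟨e, he, rfl⟩)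
      simpa using this
    have hne := hadj.ne
    simp only [Sym2.eq_iff]
    by_cases h1 : e.1 = x
    · have h2 : e.2 ≠ x := fun h => hne (h1.trans h.symm)
      simp only [h1, h2, true_and, false_and, and_false, or_false, if_false, add_zero]
      rw [Finset.sum_eq_single e.2]
      · simp
      · intro y _ hy
        simp [hy.symm]
      · simp
    · by_cases h2 : e.2 = x
      · simp only [h1, h2, true_and, false_and, and_true, false_or, if_false, zero_add]
        rw [Finset.sum_eq_single e.1]
        · simp
        · intro y _ hy
          simp [hy.symm]
        · simp
      · simp [h1, h2]
  unfold joins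
  rw [List.map_congr_left h1, Finset.card_filter]
  have h2 : ∀ l' : List (Fin n × Fin n),
      (l'.map fun e => ∑ y, if P y ∧ s(e.1, e.2) = s(x, y) then 1 else 0).sum =
      ∑ y, if P y then (l'.map fun e => s(e.1, e.2)).count s(x, y) else 0 := by
    intro l'
    induction l' with
    | nil => simp
    | cons e l' ih =>
      rw [List.map_cons, List.sum_cons, ih, ← Finset.sum_add_distrib]
      refine Finset.sum_congr rfl fun y _ => ?_
      rw [List.map_cons, List.count_cons]
      by_cases hP : P y
      · simp only [hP, true_and, if_true, beq_iff_eq]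
        ring
      · simp [hP]
  rw [h2]
  refine Finset.sum_congr rfl fun y _ => ?_
  by_cases hP : P y
  · rw [List.Nodup.count hl.1]
    simp only [hP, if_true, and_true, hl.2, SimpleGraph.mem_edgeSet]
  · simp [hP]

/-- Counts for each vertex the neighbours with nonzero entry in the array `c`. -/
def countLoop (d c : ℕ) : AProg :=
  .seq (mapLoop d (.const 0)) (edgeLoop
    (.seq (.ite (.get c (.reg 5)) (.store d (.reg 4) (.add (.get d (.reg 4)) (.const 1))) .nop)
      (.ite (.get c (.reg 4)) (.store d (.reg 5) (.add (.get d (.reg 5)) (.const 1))) .nop)))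

theorem ends_countLoop {G : SimpleGraph (Fin n)} [DecidableRel G.Adj] (hl : IsEdgeList G l)
    (hΛ : Layout μ n l.length k) (hσ : Given l σ) {d c : ℕ}
    (hd : 1 ≤ d ∧ d ≤ 14) (hc : 1 ≤ c ∧ c ≤ 14) (hdc : d ≠ c)
    (hcW : ∀ x : Fin n, σ.arr c x < μ.W)
    (hQ : ∀ σ', Agree [3, 4, 5] [d] σ σ' → (∀ x : Fin n, σ'.arr d x =
      (Finset.univ.filter fun y : Fin n => G.Adj x y ∧ σ.arr c y ≠ 0).card) → Q σ') :
    Ends μ (countLoop d c) σ Q := by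
  refine Ends.seq (ends_mapLoop hΛ hσ hd (fun _ => 0) ?_ ?_)
  · intro x hx σ' _ _
    exact ⟨hΛ.lt_word (by omega), rfl⟩
  intro σ₁ hA₁ h₁
  have hc₁ : σ₁.arr c = σ.arr c := hA₁.2 c (by simp [hdc.symm])
  refine ends_edgeLoop hΛ (hσ.agree hA₁ (by simp) (by simp) (by simp; omega)) [d]
    (by simp; omega)
    (fun j a => ∀ x : Fin n, a d x = joins (l.take j) (fun y => σ.arr c y ≠ 0) x) ?_ ?_ ?_
  · intro x
    rw [h₁ x x.isLt]
    simp [joins]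
  · intro j hj σ' hA h4 h5 hS
    have hc' : σ'.arr c = σ.arr c := (hA.2 c (by simp [hdc.symm])).trans hc₁
    have hin := hΛ.input
    have hlc := hΛ.work c hc.1 hc.2
    have hld := hΛ.work d hd.1 hd.2
    have ha := l[j].1.isLt
    have hb := l[j].2.isLt
    have hle := fun x => joins_take_le (l := l) (fun y => σ.arr c y ≠ 0) x j
    have hw : ∀ x, x < 16 * (n + l.length + k + 2) → x < μ.W := fun x hx => hΛ.lt_word hx
    have hSa := hS l[j].1
    have hSb := hS l[j].2
    have hla := hle l[j].1
    have hlb := hle l[j].2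
    have hca := hcW l[j].1
    have hcb := hcW l[j].2
    have key : ∀ x : Fin n, joins (l.take (j + 1)) (fun y => σ.arr c y ≠ 0) x = _ :=
      fun x => joins_take_succ _ x hj
    -- The endpoints differ, so the two updates for an edge concern different cells and do not
    -- disturb each other.
    have hne : ((l[j].1 : Fin n) : ℕ) ≠ (l[j].2 : Fin n) := by
      intro h
      have := (hl.2 s(l[j].1, l[j].2)).1 (List.mem_map.2 ⟨l[j], List.getElem_mem hj, rfl⟩)
      rw [SimpleGraph.mem_edgeSet] at this
      exact this.ne (Fin.ext h)
    simp only [AProg.pre, AExpr.Ok, AExpr.eval, h4, h5, hc', hSa, hSb, hlc, hld,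
      AState.setArr_reg, AState.setArr_arr, hdc.symm, false_and, if_false, hne.symm, and_false]
    refine ⟨⟨hw _ (by omega), hb, hcb⟩, fun hPb => ⟨hw _ (by omega), ⟨⟨hw _ (by omega), ha,
      hw _ (by omega)⟩, hw _ (by omega), hw _ (by omega)⟩, ha, ⟨hw _ (by omega), ha, hca⟩,
      fun hPa => ⟨hw _ (by omega), ⟨⟨hw _ (by omega), hb, hw _ (by omega)⟩, hw _ (by omega),
        hw _ (by omega)⟩, hb, ?_, ?_⟩, fun hPa => ⟨?_, ?_⟩⟩,
      fun hPb => ⟨⟨hw _ (by omega), ha, hca⟩,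
      fun hPa => ⟨hw _ (by omega), ⟨⟨hw _ (by omega), hb, hw _ (by omega)⟩, hw _ (by omega),
        hw _ (by omega)⟩, hb, ?_, ?_⟩, fun hPa => ⟨?_, ?_⟩⟩⟩
    · exact ((Agree.refl _ _ _).setArr (by simp) _ _).setArr (by simp) _ _
    · intro x
      rw [key x, ← hS x]
      simp only [true_and, hPa, hPb, ne_eq, not_false_eq_true, and_true, Fin.val_inj]
      by_cases h1 : x = l[j].1 <;> by_cases h2 : x = l[j].2
      · exact absurd (by rw [← h1, ← h2]) hne
      · simp [← h1, Ne.symm h2, h2, hS x]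
      · simp [← h2, Ne.symm h1, hS x]
      · simp [h1, h2, Ne.symm h1, Ne.symm h2]
    · exact (Agree.refl _ _ _).setArr (by simp) _ _
    · intro x
      rw [key x, ← hS x]
      simp only [true_and, hPa, hPb, ne_eq, not_false_eq_true, and_true, Fin.val_inj]
      by_cases h1 : x = l[j].1
      · simp [← h1, hS x]
      · simp [h1, Ne.symm h1]
    · exact (Agree.refl _ _ _).setArr (by simp) _ _
    · intro x
      rw [key x, ← hS x]
      simp only [true_and, hPa, hPb, ne_eq, not_false_eq_true, and_true, Fin.val_inj]
      by_cases h1 : x = l[j].2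
      · simp [← h1, hS x]
      · simp [h1, Ne.symm h1]
    · exact Agree.refl _ _ _
    · intro x
      rw [key x, ← hS x]
      simp [hPa, hPb]
  · intro σ' hA hS
    refine hQ σ' (hA₁.trans hA (by simp) (List.Subset.refl _) (List.Subset.refl _)
      (List.Subset.refl _)) fun x => ?_
    rw [hS x, List.take_length, joins_eq_card hl]

end Loops

/-! ### Sums, maxima, deletion, copying and labels of closed neighbourhoods. -/

section MoreLoops

variable {μ : Mach} {n k : ℕ} {l : List (Fin n × Fin n)} {σ : AState} {Q : AState → Prop}

/-- Sums `e` over the vertices with nonzero `g`. -/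
def sumLoop (r : ℕ) (g e : AExpr) : AProg :=
  .seq (.assign r (.const 0)) (.iter 3 1 (.ite g (.assign r (.add (.reg r) e)) .nop))

theorem ends_sumLoop (hΛ : Layout μ n l.length k) (hσ : Given l σ) {r : ℕ} {g e : AExpr}
    (hr : 6 ≤ r) (gf f : ℕ → ℕ)
    (hg : ∀ x < n, ∀ σ', Agree [3, r] [] σ σ' → σ'.reg 3 = x → g.Ok μ σ' ∧ g.eval σ' = gf x)
    (he : ∀ x < n, ∀ σ', Agree [3, r] [] σ σ' → σ'.reg 3 = x → gf x ≠ 0 →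
      e.Ok μ σ' ∧ e.eval σ' = f x)
    (hW : ∑ x ∈ Finset.range n, (if gf x ≠ 0 then f x else 0) < μ.W)
    (hQ : ∀ σ', Agree [3, r] [] σ σ' →
      σ'.reg r = ∑ x ∈ Finset.range n, (if gf x ≠ 0 then f x else 0) → Q σ') :
    Ends μ (sumLoop r g e) σ Q := by
  have h3r : r ≠ 3 := by omega
  have h1r : 1 ≠ r := by omega
  refine Ends.seq (Ends.assign (hΛ.lt_word (by omega)) ?_)
  have hA0 : Agree [3, r] [] σ (σ.setReg r 0) := (Agree.refl _ _ _).setReg (by simp) _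
  refine Ends.iter [3, r] [] (fun i σ' => σ'.reg r = ∑ x ∈ Finset.range i,
    (if gf x ≠ 0 then f x else 0)) (N := n)
    (by rw [hΛ.loops]; omega) (hΛ.lt_word (by omega)) (by simp) (by simp [h1r])
    (by simp [h1r, hσ.n]) ?_ ?_ ?_
  · simp [h3r, AExpr.eval]
  · intro x hx σ' hA hr' hS
    have hA' : Agree [3, r] [] σ σ' := hA0.trans hA (List.Subset.refl _) (List.Subset.refl _)
      (List.Subset.refl _) (List.Subset.refl _)
    obtain ⟨h1, h2⟩ := hg x hx σ' hA' hr'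
    have hle : ∑ y ∈ Finset.range (x + 1), (if gf y ≠ 0 then f y else 0) < μ.W :=
      lt_of_le_of_lt (Finset.sum_le_sum_of_subset (by
        intro y hy
        simp only [Finset.mem_range] at hy ⊢
        omega)) hW
    rw [Finset.sum_range_succ] at hle
    refine Ends.ite h1 (fun h3 => ?_) fun h3 => ?_
    · rw [h2] at h3
      obtain ⟨h4, h5⟩ := he x hx σ' hA' hr' h3
      rw [if_pos h3] at hle
      refine Ends.assign ?_ ⟨(Agree.refl _ _ _).setReg (by simp) _, ?_, ?_⟩
      · simp only [AExpr.Ok, AExpr.eval, hS, h5]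
        exact ⟨by omega, h4, hle⟩
      · simp [h3r.symm, hr']
      · simp only [AState.setReg_reg, h3r, if_false, if_true, AExpr.eval, hS, h5]
        rw [Finset.sum_range_succ, if_pos h3]
    · rw [h2] at h3
      refine Ends.nop ⟨Agree.refl _ _ _, hr', ?_⟩
      simp only [AState.setReg_reg, h3r, if_false, hS]
      rw [Finset.sum_range_succ, if_neg (by simp [h3]), add_zero]
  · intro σ' hA hS
    exact hQ σ' (hA0.trans hA (List.Subset.refl _) (List.Subset.refl _)
      (List.Subset.refl _) (List.Subset.refl _)) hS

/-- Finds the maximum of `e` over the vertices with nonzero `g`, where the value `1` is replaced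
by `b`. The maximum goes to register `r`, the vertex to register `r + 1`. -/
def maxLoop (r : ℕ) (g e b : AExpr) : AProg :=
  .seq (.assign r (.const 0)) (.iter 3 1 (.ite g
    (.seq (.assign 4 e)
    -- The sum of the two truncated differences vanishes exactly if register 4 holds 1.
    (.seq (.ite (.add (.sub (.reg 4) (.const 1)) (.sub (.const 1) (.reg 4))) .nop (.assign 4 b))
      (.ite (.sub (.reg 4) (.reg r))
        (.seq (.assign r (.reg 4)) (.assign (r + 1) (.reg 3))) .nop))) .nop))

/-- The maximum 0 means that no vertex with a positive key was met; register `r + 1` is then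
meaningless, whence the guard in `hQ`. -/
theorem ends_maxLoop (hΛ : Layout μ n l.length k) (hσ : Given l σ) {r : ℕ} {g e b : AExpr}
    (hr : 6 ≤ r) (gf f : ℕ → ℕ) (c : ℕ) (hcW : c < μ.W)
    (hg : ∀ x < n, ∀ σ', Agree [3, 4, r, r + 1] [] σ σ' → σ'.reg 3 = x →
      g.Ok μ σ' ∧ g.eval σ' = gf x)
    (he : ∀ x < n, ∀ σ', Agree [3, 4, r, r + 1] [] σ σ' → σ'.reg 3 = x → gf x ≠ 0 →
      e.Ok μ σ' ∧ e.eval σ' = f x ∧ f x < μ.W)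
    (hb : ∀ σ', Agree [3, 4, r, r + 1] [] σ σ' → b.Ok μ σ' ∧ b.eval σ' = c)
    (hQ : ∀ σ', Agree [3, 4, r, r + 1] [] σ σ' →
      (∀ x < n, gf x ≠ 0 → (if f x = 1 then c else f x) ≤ σ'.reg r) →
      (σ'.reg r ≠ 0 → σ'.reg (r + 1) < n ∧ gf (σ'.reg (r + 1)) ≠ 0 ∧
        (if f (σ'.reg (r + 1)) = 1 then c else f (σ'.reg (r + 1))) = σ'.reg r) → Q σ') :
    Ends μ (maxLoop r g e b) σ Q := by
  have h3r : r ≠ 3 := by omega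
  have h4r : r ≠ 4 := by omega
  have h1r : 1 ≠ r := by omega
  have h1r' : 1 ≠ r + 1 := by omega
  have h3r' : r + 1 ≠ 3 := by omega
  have h4r' : r + 1 ≠ 4 := by omega
  have hw : ∀ x, x < 16 * (n + l.length + k + 2) → x < μ.W := fun x hx => hΛ.lt_word hx
  refine Ends.seq (Ends.assign (hw _ (by omega)) ?_)
  have hA0 : Agree [3, 4, r, r + 1] [] σ (σ.setReg r 0) :=
    (Agree.refl _ _ _).setReg (by simp) _
  refine Ends.iter [3, 4, r, r + 1] [] (fun i σ' => σ'.reg r < μ.W ∧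
      (∀ x < i, gf x ≠ 0 → (if f x = 1 then c else f x) ≤ σ'.reg r) ∧
      (σ'.reg r ≠ 0 → σ'.reg (r + 1) < n ∧ gf (σ'.reg (r + 1)) ≠ 0 ∧
        (if f (σ'.reg (r + 1)) = 1 then c else f (σ'.reg (r + 1))) = σ'.reg r)) (N := n)
    (by rw [hΛ.loops]; omega) (hw _ (by omega)) (by simp) (by simp; omega)
    (by simp [h1r, hσ.n]) ?_ ?_ ?_
  · simpa [h3r, AExpr.eval] using hw 0 (by omega)
  · intro x hx σ' hA hr' hS
    have hA' : Agree [3, 4, r, r + 1] [] σ σ' := hA0.trans hA (List.Subset.refl _)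
      (List.Subset.refl _) (List.Subset.refl _) (List.Subset.refl _)
    obtain ⟨h1, h2⟩ := hg x hx σ' hA' hr'
    obtain ⟨hS0, hS1, hS2⟩ := hS
    refine Ends.ite h1 (fun h3 => ?_) fun h3 => ?_
    · rw [h2] at h3
      obtain ⟨h4, h5, h6⟩ := he x hx σ' hA' hr' h3
      refine Ends.seq (Ends.assign h4 ?_)
      rw [h5]
      have hA1 : Agree [3, 4, r, r + 1] [] σ' (σ'.setReg 4 (f x)) :=
        (Agree.refl _ _ _).setReg (by simp) _
      obtain ⟨h7, h8⟩ := hb _ (hA'.setReg (i := 4) (by simp) (f x))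
      -- The runs with and without replacement of the value 1 meet here, with the key in register 4.
      have main : ∀ key, key = (if f x = 1 then c else f x) → key < μ.W → ∀ τ : AState,
          Agree [3, 4, r, r + 1] [] σ' τ → τ.reg 4 = key → τ.reg 3 = x → τ.reg r = σ'.reg r →
          τ.reg (r + 1) = σ'.reg (r + 1) →
          Ends μ (.ite (.sub (.reg 4) (.reg r))
            (.seq (.assign r (.reg 4)) (.assign (r + 1) (.reg 3))) .nop) τ
            fun σ'' => Agree [3, 4, r, r + 1] [] σ' σ'' ∧ σ''.reg 3 = x ∧
              (fun i σ' => σ'.reg r < μ.W ∧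
              (∀ x < i, gf x ≠ 0 → (if f x = 1 then c else f x) ≤ σ'.reg r) ∧
              (σ'.reg r ≠ 0 → σ'.reg (r + 1) < n ∧ gf (σ'.reg (r + 1)) ≠ 0 ∧
                (if f (σ'.reg (r + 1)) = 1 then c else f (σ'.reg (r + 1))) = σ'.reg r)) (x + 1)
              (σ''.setReg 3 (x + 1)) := by
        intro key hkey hkW τ hτ h9 h10 h11 h12
        refine Ends.ite ?_ (fun h13 => ?_) fun h13 => ?_
        · simp only [AExpr.Ok, h9, h11]
          exact ⟨hkW, hS0⟩
        · simp only [AExpr.eval, h9, h11] at h13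
          refine Ends.seq (Ends.assign ?_ (Ends.assign ?_ ⟨?_, ?_, ?_, ?_, ?_⟩))
          · simpa only [AExpr.Ok, h9] using hkW
          · simp only [AExpr.Ok, AState.setReg_reg, h3r.symm, if_false, h10]
            exact hw _ (by omega)
          · exact (hτ.setReg (by simp) _).setReg (by simp) _
          · simp [h3r.symm, h3r'.symm, h10]
          · simpa [h3r, AExpr.eval, h9] using hkW
          · intro y hy hgy
            simp only [AState.setReg_reg, h3r, if_false, AExpr.eval, h9, left_eq_add,
              one_ne_zero, if_true]
            by_cases hyx : y = x
            · rw [hyx, hkey]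
            · have := hS1 y (by omega) hgy
              omega
          · intro _
            simp only [AState.setReg_reg, h3r, h3r', h3r.symm, if_false, if_true, AExpr.eval, h9, h10,
              left_eq_add, one_ne_zero]
            exact ⟨hx, h3, hkey.symm⟩
        · simp only [AExpr.eval, h9, h11] at h13
          refine Ends.nop ⟨hτ, h10, ?_, ?_, ?_⟩
          · simpa [h3r, h11] using hS0
          · intro y hy hgy
            simp only [AState.setReg_reg, h3r, if_false, h11]
            by_cases hyx : y = x
            · rw [hyx, ← hkey]
              omega
            · exact hS1 y (by omega) hgy
          · simpa [h3r, show r ≠ 2 by omega, h11, h12] using hS2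
      refine Ends.seq (Ends.ite ?_ (fun h9 => Ends.nop ?_) fun h9 => Ends.assign h7 ?_)
      · simp only [AExpr.Ok, AExpr.eval, AState.setReg_reg, if_true]
        exact ⟨⟨h6, hw _ (by omega)⟩, ⟨hw _ (by omega), h6⟩, by
          have := hw 2 (by omega)
          omega⟩
      · simp only [AExpr.eval, AState.setReg_reg, if_true] at h9
        refine main (f x) ?_ h6 _ hA1 (by simp) (by simp [hr']) (by simp [h4r]) (by simp [h4r'])
        rw [if_neg (by omega)]
      · simp only [AExpr.eval, AState.setReg_reg, if_true] at h9
        rw [h8]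
        refine main c ?_ hcW _ (hA1.setReg (by simp) _) (by simp) (by simp [hr']) (by simp [h4r])
          (by simp [h4r'])
        rw [if_pos (by omega)]
    · rw [h2] at h3
      refine Ends.nop ⟨Agree.refl _ _ _, hr', ?_⟩
      simp only [AState.setReg_reg, h3r, h3r', if_false]
      refine ⟨hS0, fun y hy hgy => ?_, hS2⟩
      by_cases hyx : y = x
      · exact absurd (hyx ▸ h3) hgy
      · exact hS1 y (by omega) hgy
  · intro σ' hA hS
    exact hQ σ' (hA0.trans hA (List.Subset.refl _) (List.Subset.refl _)
      (List.Subset.refl _) (List.Subset.refl _)) hS.2.1 hS.2.2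

/-- Marks the vertices with nonzero `g` as deleted in the frame at register 6. -/
def deleteLoop (g : AExpr) : AProg :=
  .iter 3 1 (.ite g (.store 15 (.add (.reg 6) (.reg 3)) (.const 1)) .nop)

theorem ends_deleteLoop (hΛ : Layout μ n l.length k) (hσ : Given l σ) {g : AExpr} {a : ℕ}
    (ha : σ.reg 6 = a) (haW : a + n < μ.W) (hal : a + n ≤ μ.len 15) (gf : ℕ → ℕ)
    (hg : ∀ x < n, ∀ σ', Agree [3] [15] σ σ' → σ'.reg 3 = x → g.Ok μ σ' ∧ g.eval σ' = gf x)
    (hQ : ∀ σ', Agree [3] [15] σ σ' →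
      (∀ x < n, σ'.arr 15 (a + x) = if gf x ≠ 0 then 1 else σ.arr 15 (a + x)) →
      (∀ y, y < a ∨ a + n ≤ y → σ'.arr 15 y = σ.arr 15 y) → Q σ') :
    Ends μ (deleteLoop g) σ Q := by
  refine Ends.iter [3] [15] (fun i σ' =>
    (∀ x < n, σ'.arr 15 (a + x) = if x < i ∧ gf x ≠ 0 then 1 else σ.arr 15 (a + x)) ∧
    (∀ y, y < a ∨ a + n ≤ y → σ'.arr 15 y = σ.arr 15 y)) (N := n)
    (by rw [hΛ.loops]; omega) (hΛ.lt_word (by omega)) (by simp) (by simp) hσ.n (by simp) ?_ ?_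
  · intro x hx σ' hA hr hS
    obtain ⟨h1, h2⟩ := hg x hx σ' hA hr
    have h6 : σ'.reg 6 = a := (hA.1 6 (by simp)).trans ha
    refine Ends.ite h1 (fun h3 => Ends.store ?_ ?_ ?_ ⟨?_, hr, ?_, ?_⟩) fun h3 =>
      Ends.nop ⟨Agree.refl _ _ _, hr, ?_, ?_⟩
    · simp only [AExpr.Ok, AExpr.eval, hr, h6]
      exact ⟨by omega, by omega, by omega⟩
    · exact hΛ.lt_word (by omega)
    · simp only [AExpr.eval, hr, h6]
      omega
    · exact (Agree.refl _ _ _).setArr (by simp) _ _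
    · intro y hy
      rw [h2] at h3
      simp only [AExpr.eval, hr, h6, AState.setReg_arr, AState.setArr_arr, true_and,
        Nat.add_left_cancel_iff]
      by_cases hyx : y = x
      · simp [hyx, h3]
      · rw [if_neg hyx, hS.1 y hy]
        congr 1
        simp only [eq_iff_iff, and_congr_left_iff]
        omega
    · intro y hy
      simp only [AExpr.eval, hr, h6, AState.setReg_arr, AState.setArr_arr, true_and]
      rw [if_neg (by omega), hS.2 y hy]
    · intro y hy
      rw [h2] at h3
      simp only [AState.setReg_arr]
      rw [hS.1 y hy]
      by_cases hyx : y = x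
      · simp [hyx, h3]
      · congr 1
        simp only [eq_iff_iff, and_congr_left_iff]
        omega
    · intro y hy
      exact hS.2 y hy
  · intro σ' hA hS
    refine hQ σ' hA (fun x hx => ?_) hS.2
    rw [hS.1 x hx]
    simp [hx]

/-- Copies the frame at register 6 to the next frame. The length of a frame is in register 11. -/
def copyLoop : AProg :=
  .iter 3 11 (.store 15 (.add (.add (.reg 6) (.reg 11)) (.reg 3))
    (.get 15 (.add (.reg 6) (.reg 3))))

theorem ends_copyLoop (hΛ : Layout μ n l.length k) {a : ℕ}
    (ha : σ.reg 6 = a) (hF : σ.reg 11 = n + 3) (hal : a + 2 * (n + 3) ≤ μ.len 15)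
    (haW : a + 2 * (n + 3) < μ.W)
    (hv : ∀ x < n + 3, σ.arr 15 (a + x) < μ.W)
    (hQ : ∀ σ', Agree [3] [15] σ σ' →
      (∀ x < n + 3, σ'.arr 15 (a + (n + 3) + x) = σ.arr 15 (a + x)) →
      (∀ y, y < a + (n + 3) → σ'.arr 15 y = σ.arr 15 y) → Q σ') :
    Ends μ copyLoop σ Q := by
  refine Ends.iter [3] [15] (fun i σ' =>
    (∀ x < i, σ'.arr 15 (a + (n + 3) + x) = σ.arr 15 (a + x)) ∧
    (∀ y, y < a + (n + 3) → σ'.arr 15 y = σ.arr 15 y)) (N := n + 3)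
    (by rw [hΛ.loops]; omega) (hΛ.lt_word (by omega)) (by simp) (by simp) hF (by simp) ?_
    (fun σ' hA hS => hQ σ' hA hS.1 hS.2)
  intro x hx σ' hA hr hS
  have h6 : σ'.reg 6 = a := (hA.1 6 (by simp)).trans ha
  have h11 : σ'.reg 11 = n + 3 := (hA.1 11 (by simp)).trans hF
  have hx' := hS.2 (a + x) (by omega)
  have hxv := hv x hx
  refine Ends.store ?_ ?_ ?_ ⟨?_, hr, ?_, ?_⟩
  · simp only [AExpr.Ok, AExpr.eval, hr, h6, h11]
    omega
  · simp only [AExpr.Ok, AExpr.eval, hr, h6, hx']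
    omega
  · simp only [AExpr.eval, hr, h6, h11]
    omega
  · exact (Agree.refl _ _ _).setArr (by simp) _ _
  · intro y hy
    simp only [AExpr.eval, hr, h6, h11, AState.setReg_arr, AState.setArr_arr, true_and,
      Nat.add_left_cancel_iff, hx']
    by_cases hyx : y = x
    · simp [hyx]
    · rw [if_neg hyx, hS.1 y (by omega)]
  · intro y hy
    simp only [AExpr.eval, hr, h6, h11, AState.setReg_arr, AState.setArr_arr, true_and]
    rw [if_neg (by omega), hS.2 y hy]

theorem mem_take_succ {j : ℕ} (hj : j < l.length) (e : Fin n × Fin n) :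
    e ∈ l.take (j + 1) ↔ e ∈ l.take j ∨ e = l[j] := by
  rw [List.take_succ_eq_append_getElem hj, List.mem_append, List.mem_singleton]

theorem IsEdgeList.adj {G : SimpleGraph (Fin n)} (hl : IsEdgeList G l) {e : Fin n × Fin n}
    (he : e ∈ l) : G.Adj e.1 e.2 := by
  have := (hl.2 s(e.1, e.2)).1 (List.mem_map.2 ⟨e, he, rfl⟩)
  simpa using this

theorem IsEdgeList.mem {G : SimpleGraph (Fin n)} (hl : IsEdgeList G l) {x y : Fin n}
    (h : G.Adj x y) : (x, y) ∈ l ∨ (y, x) ∈ l := by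
  obtain ⟨e, he, heq⟩ := List.mem_map.1 ((hl.2 s(x, y)).2 h)
  rw [Sym2.eq_iff] at heq
  rcases heq with ⟨h1, h2⟩ | ⟨h1, h2⟩
  · exact Or.inl (by rw [← h1, ← h2]; exact he)
  · exact Or.inr (by rw [← h1, ← h2]; exact he)

/-- Whether both endpoints of the current edge are alive. -/
def bothAlive : AExpr := .sub (.add (.get 1 (.reg 4)) (.get 1 (.reg 5))) (.const 1)

/-- Computes in array 3 the smallest vertex in the closed neighbourhood of each vertex. -/
def minLoop : AProg :=
  .seq (mapLoop 3 (.reg 3)) (edgeLoop (.ite bothAlive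
    (.seq (.ite (.sub (.get 3 (.reg 4)) (.reg 5)) (.store 3 (.reg 4) (.reg 5)) .nop)
      (.ite (.sub (.get 3 (.reg 5)) (.reg 4)) (.store 3 (.reg 5) (.reg 4)) .nop)) .nop))

/-- One pass suffices because labels are compared with the endpoints themselves and not with their
labels: the minimum is over the closed neighbourhood, not over the component. -/
theorem ends_minLoop {G : SimpleGraph (Fin n)} [DecidableRel G.Adj] (hl : IsEdgeList G l)
    (hΛ : Layout μ n l.length k) (hσ : Given l σ) {A : Finset (Fin n)}
    (h1 : ∀ x : Fin n, σ.arr 1 x = if x ∈ A then 1 else 0)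
    (hQ : ∀ σ', Agree [3, 4, 5] [3] σ σ' → (∀ x : Fin n, σ'.arr 3 x ≤ x ∧
      (σ'.arr 3 x = x ∨ ∃ y ∈ nb G A x, σ'.arr 3 x = y) ∧
      (x ∈ A → ∀ y ∈ nb G A x, σ'.arr 3 x ≤ y)) → Q σ') : Ends μ minLoop σ Q := by
  refine Ends.seq (ends_mapLoop hΛ hσ (by omega) (fun x => x) ?_ ?_)
  · intro x hx σ' _ h
    simp only [AExpr.Ok, AExpr.eval, h]
    exact ⟨hΛ.lt_word (by omega), trivial⟩
  intro σ₁ hA₁ h₁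
  refine ends_edgeLoop hΛ (hσ.agree hA₁ (by simp) (by simp) (by simp)) [3] (by simp)
    (fun j a => ∀ x : Fin n, a 3 x ≤ x ∧ (a 3 x = x ∨ ∃ y ∈ nb G A x, a 3 x = y) ∧
      (x ∈ A → ∀ y ∈ A, (x, y) ∈ l.take j ∨ (y, x) ∈ l.take j → a 3 x ≤ y)) ?_ ?_ ?_
  · intro x
    simp [h₁ x x.isLt]
  · intro j hj σ' hA h4 h5 hS
    have hl1 := hΛ.work 1 (by omega) (by omega)
    have hl3 := hΛ.work 3 (by omega) (by omega)
    have ha := l[j].1.isLt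
    have hb := l[j].2.isLt
    have hw : ∀ x, x < 16 * (n + l.length + k + 2) → x < μ.W := fun x hx => hΛ.lt_word hx
    have ha1 : σ'.arr 1 l[j].1 = if l[j].1 ∈ A then 1 else 0 := by
      rw [hA.2 1 (by simp), hA₁.2 1 (by simp), h1]
    have hb1 : σ'.arr 1 l[j].2 = if l[j].2 ∈ A then 1 else 0 := by
      rw [hA.2 1 (by simp), hA₁.2 1 (by simp), h1]
    have ha1' : σ'.arr 1 l[j].1 ≤ 1 := by rw [ha1]; split_ifs <;> omega
    have hb1' : σ'.arr 1 l[j].2 ≤ 1 := by rw [hb1]; split_ifs <;> omega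
    have ha3 := (hS l[j].1).1
    have hb3 := (hS l[j].2).1
    have hadj := hl.adj (List.getElem_mem hj)
    have hne : ((l[j].2 : Fin n) : ℕ) ≠ (l[j].1 : Fin n) := fun h => hadj.ne (Fin.ext h.symm)
    -- All outcomes of the tests change labels at the two endpoints only; they are treated together
    -- through the new label function `τ`.
    have conclude : ∀ τ : Fin n → ℕ,
        (∀ x, τ x = σ'.arr 3 x ∨ (l[j].1 ∈ A ∧ l[j].2 ∈ A ∧ τ x ≤ σ'.arr 3 x ∧
          ((x = l[j].1 ∧ τ x = l[j].2) ∨ (x = l[j].2 ∧ τ x = l[j].1)))) →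
        (l[j].1 ∈ A → l[j].2 ∈ A → τ l[j].1 ≤ l[j].2 ∧ τ l[j].2 ≤ l[j].1) →
        ∀ x : Fin n, τ x ≤ x ∧ (τ x = x ∨ ∃ y ∈ nb G A x, τ x = y) ∧
          (x ∈ A → ∀ y ∈ A, (x, y) ∈ l.take (j + 1) ∨ (y, x) ∈ l.take (j + 1) →
            τ x ≤ y) := by
      intro τ hτ hτ' x
      obtain ⟨hx1, hx2, hx3⟩ := hS x
      have hle : τ x ≤ σ'.arr 3 x := by
        rcases hτ x with h | h
        · exact h.le
        · exact h.2.2.1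
      refine ⟨hle.trans hx1, ?_, fun hxA y hyA hxy => ?_⟩
      · rcases hτ x with h | ⟨hA1, hA2, -, ⟨h, h'⟩ | ⟨h, h'⟩⟩
        · rw [h]
          exact hx2
        · refine Or.inr ⟨l[j].2, mem_nb.2 ⟨hA2, ?_⟩, h'⟩
          rw [h]
          exact hadj
        · refine Or.inr ⟨l[j].1, mem_nb.2 ⟨hA1, ?_⟩, h'⟩
          rw [h]
          exact hadj.symm
      · rw [mem_take_succ hj, mem_take_succ hj] at hxy
        by_cases hold : (x, y) ∈ l.take j ∨ (y, x) ∈ l.take j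
        · exact hle.trans (hx3 hxA y hyA hold)
        · have h' : (x, y) = l[j] ∨ (y, x) = l[j] := by tauto
          rcases h' with h' | h'
          · rw [← h'] at hτ'
            exact (hτ' hxA hyA).1
          · rw [← h'] at hτ'
            exact (hτ' hyA hxA).2
    simp only [bothAlive, AProg.pre, AExpr.Ok, AExpr.eval, h4, h5, hl1, hl3,
      AState.setArr_reg, AState.setArr_arr, hne, true_and, if_false]
    refine ⟨⟨⟨⟨hw _ (by omega), ha, hw _ (by omega)⟩, ⟨hw _ (by omega), hb, hw _ (by omega)⟩,
      hw _ (by omega)⟩, hw _ (by omega)⟩, fun hal => ⟨⟨⟨hw _ (by omega), ha, hw _ (by omega)⟩,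
      hw _ (by omega)⟩, fun h6 => ⟨hw _ (by omega), hw _ (by omega), ha, ⟨⟨hw _ (by omega), hb,
      hw _ (by omega)⟩, hw _ (by omega)⟩, fun h7 => ⟨hw _ (by omega), hw _ (by omega), hb, ?_⟩,
      fun h7 => ?_⟩, fun h6 => ⟨⟨⟨hw _ (by omega), hb, hw _ (by omega)⟩, hw _ (by omega)⟩,
      fun h7 => ⟨hw _ (by omega), hw _ (by omega), hb, ?_⟩, fun h7 => ?_⟩⟩, fun hal => ?_⟩
    all_goals refine ⟨?_, conclude _ ?_ ?_⟩
    any_goals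
      first
      | exact Agree.refl _ _ _
      | exact (Agree.refl _ _ _).setArr (by simp) _ _
      | exact ((Agree.refl _ _ _).setArr (by simp) _ _).setArr (by simp) _ _
    all_goals
      rw [ha1, hb1] at hal
      by_cases hA1 : l[j].1 ∈ A <;> by_cases hA2 : l[j].2 ∈ A <;>
        simp only [hA1, hA2, if_true, if_false] at hal <;>
        simp only [hA1, hA2, true_and, false_and, or_false, imp_true_iff,
          forall_const, IsEmpty.forall_iff, hne, hne.symm, if_true, if_false] <;> first
        | omega
        | skip
    all_goals
      intro x
      by_cases hxa : x = l[j].1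
      · subst hxa
        simp [hne, hne.symm] <;> omega
      · by_cases hxb : x = l[j].2
        · subst hxb
          simp [hne, hne.symm] <;> omega
        · simp [hxa, hxb, Fin.val_inj]
  · intro σ' hA hS
    refine hQ σ' (hA₁.trans hA (by simp) (List.Subset.refl _) (List.Subset.refl _)
      (List.Subset.refl _)) fun x => ⟨(hS x).1, (hS x).2.1, fun hx y hy => ?_⟩
    rw [List.take_length] at hS
    exact (hS x).2.2 hx y (mem_nb.1 hy).1 (hl.mem (mem_nb.1 hy).2)

/-- Marks in array 4 the endpoints of the edges whose endpoints differ in array 2 or array 3. -/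
def markLoop : AProg :=
  .seq (mapLoop 4 (.const 0)) (edgeLoop (.ite bothAlive
    (.ite (.add (.add (.sub (.get 2 (.reg 4)) (.get 2 (.reg 5)))
        (.sub (.get 2 (.reg 5)) (.get 2 (.reg 4))))
      (.add (.sub (.get 3 (.reg 4)) (.get 3 (.reg 5))) (.sub (.get 3 (.reg 5)) (.get 3 (.reg 4)))))
      (.seq (.store 4 (.reg 4) (.const 1)) (.store 4 (.reg 5) (.const 1))) .nop) .nop))

theorem ends_markLoop {G : SimpleGraph (Fin n)} [DecidableRel G.Adj] (hl : IsEdgeList G l)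
    (hΛ : Layout μ n l.length k) (hσ : Given l σ) {A : Finset (Fin n)}
    (h1 : ∀ x : Fin n, σ.arr 1 x = if x ∈ A then 1 else 0)
    (h2 : ∀ x : Fin n, σ.arr 2 x ≤ n) (h3 : ∀ x : Fin n, σ.arr 3 x ≤ n)
    (hQ : ∀ σ', Agree [3, 4, 5] [4] σ σ' → (∀ x : Fin n, σ'.arr 4 x ≤ 1 ∧
      (σ'.arr 4 x ≠ 0 ↔ x ∈ A ∧ ∃ y ∈ nb G A x,
        ¬ (σ.arr 2 x = σ.arr 2 y ∧ σ.arr 3 x = σ.arr 3 y))) → Q σ') : Ends μ markLoop σ Q := by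
  refine Ends.seq (ends_mapLoop hΛ hσ (by omega) (fun x => 0) ?_ ?_)
  · intro x hx σ' _ h
    exact ⟨hΛ.lt_word (by omega), rfl⟩
  intro σ₁ hA₁ h₁
  refine ends_edgeLoop hΛ (hσ.agree hA₁ (by simp) (by simp) (by simp)) [4] (by simp)
    (fun j a => ∀ x : Fin n, a 4 x ≤ 1 ∧ (a 4 x ≠ 0 ↔ x ∈ A ∧ ∃ y ∈ A,
      ((x, y) ∈ l.take j ∨ (y, x) ∈ l.take j) ∧
        ¬ (σ.arr 2 x = σ.arr 2 y ∧ σ.arr 3 x = σ.arr 3 y))) ?_ ?_ ?_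
  · intro x
    simp [h₁ x x.isLt]
  · intro j hj σ' hA h4 h5 hS
    have hl1 := hΛ.work 1 (by omega) (by omega)
    have hl2 := hΛ.work 2 (by omega) (by omega)
    have hl3 := hΛ.work 3 (by omega) (by omega)
    have hl4 := hΛ.work 4 (by omega) (by omega)
    have ha := l[j].1.isLt
    have hb := l[j].2.isLt
    have hw : ∀ x, x < 16 * (n + l.length + k + 2) → x < μ.W := fun x hx => hΛ.lt_word hx
    have ha1 : σ'.arr 1 l[j].1 = if l[j].1 ∈ A then 1 else 0 := by
      rw [hA.2 1 (by simp), hA₁.2 1 (by simp), h1]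
    have hb1 : σ'.arr 1 l[j].2 = if l[j].2 ∈ A then 1 else 0 := by
      rw [hA.2 1 (by simp), hA₁.2 1 (by simp), h1]
    have ha1' : σ'.arr 1 l[j].1 ≤ 1 := by rw [ha1]; split_ifs <;> omega
    have hb1' : σ'.arr 1 l[j].2 ≤ 1 := by rw [hb1]; split_ifs <;> omega
    have e2 : σ'.arr 2 = σ.arr 2 := (hA.2 2 (by simp)).trans (hA₁.2 2 (by simp))
    have e3 : σ'.arr 3 = σ.arr 3 := (hA.2 3 (by simp)).trans (hA₁.2 3 (by simp))
    have a2 := h2 l[j].1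
    have b2 := h2 l[j].2
    have a3 := h3 l[j].1
    have b3 := h3 l[j].2
    simp only [bothAlive, AProg.pre, AExpr.Ok, AExpr.eval, h4, h5, hl1, hl2, hl3, hl4, e2, e3,
      AState.setArr_reg]
    have step : ∀ x : Fin n, (x ∈ A ∧ ∃ y ∈ A,
        ((x, y) ∈ l.take (j + 1) ∨ (y, x) ∈ l.take (j + 1)) ∧
          ¬ (σ.arr 2 x = σ.arr 2 y ∧ σ.arr 3 x = σ.arr 3 y)) ↔
        ((x ∈ A ∧ ∃ y ∈ A, ((x, y) ∈ l.take j ∨ (y, x) ∈ l.take j) ∧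
          ¬ (σ.arr 2 x = σ.arr 2 y ∧ σ.arr 3 x = σ.arr 3 y)) ∨
        (l[j].1 ∈ A ∧ l[j].2 ∈ A ∧ ¬ (σ.arr 2 l[j].1 = σ.arr 2 l[j].2 ∧
          σ.arr 3 l[j].1 = σ.arr 3 l[j].2) ∧ (x = l[j].1 ∨ x = l[j].2))) := by
      intro x
      simp only [mem_take_succ hj]
      constructor
      · rintro ⟨hx, y, hy, hxy, hd⟩
        by_cases hold : (x, y) ∈ l.take j ∨ (y, x) ∈ l.take j
        · exact Or.inl ⟨hx, y, hy, hold, hd⟩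
        · right
          have h' : (x, y) = l[j] ∨ (y, x) = l[j] := by tauto
          rcases h' with h' | h'
          · rw [← h']
            exact ⟨hx, hy, hd, Or.inl rfl⟩
          · rw [← h']
            exact ⟨hy, hx, fun h => hd ⟨h.1.symm, h.2.symm⟩, Or.inr rfl⟩
      · rintro (⟨hx, y, hy, hxy, hd⟩ | ⟨h1, h2, hd, rfl | rfl⟩)
        · exact ⟨hx, y, hy, by tauto, hd⟩
        · exact ⟨h1, l[j].2, h2, Or.inl (Or.inr rfl), hd⟩
        · exact ⟨h2, l[j].1, h1, Or.inr (Or.inr rfl), fun h => hd ⟨h.1.symm, h.2.symm⟩⟩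
    refine ⟨⟨⟨⟨hw _ (by omega), ha, hw _ (by omega)⟩, ⟨hw _ (by omega), hb, hw _ (by omega)⟩,
      hw _ (by omega)⟩, hw _ (by omega)⟩, fun hal => ⟨⟨⟨⟨⟨hw _ (by omega), ha, hw _ (by omega)⟩,
      hw _ (by omega), hb, hw _ (by omega)⟩, ⟨⟨hw _ (by omega), hb, hw _ (by omega)⟩,
      hw _ (by omega), ha, hw _ (by omega)⟩, hw _ (by omega)⟩,
      ⟨⟨⟨hw _ (by omega), ha, hw _ (by omega)⟩,
      hw _ (by omega), hb, hw _ (by omega)⟩, ⟨⟨hw _ (by omega), hb, hw _ (by omega)⟩,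
      hw _ (by omega), ha, hw _ (by omega)⟩, hw _ (by omega)⟩, hw _ (by omega)⟩, fun hd =>
      ⟨hw _ (by omega), hw _ (by omega), ha, hw _ (by omega), hw _ (by omega), hb,
      ((Agree.refl _ _ _).setArr (by simp) _ _).setArr (by simp) _ _, ?_⟩,
      fun hd => ⟨Agree.refl _ _ _, ?_⟩⟩, fun hal => ⟨Agree.refl _ _ _, ?_⟩⟩
    · intro x
      rw [step x, ← (hS x).2]
      have hA1 : l[j].1 ∈ A := by
        by_contra h
        rw [ha1, if_neg h] at hal
        omega
      have hA2 : l[j].2 ∈ A := by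
        by_contra h
        rw [hb1, if_neg h] at hal
        omega
      have hd' : ¬ (σ.arr 2 l[j].1 = σ.arr 2 l[j].2 ∧ σ.arr 3 l[j].1 = σ.arr 3 l[j].2) := by omega
      simp only [AState.setArr_arr, true_and, Fin.val_inj, hA1, hA2, hd', not_false_eq_true]
      have := (hS x).1
      by_cases hx1 : x = l[j].1 <;> by_cases hx2 : x = l[j].2 <;> simp [hx1, hx2]
      simpa [hx1, hx2] using this
    · intro x
      rw [step x, ← (hS x).2]
      have hd' : (σ.arr 2 l[j].1 = σ.arr 2 l[j].2 ∧ σ.arr 3 l[j].1 = σ.arr 3 l[j].2) := by omega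
      simp [hd', (hS x).1]
    · intro x
      rw [step x, ← (hS x).2]
      have : ¬ (l[j].1 ∈ A ∧ l[j].2 ∈ A) := by
        rintro ⟨h, h'⟩
        rw [ha1, hb1, if_pos h, if_pos h'] at hal
        omega
      refine ⟨(hS x).1, ?_⟩
      tauto
  · intro σ' hA hS
    refine hQ σ' (hA₁.trans hA (by simp) (List.Subset.refl _) (List.Subset.refl _)
      (List.Subset.refl _)) fun x => ⟨(hS x).1, (hS x).2.trans ?_⟩
    rw [List.take_length]
    constructor
    · rintro ⟨hx, y, hy, hxy, hd⟩
      refine ⟨hx, y, mem_nb.2 ⟨hy, ?_⟩, hd⟩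
      rcases hxy with h | h
      · exact hl.adj h
      · exact (hl.adj h).symm
    · rintro ⟨hx, y, hy, hd⟩
      exact ⟨hx, y, (mem_nb.1 hy).1, hl.mem (mem_nb.1 hy).2, hd⟩

end MoreLoops

/-! ### Reading the shape of the conflicts, and cluster graphs, from counts. -/

section Counting

variable {V : Type*} [DecidableEq V] {G : SimpleGraph V} [DecidableRel G.Adj]
variable {A : Finset V} {v w : V}

theorem card_nb_eq {x : V} (hx : x ∈ nb G A v) : (nb G A v).card =
    ((nb G A v).filter (G.Adj x)).card + ((hn G A v x).filter fun y => G.Adj v y).card + 1 := by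
  have h1 : nb G A v = insert x ((nb G A v).filter (G.Adj x) ∪
      (hn G A v x).filter fun y => G.Adj v y) := by
    obtain ⟨hxA, hvx⟩ := mem_nb.1 hx
    ext y
    simp only [mem_nb, mem_hn, Finset.mem_insert, Finset.mem_union, Finset.mem_filter, Conf]
    constructor
    · rintro ⟨hy, hvy⟩
      have := hvy.ne'
      tauto
    · rintro (rfl | h) <;> tauto
  conv_lhs => rw [h1]
  rw [Finset.card_insert_of_notMem, Finset.card_union_of_disjoint]
  · rw [Finset.disjoint_left]
    intro y hy hy'
    simp only [mem_hn, Finset.mem_filter, Conf] at hy hy'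
    tauto
  · simp [mem_hn, Conf]

theorem hdeg_eq_add (x : V) :
    hdeg G A v x = ((hn G A v x).filter fun y => G.Adj v y).card + hout G A v x :=
  (Finset.card_filter_add_card_filter_not (s := hn G A v x) fun y => G.Adj v y).symm

/-- The conflicts of `x` are found without enumerating pairs: both counts on the right are numbers
of neighbours in a fixed set, so one pass over the edges finds each of them for all `x`. The
subtraction does not truncate. -/
theorem hdeg_eq {x : V} (hx : x ∈ nb G A v) : hdeg G A v x =
    (nb G A v).card - 1 - ((nb G A v).filter (G.Adj x)).card + hout G A v x := by
  rw [hdeg_eq_add, card_nb_eq hx]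
  omega

theorem hout_eq (x : V) : hout G A v x =
    (A.filter fun y => G.Adj x y ∧ ¬ G.Adj v y ∧ y ≠ v).card := by
  unfold hout
  congr 1
  ext y
  simp only [Finset.mem_filter, mem_hn, Conf]
  constructor
  · tauto
  · rintro ⟨hy, hxy, hvy, hyv⟩
    have := hxy.ne'
    tauto

/-- In `esum` an inner conflict is counted at both ends, and an outer one by `hdeg` and by `hout`.
So the sum on the right is twice the number of conflicts that avoid `y`. -/
theorem esum_eq {y : V} (hy : y ∈ nb G A v) : esum G A v = 2 * hdeg G A v y +
    ∑ x ∈ (nb G A v).erase y, (((hn G A v x).erase y).card + hout G A v x) := by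
  have h1 : ∀ x ∈ (nb G A v).erase y, hdeg G A v x + hout G A v x =
      (((hn G A v x).erase y).card + hout G A v x) + if x ∈ hn G A v y then 1 else 0 := by
    intro x hx
    obtain ⟨-, hx⟩ := Finset.mem_erase.1 hx
    by_cases h : x ∈ hn G A v y
    · have := Finset.card_erase_add_one (mem_hn_comm hy h (mem_nb.1 hx).2).2
      rw [if_pos h]
      unfold hdeg
      omega
    · have h' : y ∉ hn G A v x := fun h' => h (mem_hn_comm hx h' (mem_nb.1 hy).2).2
      rw [if_neg h, Finset.erase_eq_of_notMem h']
      rfl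
  have h2 : (hn G A v y).filter (fun x => G.Adj v x) =
      ((nb G A v).erase y).filter fun x => x ∈ hn G A v y := by
    ext x
    simp only [Finset.mem_filter, Finset.mem_erase]
    constructor
    · rintro ⟨h, h'⟩
      exact ⟨⟨ne_of_mem_hn h, (mem_hn_comm hy h h').1⟩, h⟩
    · rintro ⟨⟨-, h⟩, h'⟩
      exact ⟨h', (mem_nb.1 h).2⟩
  unfold esum
  rw [← Finset.add_sum_erase _ _ hy, Finset.sum_congr rfl h1, Finset.sum_add_distrib,
    ← Finset.card_filter, ← h2]
  have := hdeg_eq_add (G := G) (A := A) (v := v) y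
  omega

theorem covers_iff {y : V} (hy : y ∈ nb G A v) :
    Covers G A v y y ↔ esum G A v ≤ 2 * hdeg G A v y := by
  rw [esum_eq hy]
  have : Covers G A v y y ↔
      ∑ x ∈ (nb G A v).erase y, (((hn G A v x).erase y).card + hout G A v x) = 0 := by
    rw [Finset.sum_eq_zero_iff]
    constructor
    · intro h x hx
      obtain ⟨hxy, hx⟩ := Finset.mem_erase.1 hx
      have h1 : (hn G A v x).erase y = ∅ := by
        rw [Finset.eq_empty_iff_forall_notMem]
        intro z hz
        obtain ⟨hzy, hz⟩ := Finset.mem_erase.1 hz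
        have := h x hx z hz
        tauto
      have h2 : hout G A v x ≤ ((hn G A v x).erase y).card := by
        apply Finset.card_le_card
        intro z hz
        obtain ⟨hz, hvz⟩ := Finset.mem_filter.1 hz
        exact Finset.mem_erase.2 ⟨fun h => hvz (h ▸ (mem_nb.1 hy).2), hz⟩
      rw [h1, Finset.card_empty] at h2 ⊢
      omega
    · intro h x hx z hz
      by_contra hcon
      push Not at hcon
      have h1 := h x (Finset.mem_erase.2 ⟨hcon.1, hx⟩)
      have h2 : 0 < ((hn G A v x).erase y).card :=
        Finset.card_pos.2 ⟨z, Finset.mem_erase.2 ⟨hcon.2.1, hz⟩⟩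
      omega
  rw [this]
  omega

/-- Exactly one conflict avoids `w`, and `c` is one of its ends. A second one, avoiding `c` too,
would raise the remaining sum above 2. -/
theorem exists_covers_of_esum (hw : w ∈ nb G A v) (he : esum G A v = 2 * (hdeg G A v w + 1)) :
    ∃ c, Covers G A v w c := by
  rw [esum_eq hw] at he
  set f : V → ℕ := fun x => ((hn G A v x).erase w).card + hout G A v x with hf
  have hsum : ∑ x ∈ (nb G A v).erase w, f x = 2 := by
    change 2 * hdeg G A v w + ∑ x ∈ (nb G A v).erase w, f x = _ at he
    omega
  have hpos : ∀ x q, q ∈ hn G A v x → q ≠ w → 0 < ((hn G A v x).erase w).card := fun x q hq hqw =>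
    Finset.card_pos.2 ⟨q, Finset.mem_erase.2 ⟨hqw, hq⟩⟩
  by_cases h : ∃ x ∈ nb G A v, x ≠ w ∧ ∃ q ∈ hn G A v x, q ≠ w
  · obtain ⟨x, hx, hxw, q, hq, hqw⟩ := h
    refine ⟨x, fun p hp r hr => ?_⟩
    by_contra hcon
    push Not at hcon
    obtain ⟨hpw, hrw, hpx, hrx⟩ := hcon
    have h1 := hpos x q hq hqw
    have h2 := hpos p r hr hrw
    have hxm : x ∈ (nb G A v).erase w := Finset.mem_erase.2 ⟨hxw, hx⟩
    have hpm : p ∈ ((nb G A v).erase w).erase x :=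
      Finset.mem_erase.2 ⟨hpx, Finset.mem_erase.2 ⟨hpw, hp⟩⟩
    rw [← Finset.add_sum_erase _ _ hxm, ← Finset.add_sum_erase _ _ hpm] at hsum
    by_cases hvr : G.Adj v r
    · obtain ⟨hrn, hpr⟩ := mem_hn_comm hp hr hvr
      have h3 := hpos r p hpr hpw
      have hrm : r ∈ (((nb G A v).erase w).erase x).erase p := Finset.mem_erase.2
        ⟨ne_of_mem_hn hr, Finset.mem_erase.2 ⟨hrx, Finset.mem_erase.2 ⟨hrw, hrn⟩⟩⟩
      rw [← Finset.add_sum_erase _ _ hrm] at hsum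
      simp only [hf] at hsum
      omega
    · have h3 : 0 < hout G A v p := Finset.card_pos.2 ⟨r, Finset.mem_filter.2 ⟨hr, hvr⟩⟩
      simp only [hf] at hsum
      omega
  · push Not at h
    refine ⟨w, fun x hx y hy => ?_⟩
    by_cases hxw : x = w
    · exact Or.inl hxw
    · exact Or.inr (Or.inl (h x hx hxw y hy))

/-- If the preferred vertex has two conflicts, then two is the maximum, and a total of 8 over four
neighbours forces two at each. -/
theorem butterfly_iff (hw : Pref G A v w) : Butterfly G A v ↔
    (nb G A v).card = 4 ∧ ∑ x ∈ nb G A v, hout G A v x = 0 ∧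
      ∑ x ∈ nb G A v, hdeg G A v x = 8 ∧ hdeg G A v w = 2 := by
  constructor
  · rintro ⟨h1, h2⟩
    refine ⟨h1, Finset.sum_eq_zero fun x hx => (h2 x hx).2, ?_, (h2 w hw.1).1⟩
    rw [Finset.sum_congr rfl fun x hx => (h2 x hx).1, Finset.sum_const, h1, smul_eq_mul]
  · rintro ⟨h1, h2, h3, h4⟩
    rw [Finset.sum_eq_zero_iff] at h2
    have hle : ∀ x ∈ nb G A v, hdeg G A v x ≤ 2 := by
      rcases hw.2.2 with h | h
      · omega
      · intro x hx
        have := (h x hx).2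
        omega
    refine ⟨h1, fun x hx => ⟨?_, h2 x hx⟩⟩
    rw [← Finset.add_sum_erase _ _ hx] at h3
    have h5 : ∑ y ∈ (nb G A v).erase x, hdeg G A v y ≤ ∑ y ∈ (nb G A v).erase x, 2 :=
      Finset.sum_le_sum fun y hy => hle y (Finset.mem_erase.1 hy).2
    rw [Finset.sum_const, Finset.card_erase_of_mem hx, h1, smul_eq_mul] at h5
    have := hle x hx
    omega

theorem nb_insert_eq {x y : V} (hx : x ∈ A) (hy : y ∈ nb G A x)
    (h : ∀ z ∈ hn G A x y, False) : insert x (nb G A x) = insert y (nb G A y) := by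
  obtain ⟨hyA, hxy⟩ := mem_nb.1 hy
  ext z
  simp only [Finset.mem_insert, mem_nb]
  by_cases hzx : z = x
  · subst hzx
    simp [hx, hxy.symm]
  by_cases hzy : z = y
  · subst hzy
    simp [hyA, hxy]
  by_cases hzA : z ∈ A
  · have := h z
    rw [mem_hn] at this
    unfold Conf at this
    tauto
  · tauto

/-- Endpoints of edges between vertices with different closed neighbourhoods can be told from the
degrees and the smallest elements of the closed neighbourhoods. -/
theorem hasConf_of_ne {f : V → ℕ} {r : V → ℕ}
    (hr1 : ∀ x ∈ A, r x = f x ∨ ∃ y ∈ nb G A x, r x = f y)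
    (hr2 : ∀ x ∈ A, r x ≤ f x ∧ ∀ y ∈ nb G A x, r x ≤ f y) {x : V} (hx : x ∈ A)
    (h : ∃ y ∈ nb G A x, ¬ ((nb G A x).card = (nb G A y).card ∧ r x = r y)) : HasConf G A x := by
  obtain ⟨y, hy, h⟩ := h
  by_contra hcon
  have hnone : ∀ z ∈ hn G A x y, False := fun z hz => hcon ⟨y, hy, z, hz⟩
  have heq := nb_insert_eq hx hy hnone
  obtain ⟨hyA, hxy⟩ := mem_nb.1 hy
  apply h
  constructor
  · have h1 : (insert x (nb G A x)).card = (nb G A x).card + 1 :=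
      Finset.card_insert_of_notMem (by simp [mem_nb])
    have h2 : (insert y (nb G A y)).card = (nb G A y).card + 1 :=
      Finset.card_insert_of_notMem (by simp [mem_nb])
    rw [heq] at h1
    omega
  · have mem1 : ∀ a ∈ A, ∃ b ∈ insert a (nb G A a), r a = f b := by
      intro a ha
      rcases hr1 a ha with h | ⟨b, hb, h⟩
      · exact ⟨a, by simp, h⟩
      · exact ⟨b, by simp [hb], h⟩
    have le1 : ∀ a ∈ A, ∀ b ∈ insert a (nb G A a), r a ≤ f b := by
      intro a ha b hb
      rcases Finset.mem_insert.1 hb with rfl | hb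
      · exact (hr2 b ha).1
      · exact (hr2 a ha).2 b hb
    obtain ⟨a, ha, ha'⟩ := mem1 x hx
    obtain ⟨b, hb, hb'⟩ := mem1 y hyA
    have h1 := le1 x hx b (heq ▸ hb)
    have h2 := le1 y hyA a (heq ▸ ha)
    omega

/-- Let `c` be the vertex labelling the component of `y`. Every vertex with this label equals `c` or
is adjacent to `c`, so closed neighbourhoods in the component are contained in that of `c`. Equal
degrees make the one of `x` equal to it, and it contains `z`. -/
theorem clus_of_eq {f : V → ℕ} {r : V → ℕ} (hf : Function.Injective f)
    (hr1 : ∀ x ∈ A, r x = f x ∨ ∃ y ∈ nb G A x, r x = f y)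
    (h : ∀ x ∈ A, ∀ y ∈ nb G A x, (nb G A x).card = (nb G A y).card ∧ r x = r y) :
    Clus G A := by
  intro x hx y hy z hz hxy hyz hxz
  obtain ⟨c, hcA, hc⟩ : ∃ c ∈ A, r y = f c := by
    rcases hr1 y hy with h | ⟨c, hc, h⟩
    · exact ⟨y, hy, h⟩
    · exact ⟨c, (mem_nb.1 hc).1, h⟩
  have hadj : ∀ a ∈ A, r a = f c → a = c ∨ c ∈ nb G A a := by
    intro a ha hra
    rcases hr1 a ha with h | ⟨b, hb, h⟩
    · exact Or.inl (hf (h.symm.trans hra))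
    · rw [← hf (h.symm.trans hra)]
      exact Or.inr hb
  have hrx : r x = f c := ((h x hx y (mem_nb.2 ⟨hy, hxy⟩)).2).trans hc
  have hrz : r z = f c := ((h y hy z (mem_nb.2 ⟨hz, hyz⟩)).2).symm.trans hc
  have hrc : r c = f c := by
    rcases hadj y hy hc with rfl | h'
    · exact hc
    · exact (h y hy c h').2.symm.trans hc
  have hdeg : (nb G A x).card = (nb G A c).card := by
    rcases hadj x hx hrx with rfl | h'
    · rfl
    · exact (h x hx c h').1
  have hsub : ∀ a ∈ A, r a = f c → insert a (nb G A a) ⊆ insert c (nb G A c) := by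
    intro a ha hra b hb
    have hbA : b ∈ A := by
      rcases Finset.mem_insert.1 hb with rfl | hb
      · exact ha
      · exact (mem_nb.1 hb).1
    have hrb : r b = f c := by
      rcases Finset.mem_insert.1 hb with rfl | hb
      · exact hra
      · exact (h a ha b hb).2.symm.trans hra
    rw [Finset.mem_insert]
    rcases hadj b hbA hrb with h' | h'
    · exact Or.inl h'
    · exact Or.inr (mem_nb.2 ⟨hbA, (mem_nb.1 h').2.symm⟩)
  have hcard : ∀ a, (insert a (nb G A a)).card = (nb G A a).card + 1 := fun a =>
    Finset.card_insert_of_notMem (by simp [mem_nb])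
  have heq : insert x (nb G A x) = insert c (nb G A c) :=
    Finset.eq_of_subset_of_card_le (hsub x hx hrx) (by rw [hcard, hcard, hdeg])
  have hzx : z ∈ insert x (nb G A x) := by
    rw [heq]
    exact hsub z hz hrz (by simp)
  rcases Finset.mem_insert.1 hzx with h' | h'
  · exact absurd h'.symm hxz
  · exact (mem_nb.1 h').2

end Counting

/-! ### The passes for functions and sets of vertices. -/

section VertexLoops

variable {μ : Mach} {n k : ℕ} {l : List (Fin n × Fin n)} {σ : AState} {Q : AState → Prop}

/-- The extension of a function on the vertices by zero. -/
def extend (f : Fin n → ℕ) (x : ℕ) : ℕ := if h : x < n then f ⟨x, h⟩ else 0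

theorem extend_val (f : Fin n → ℕ) (x : Fin n) : extend f x = f x := by simp [extend]

theorem extend_of_lt (f : Fin n → ℕ) {x : ℕ} (h : x < n) : extend f x = f ⟨x, h⟩ := by
  simp [extend, h]

theorem ends_mapLoop_fin (hΛ : Layout μ n l.length k) (hσ : Given l σ) {j : ℕ} {e : AExpr}
    (hj : 1 ≤ j ∧ j ≤ 14) (f : Fin n → ℕ)
    (he : ∀ x : Fin n, ∀ σ', Agree [3] [j] σ σ' → σ'.reg 3 = x → e.Ok μ σ' ∧ e.eval σ' = f x)
    (hQ : ∀ σ', Agree [3] [j] σ σ' → (∀ x : Fin n, σ'.arr j x = f x) → Q σ') :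
    Ends μ (mapLoop j e) σ Q := by
  refine ends_mapLoop hΛ hσ hj (extend f) (fun x hx σ' hA h => ?_) fun σ' hA h =>
    hQ σ' hA fun x => ?_
  · rw [extend_of_lt f hx]
    exact he ⟨x, hx⟩ σ' hA h
  · rw [h x x.isLt, extend_val]

theorem ends_sumLoop_fin (hΛ : Layout μ n l.length k) (hσ : Given l σ) {r : ℕ} {g e : AExpr}
    (hr : 6 ≤ r) (S : Finset (Fin n)) (f : Fin n → ℕ)
    (hg : ∀ x : Fin n, ∀ σ', Agree [3, r] [] σ σ' → σ'.reg 3 = x →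
      g.Ok μ σ' ∧ g.eval σ' = if x ∈ S then 1 else 0)
    (he : ∀ x ∈ S, ∀ σ', Agree [3, r] [] σ σ' → σ'.reg 3 = x → e.Ok μ σ' ∧ e.eval σ' = f x)
    (hW : ∑ x ∈ S, f x < μ.W)
    (hQ : ∀ σ', Agree [3, r] [] σ σ' → σ'.reg r = ∑ x ∈ S, f x → Q σ') :
    Ends μ (sumLoop r g e) σ Q := by
  have hsum : ∑ x ∈ Finset.range n,
      (if extend (fun x => if x ∈ S then 1 else 0) x ≠ 0 then extend f x else 0) =
      ∑ x ∈ S, f x := by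
    rw [Finset.sum_range, ← Finset.sum_filter]
    refine Finset.sum_congr ?_ fun x _ => extend_val f x
    ext x
    simp [extend_val]
  refine ends_sumLoop hΛ hσ hr (extend fun x => if x ∈ S then 1 else 0) (extend f)
    (fun x hx σ' hA h => ?_) (fun x hx σ' hA h hS => ?_) (by rwa [hsum])
    fun σ' hA h => hQ σ' hA (h.trans hsum)
  · rw [extend_of_lt _ hx]
    exact hg ⟨x, hx⟩ σ' hA h
  · rw [extend_of_lt _ hx] at hS ⊢
    exact he ⟨x, hx⟩ (by simpa using hS) σ' hA h

theorem ends_maxLoop_fin (hΛ : Layout μ n l.length k) (hσ : Given l σ) {r : ℕ} {g e b : AExpr}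
    (hr : 6 ≤ r) (S : Finset (Fin n)) (f : Fin n → ℕ) (c : ℕ) (hcW : c < μ.W)
    (hg : ∀ x : Fin n, ∀ σ', Agree [3, 4, r, r + 1] [] σ σ' → σ'.reg 3 = x →
      g.Ok μ σ' ∧ g.eval σ' = if x ∈ S then 1 else 0)
    (he : ∀ x ∈ S, ∀ σ', Agree [3, 4, r, r + 1] [] σ σ' → σ'.reg 3 = x →
      e.Ok μ σ' ∧ e.eval σ' = f x ∧ f x < μ.W)
    (hb : ∀ σ', Agree [3, 4, r, r + 1] [] σ σ' → b.Ok μ σ' ∧ b.eval σ' = c)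
    (hQ : ∀ σ', Agree [3, 4, r, r + 1] [] σ σ' →
      (∀ x ∈ S, (if f x = 1 then c else f x) ≤ σ'.reg r) →
      (σ'.reg r ≠ 0 → ∃ x ∈ S, σ'.reg (r + 1) = x ∧ (if f x = 1 then c else f x) = σ'.reg r) →
      Q σ') :
    Ends μ (maxLoop r g e b) σ Q := by
  refine ends_maxLoop hΛ hσ hr (extend fun x => if x ∈ S then 1 else 0) (extend f) c hcW
    (fun x hx σ' hA h => ?_) (fun x hx σ' hA h hS => ?_) hb
    fun σ' hA h h' => hQ σ' hA (fun x hx => ?_) fun h0 => ?_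
  · rw [extend_of_lt _ hx]
    exact hg ⟨x, hx⟩ σ' hA h
  · rw [extend_of_lt _ hx] at hS ⊢
    exact he ⟨x, hx⟩ (by simpa using hS) σ' hA h
  · have := h x x.isLt
    rw [extend_val, extend_val] at this
    exact this (by simp [hx])
  · obtain ⟨h1, h2, h3⟩ := h' h0
    rw [extend_of_lt _ h1] at h2 h3
    exact ⟨⟨_, h1⟩, by simpa using h2, rfl, h3⟩

theorem ends_deleteLoop_fin (hΛ : Layout μ n l.length k) (hσ : Given l σ) {g : AExpr} {a : ℕ}
    (ha : σ.reg 6 = a) (haW : a + n < μ.W) (hal : a + n ≤ μ.len 15) (S : Finset (Fin n))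
    (hg : ∀ x : Fin n, ∀ σ', Agree [3] [15] σ σ' → σ'.reg 3 = x →
      g.Ok μ σ' ∧ g.eval σ' = if x ∈ S then 1 else 0)
    (hQ : ∀ σ', Agree [3] [15] σ σ' →
      (∀ x : Fin n, σ'.arr 15 (a + x) = if x ∈ S then 1 else σ.arr 15 (a + x)) →
      (∀ y, y < a ∨ a + n ≤ y → σ'.arr 15 y = σ.arr 15 y) → Q σ') :
    Ends μ (deleteLoop g) σ Q := by
  refine ends_deleteLoop hΛ hσ ha haW hal (extend fun x => if x ∈ S then 1 else 0)
    (fun x hx σ' hA h => ?_) fun σ' hA h h' => hQ σ' hA (fun x => ?_) h'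
  · rw [extend_of_lt _ hx]
    exact hg ⟨x, hx⟩ σ' hA h
  · rw [h x x.isLt, extend_val]
    simp

end VertexLoops

/-! ### The stack of nodes in the memory. -/

section Stacks

variable {μ : Mach} {n k : ℕ} {l : List (Fin n × Fin n)} {σ σ' : AState} {Q : AState → Prop}
variable {A : Finset (Fin n)} {K c f : ℕ} {rest : List (Node (Fin n))}

/-- The code `c` and the vertex `f` represent the mode. -/
def Mode.At (m : Mode (Fin n)) (c f : ℕ) : Prop :=
  match m with
  | .free => c = 0 ∧ f ≤ n
  | .fresh v => c = 1 ∧ f = v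
  | .kept v => c = 2 ∧ f = v

theorem Mode.At.le {m : Mode (Fin n)} (h : m.At c f) : c ≤ 2 ∧ f ≤ n := by
  cases m with
  | free => simp only [Mode.At] at h; omega
  | fresh v => have := v.isLt; simp only [Mode.At] at h; omega
  | kept v => have := v.isLt; simp only [Mode.At] at h; omega

/-- A frame of the stack, at the address `o`. -/
structure FrameAt (a : ℕ → ℕ) (o : ℕ) (A : Finset (Fin n)) (K c f : ℕ) : Prop where
  -- Zero stands for a remaining vertex, so that untouched memory encodes the full vertex set.
  alive : ∀ x : Fin n, a (o + x) = if x ∈ A then 0 else 1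
  budget : a (o + n) = K
  code : a (o + (n + 1)) = c
  focus : a (o + (n + 2)) = f

theorem FrameAt.congr {a b : ℕ → ℕ} {o : ℕ} (h : FrameAt a o A K c f)
    (hab : ∀ y, o ≤ y → y < o + (n + 3) → b y = a y) : FrameAt b o A K c f := by
  refine ⟨fun x => ?_, ?_, ?_, ?_⟩
  · rw [hab _ (by omega) (by omega)]
    exact h.alive x
  · rw [hab _ (by omega) (by omega)]
    exact h.budget
  · rw [hab _ (by omega) (by omega)]
    exact h.code
  · rw [hab _ (by omega) (by omega)]
    exact h.focus

/-- The frames of the nodes in the list, the first one on top. -/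
def Stack (a : ℕ → ℕ) : List (Node (Fin n)) → Prop
  | [] => True
  | s :: rest => (∃ c f, s.mode.At c f ∧ FrameAt a (rest.length * (n + 3)) s.alive s.budget c f) ∧
      Stack a rest

theorem Stack.congr {a b : ℕ → ℕ} {L : List (Node (Fin n))} (h : Stack a L)
    (hab : ∀ y < L.length * (n + 3), b y = a y) : Stack b L := by
  induction L with
  | nil => trivial
  | cons s rest ih =>
    obtain ⟨⟨c, f, hm, hf⟩, hr⟩ := h
    simp only [List.length_cons, Nat.succ_mul] at hab
    exact ⟨⟨c, f, hm, hf.congr fun y _ hy => hab y (by omega)⟩,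
      ih hr fun y hy => hab y (by omega)⟩

/-- The stack of nodes in the memory. -/
structure Pile (l : List (Fin n × Fin n)) (σ : AState) (L : List (Node (Fin n))) : Prop where
  given : Given l σ
  ans : σ.reg 0 = 0
  -- For the empty stack the truncated subtraction gives the address 0, in agreement with `pop`.
  sp : σ.reg 6 = (L.length - 1) * (n + 3)
  count : σ.reg 7 = L.length
  frame : σ.reg 11 = n + 3
  stack : Stack (σ.arr 15) L

/-- The stack of nodes in the memory, with explicit contents of the top frame. -/
structure Top (l : List (Fin n × Fin n)) (σ : AState) (A : Finset (Fin n)) (K c f : ℕ)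
    (rest : List (Node (Fin n))) : Prop where
  given : Given l σ
  ans : σ.reg 0 = 0
  sp : σ.reg 6 = rest.length * (n + 3)
  count : σ.reg 7 = rest.length + 1
  frame : σ.reg 11 = n + 3
  top : FrameAt (σ.arr 15) (rest.length * (n + 3)) A K c f
  stack : Stack (σ.arr 15) rest

theorem Pile.exists_top {s : Node (Fin n)} (h : Pile l σ (s :: rest)) :
    ∃ c f, s.mode.At c f ∧ Top l σ s.alive s.budget c f rest := by
  obtain ⟨⟨c, f, hm, hf⟩, hr⟩ := h.stack
  exact ⟨c, f, hm, h.given, h.ans, by simpa using h.sp, by simpa using h.count, h.frame, hf, hr⟩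

theorem Top.pile (h : Top l σ A K c f rest) {m : Mode (Fin n)} (hm : m.At c f) :
    Pile l σ (⟨A, K, m⟩ :: rest) :=
  ⟨h.given, h.ans, by simpa using h.sp, by simpa using h.count, h.frame,
    ⟨c, f, hm, h.top⟩, h.stack⟩

theorem Top.agree (h : Top l σ A K c f rest) {R D : List ℕ} (hA : Agree R D σ σ')
    (hR : ∀ i ∈ R, i ∉ [0, 1, 2, 6, 7, 11]) (hD : ∀ j ∈ D, j ∉ [0, 15]) :
    Top l σ' A K c f rest := by
  have hr : ∀ i, i ∈ [0, 1, 2, 6, 7, 11] → σ'.reg i = σ.reg i := fun i hi =>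
    hA.1 i fun h => hR i h hi
  have hd : ∀ i, i ∈ [0, 15] → σ'.arr i = σ.arr i := fun i hi => hA.2 i fun h => hD i h hi
  have h15 := hd 15 (by simp)
  refine ⟨h.given.agree hA (fun h => hR _ h (by simp)) (fun h => hR _ h (by simp))
    (fun h => hD _ h (by simp)), ?_, ?_, ?_, ?_, h15 ▸ h.top, h15 ▸ h.stack⟩
  · rw [hr 0 (by simp), h.ans]
  · rw [hr 6 (by simp), h.sp]
  · rw [hr 7 (by simp), h.count]
  · rw [hr 11 (by simp), h.frame]

/-- The nodes on the stack satisfy the invariants of the search. -/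
structure Valid (k : ℕ) (L : List (Node (Fin n))) : Prop where
  wf : ∀ s ∈ L, s.Wf
  budget : ∀ s ∈ L, s.budget ≤ k
  inc : (L.map fun s => s.alive.card).Pairwise (· < ·)

theorem pairwise_lt_length_le {L : List ℕ} {b : ℕ} (h : L.Pairwise (· < ·)) (hb : ∀ x ∈ L, x < b) :
    L.length ≤ b := by
  have h1 : L.toFinset ⊆ Finset.range b := fun x hx =>
    Finset.mem_range.2 (hb x (List.mem_toFinset.1 hx))
  have h2 := Finset.card_le_card h1
  rwa [List.toFinset_card_of_nodup (h.imp fun h => h.ne), Finset.card_range] at h2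

/-- The sizes on the stack are distinct numbers between 0 and n. This is the reason for polynomial
space. -/
theorem Valid.length_le {L : List (Node (Fin n))} (h : Valid k L) : L.length ≤ n + 1 := by
  have := pairwise_lt_length_le h.inc (b := n + 1) fun x hx => by
    obtain ⟨s, -, rfl⟩ := List.mem_map.1 hx
    have := Finset.card_le_univ s.alive
    rw [Fintype.card_fin] at this
    omega
  simpa using this

theorem Valid.next {G : SimpleGraph (Fin n)} [DecidableRel G.Adj] {s : Node (Fin n)}
    {cs : List (Node (Fin n))} (h : Valid k (s :: rest)) (hs : Step G s (some cs)) :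
    Valid k (cs ++ rest) := by
  have hwf := h.wf s (by simp)
  obtain ⟨h1, h2⟩ := hs.shrink hwf
  have hb := h.budget s (by simp)
  have hinc := h.inc
  rw [List.map_cons, List.pairwise_cons] at hinc
  refine ⟨fun c hc => ?_, fun c hc => ?_, ?_⟩
  · rcases List.mem_append.1 hc with hc | hc
    · exact hs.wf hwf c hc
    · exact h.wf c (by simp [hc])
  · rcases List.mem_append.1 hc with hc | hc
    · exact (h1 c hc).1.trans hb
    · exact h.budget c (by simp [hc])
  · rw [List.map_append, List.pairwise_append]
    refine ⟨h2, hinc.2, fun a ha b hb => ?_⟩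
    obtain ⟨c, hc, rfl⟩ := List.mem_map.1 ha
    exact lt_of_le_of_lt (h1 c hc).2 (hinc.1 b hb)

/-- The three terms leave room for addresses on the stack, for sums of conflict counts, and for
single counts and budgets. -/
theorem Layout.bounds {m : ℕ} (h : Layout μ n m k) :
    (n + 2) * (n + 3) + 4 * (n * n) + 8 * (n + m + k + 2) ≤ μ.W := by
  have := h.word
  nlinarith [Nat.zero_le (m * m), Nat.zero_le (k * k), Nat.zero_le (n * m), Nat.zero_le (n * k),
    Nat.zero_le (m * k)]

theorem offset_le {r n : ℕ} (h : r ≤ n + 1) : r * (n + 3) + (n + 3) ≤ (n + 2) * (n + 3) := by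
  have := Nat.mul_le_mul_right (n + 3) (show r + 1 ≤ n + 2 by omega)
  rwa [Nat.succ_mul] at this

theorem Top.store (hΛ : Layout μ n l.length k) (h : Top l σ A K c f rest)
    (hlen : rest.length ≤ n + 1) {a e : AExpr} {A' : Finset (Fin n)} {K' c' f' d : ℕ}
    (ha : a.Ok μ σ) (he : e.Ok μ σ) (had : a.eval σ = rest.length * (n + 3) + d) (hd : d < n + 3)
    (hf : FrameAt (Function.update (σ.arr 15) (rest.length * (n + 3) + d) (e.eval σ))
      (rest.length * (n + 3)) A' K' c' f')
    (hQ : ∀ σ', Agree [] [15] σ σ' → Top l σ' A' K' c' f' rest →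
      (∀ y, rest.length * (n + 3) + (n + 3) ≤ y → σ'.arr 15 y = σ.arr 15 y) → Q σ') :
    Ends μ (.store 15 a e) σ Q := by
  have hoff := offset_le hlen
  have hA : Agree [] [15] σ (σ.setArr 15 (rest.length * (n + 3) + d) (e.eval σ)) :=
    (Agree.refl _ _ _).setArr (by simp) _ _
  have h15 : (σ.setArr 15 (rest.length * (n + 3) + d) (e.eval σ)).arr 15 =
      Function.update (σ.arr 15) (rest.length * (n + 3) + d) (e.eval σ) := by
    simp [AState.setArr]
  refine Ends.store ha he (by rw [had, hΛ.stack]; omega) ?_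
  rw [had]
  refine hQ _ hA ⟨h.given.agree hA (by simp) (by simp) (by simp), h.ans, h.sp, h.count, h.frame,
    by rwa [h15], h.stack.congr fun y hy => ?_⟩ fun y hy => ?_
  · rw [h15, Function.update_of_ne (by omega)]
  · rw [h15, Function.update_of_ne (by omega)]

def setBudget (e : AExpr) : AProg := .store 15 (.add (.reg 6) (.reg 1)) e

def setCode (c : ℕ) : AProg := .store 15 (.add (.reg 6) (.add (.reg 1) (.const 1))) (.const c)

def setFocus (e : AExpr) : AProg := .store 15 (.add (.reg 6) (.add (.reg 1) (.const 2))) e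

theorem ends_setBudget (hΛ : Layout μ n l.length k) (h : Top l σ A K c f rest)
    (hlen : rest.length ≤ n + 1) {e : AExpr} {K' : ℕ} (he : e.Ok μ σ) (hK : e.eval σ = K')
    (hQ : ∀ σ', Agree [] [15] σ σ' → Top l σ' A K' c f rest →
      (∀ y, rest.length * (n + 3) + (n + 3) ≤ y → σ'.arr 15 y = σ.arr 15 y) → Q σ') :
    Ends μ (setBudget e) σ Q := by
  have hoff := offset_le hlen
  have hb := hΛ.bounds
  refine h.store hΛ hlen (d := n) ?_ he ?_ (by omega) ?_ hQ
  · simp only [AExpr.Ok, AExpr.eval, h.sp, h.given.n]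
    omega
  · simp only [AExpr.eval, h.sp, h.given.n]
  · rw [hK]
    refine ⟨fun x => ?_, by simp, ?_, ?_⟩
    · rw [Function.update_of_ne (by omega), h.top.alive]
    · rw [Function.update_of_ne (by omega), h.top.code]
    · rw [Function.update_of_ne (by omega), h.top.focus]

theorem ends_setCode (hΛ : Layout μ n l.length k) (h : Top l σ A K c f rest)
    (hlen : rest.length ≤ n + 1) {c' : ℕ} (hc : c' ≤ 2)
    (hQ : ∀ σ', Agree [] [15] σ σ' → Top l σ' A K c' f rest → Q σ') :
    Ends μ (setCode c') σ Q := by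
  have hoff := offset_le hlen
  have hb := hΛ.bounds
  refine h.store hΛ hlen (d := n + 1) ?_ ?_ ?_ (by omega) ?_ fun σ' hA hT _ => hQ σ' hA hT
  · simp only [AExpr.Ok, AExpr.eval, h.sp, h.given.n]
    omega
  · simp only [AExpr.Ok]
    omega
  · simp only [AExpr.eval, h.sp, h.given.n]
  · simp only [AExpr.eval]
    refine ⟨fun x => ?_, ?_, by simp, ?_⟩
    · rw [Function.update_of_ne (by omega), h.top.alive]
    · rw [Function.update_of_ne (by omega), h.top.budget]
    · rw [Function.update_of_ne (by omega), h.top.focus]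

theorem ends_setFocus (hΛ : Layout μ n l.length k) (h : Top l σ A K c f rest)
    (hlen : rest.length ≤ n + 1) {e : AExpr} {f' : ℕ} (he : e.Ok μ σ) (hf : e.eval σ = f')
    (hQ : ∀ σ', Agree [] [15] σ σ' → Top l σ' A K c f' rest → Q σ') :
    Ends μ (setFocus e) σ Q := by
  have hoff := offset_le hlen
  have hb := hΛ.bounds
  refine h.store hΛ hlen (d := n + 2) ?_ he ?_ (by omega) ?_ fun σ' hA hT _ => hQ σ' hA hT
  · simp only [AExpr.Ok, AExpr.eval, h.sp, h.given.n]
    omega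
  · simp only [AExpr.eval, h.sp, h.given.n]
  · rw [hf]
    refine ⟨fun x => ?_, ?_, ?_, by simp⟩
    · rw [Function.update_of_ne (by omega), h.top.alive]
    · rw [Function.update_of_ne (by omega), h.top.budget]
    · rw [Function.update_of_ne (by omega), h.top.code]

/-- Deletes the vertex in register `r` in the top frame. -/
def deleteVertex (r : ℕ) : AProg := .store 15 (.add (.reg 6) (.reg r)) (.const 1)

theorem ends_deleteVertex (hΛ : Layout μ n l.length k) (h : Top l σ A K c f rest)
    (hlen : rest.length ≤ n + 1) {r : ℕ} {w : Fin n} (hw : σ.reg r = w)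
    (hQ : ∀ σ', Agree [] [15] σ σ' → Top l σ' (A.erase w) K c f rest →
      (∀ y, rest.length * (n + 3) + (n + 3) ≤ y → σ'.arr 15 y = σ.arr 15 y) → Q σ') :
    Ends μ (deleteVertex r) σ Q := by
  have hoff := offset_le hlen
  have hb := hΛ.bounds
  have hwn := w.isLt
  refine h.store hΛ hlen (d := w) ?_ ?_ ?_ (by omega) ?_ hQ
  · simp only [AExpr.Ok, AExpr.eval, h.sp, hw]
    omega
  · simp only [AExpr.Ok]
    omega
  · simp only [AExpr.eval, h.sp, hw]
  · simp only [AExpr.eval]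
    refine ⟨fun x => ?_, ?_, ?_, ?_⟩
    · by_cases hxw : x = w
      · simp [hxw]
      · have : (x : ℕ) ≠ w := fun h => hxw (Fin.ext h)
        rw [Function.update_of_ne (by omega), h.top.alive]
        simp [hxw]
    · rw [Function.update_of_ne (by omega), h.top.budget]
    · rw [Function.update_of_ne (by omega), h.top.code]
    · rw [Function.update_of_ne (by omega), h.top.focus]

theorem ends_delete (hΛ : Layout μ n l.length k) (h : Top l σ A K c f rest)
    (hlen : rest.length ≤ n + 1) {g : AExpr} (S : Finset (Fin n))
    (hg : ∀ x : Fin n, ∀ σ', Agree [3] [15] σ σ' → σ'.reg 3 = x →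
      g.Ok μ σ' ∧ g.eval σ' = if x ∈ S then 1 else 0)
    (hQ : ∀ σ', Agree [3] [15] σ σ' → Top l σ' (A \ S) K c f rest → Q σ') :
    Ends μ (deleteLoop g) σ Q := by
  have hoff := offset_le hlen
  have hb := hΛ.bounds
  refine ends_deleteLoop_fin hΛ h.given h.sp (by omega) (by rw [hΛ.stack]; omega) S hg
    fun σ' hA h1 h2 => hQ σ' hA ⟨h.given.agree hA (by simp) (by simp) (by simp), ?_, ?_, ?_, ?_,
      ⟨fun x => ?_, ?_, ?_, ?_⟩, h.stack.congr fun y hy => h2 y (by omega)⟩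
  · rw [hA.1 0 (by simp), h.ans]
  · rw [hA.1 6 (by simp), h.sp]
  · rw [hA.1 7 (by simp), h.count]
  · rw [hA.1 11 (by simp), h.frame]
  · rw [h1, h.top.alive]
    by_cases hx : x ∈ S <;> simp [hx]
  · rw [h2 _ (by omega), h.top.budget]
  · rw [h2 _ (by omega), h.top.code]
  · rw [h2 _ (by omega), h.top.focus]

/-- A valid stack has at most n + 1 frames, and a step uses at most one more; hence array 15 has
room for n + 2. -/
theorem ends_copy (hΛ : Layout μ n l.length k) (h : Top l σ A K c f rest)
    (hlen : rest.length ≤ n) (hK : K ≤ k) (hc : c ≤ 2) (hf : f ≤ n)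
    (hQ : ∀ σ', Agree [3] [15] σ σ' → Top l σ' A K c f rest →
      FrameAt (σ'.arr 15) ((rest.length + 1) * (n + 3)) A K c f → Q σ') :
    Ends μ copyLoop σ Q := by
  have hoff := offset_le (r := rest.length + 1) (n := n) (by omega)
  rw [Nat.succ_mul] at hoff
  have hb := hΛ.bounds
  refine ends_copyLoop hΛ h.sp h.frame (by rw [hΛ.stack]; omega) (by omega) (fun x hx => ?_)
    fun σ' hA h1 h2 => hQ σ' hA ⟨h.given.agree hA (by simp) (by simp) (by simp), ?_, ?_, ?_, ?_,
      h.top.congr fun y _ hy => h2 y hy, h.stack.congr fun y hy => h2 y (by omega)⟩ ?_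
  · by_cases hxn : x < n
    · have := h.top.alive ⟨x, hxn⟩
      simp only at this
      rw [this]
      split_ifs <;> omega
    · obtain rfl | rfl | rfl : x = n ∨ x = n + 1 ∨ x = n + 2 := by omega
      · rw [h.top.budget]
        omega
      · rw [h.top.code]
        omega
      · rw [h.top.focus]
        omega
  · rw [hA.1 0 (by simp), h.ans]
  · rw [hA.1 6 (by simp), h.sp]
  · rw [hA.1 7 (by simp), h.count]
  · rw [hA.1 11 (by simp), h.frame]
  · rw [Nat.succ_mul]
    refine ⟨fun x => ?_, ?_, ?_, ?_⟩
    · rw [h1 _ (by omega), h.top.alive]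
    · rw [h1 _ (by omega), h.top.budget]
    · rw [h1 _ (by omega), h.top.code]
    · rw [h1 _ (by omega), h.top.focus]

/-- Makes the next frame the top frame. -/
def raise : AProg :=
  .seq (.assign 6 (.add (.reg 6) (.reg 11))) (.assign 7 (.add (.reg 7) (.const 1)))

theorem ends_raise (hΛ : Layout μ n l.length k) {A' : Finset (Fin n)} {K' c' f' : ℕ}
    (h : Top l σ A' K' c' f' rest) (hlen : rest.length ≤ n) {m : Mode (Fin n)} (hm : m.At c' f')
    (hF : FrameAt (σ.arr 15) ((rest.length + 1) * (n + 3)) A K c f)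
    (hQ : ∀ σ', Agree [6, 7] [] σ σ' → Top l σ' A K c f (⟨A', K', m⟩ :: rest) → Q σ') :
    Ends μ raise σ Q := by
  have hoff := offset_le (r := rest.length + 1) (n := n) (by omega)
  rw [Nat.succ_mul] at hoff
  have hb := hΛ.bounds
  have hA : Agree [6, 7] [] σ ((σ.setReg 6 (σ.reg 6 + σ.reg 11)).setReg 7 (σ.reg 7 + 1)) :=
    ((Agree.refl _ _ _).setReg (by simp) _).setReg (by simp) _
  refine Ends.seq (Ends.assign ?_ (Ends.assign ?_ ?_))
  · simp only [AExpr.Ok, AExpr.eval, h.sp, h.frame]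
    omega
  · simp only [AExpr.Ok, AExpr.eval, AState.setReg_reg, Nat.reduceEqDiff, if_false, h.count]
    omega
  · refine hQ _ hA ⟨h.given.agree hA (by simp) (by simp) (by simp), ?_, ?_, ?_, ?_, hF,
      ⟨c', f', hm, h.top⟩, h.stack⟩
    · simpa using h.ans
    · simp [AExpr.eval, h.sp, h.frame, Nat.succ_mul]
    · simp [AExpr.eval, h.count]
    · simpa using h.frame

/-- Removes the top frame. -/
def pop : AProg :=
  .seq (.assign 6 (.sub (.reg 6) (.reg 11))) (.assign 7 (.sub (.reg 7) (.const 1)))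

theorem ends_pop (hΛ : Layout μ n l.length k) (h : Top l σ A K c f rest)
    (hlen : rest.length ≤ n + 1) (hQ : ∀ σ', Pile l σ' rest → Q σ') : Ends μ pop σ Q := by
  have hoff := offset_le hlen
  have hb := hΛ.bounds
  have hA : Agree [6, 7] [] σ ((σ.setReg 6 (σ.reg 6 - σ.reg 11)).setReg 7 (σ.reg 7 - 1)) :=
    ((Agree.refl _ _ _).setReg (by simp) _).setReg (by simp) _
  refine Ends.seq (Ends.assign ?_ (Ends.assign ?_ ?_))
  · simp only [AExpr.Ok, h.sp, h.frame]
    omega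
  · simp only [AExpr.Ok, AState.setReg_reg, Nat.reduceEqDiff, if_false, h.count]
    omega
  · refine hQ _ ⟨h.given.agree hA (by simp) (by simp) (by simp), ?_, ?_, ?_, ?_, h.stack⟩
    · simpa using h.ans
    · simp [AExpr.eval, h.sp, h.frame, Nat.sub_mul]
    · simp [AExpr.eval, h.count]
    · simpa using h.frame

end Stacks

/-! ### The step for free nodes, and marking the neighbourhood of the vertex in focus. -/

section Body

variable {μ : Mach} {n k : ℕ} {l : List (Fin n × Fin n)} {σ σ' : AState} {Q : AState → Prop}
variable {G : SimpleGraph (Fin n)} [DecidableRel G.Adj]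
variable {A : Finset (Fin n)} {K c f : ℕ} {rest : List (Node (Fin n))} {v w : Fin n}

/-- The state after one step of the search from the node `s`, where `rest` is the remaining
stack. -/
def Next (G : SimpleGraph (Fin n)) [DecidableRel G.Adj] (l : List (Fin n × Fin n))
    (s : Node (Fin n)) (rest : List (Node (Fin n))) (σ : AState) : Prop :=
  (∃ cs, Step G s (some cs) ∧ Pile l σ (cs ++ rest)) ∨
    (Step G s none ∧ σ.reg 7 = 0 ∧ σ.reg 0 = 1)

/-- The top frame has been loaded into registers and array 1. -/
structure Loaded (l : List (Fin n × Fin n)) (σ : AState) (A : Finset (Fin n)) (K c f : ℕ)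
    (rest : List (Node (Fin n))) : Prop extends Top l σ A K c f rest where
  alive : ∀ x : Fin n, σ.arr 1 x = if x ∈ A then 1 else 0
  budget : σ.reg 8 = K
  code : σ.reg 9 = c
  focus : σ.reg 10 = f

theorem Loaded.agree (h : Loaded l σ A K c f rest) {R D : List ℕ} (hA : Agree R D σ σ')
    (hR : ∀ i ∈ R, i ∉ [0, 1, 2, 6, 7, 8, 9, 10, 11]) (hD : ∀ j ∈ D, j ∉ [0, 1, 15]) :
    Loaded l σ' A K c f rest := by
  have hr : ∀ i, i ∈ [0, 1, 2, 6, 7, 8, 9, 10, 11] → σ'.reg i = σ.reg i := fun i hi =>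
    hA.1 i fun h => hR i h hi
  have hd : ∀ i, i ∈ [0, 1, 15] → σ'.arr i = σ.arr i := fun i hi => hA.2 i fun h => hD i h hi
  refine ⟨h.toTop.agree hA (fun i hi => ?_) fun i hi => ?_, ?_, ?_, ?_, ?_⟩
  · have := hR i hi
    simp only [List.mem_cons] at this ⊢
    tauto
  · have := hD i hi
    simp only [List.mem_cons] at this ⊢
    tauto
  · rw [hd 1 (by simp)]
    exact h.alive
  · rw [hr 8 (by simp), h.budget]
  · rw [hr 9 (by simp), h.code]
  · rw [hr 10 (by simp), h.focus]

def load : AProg :=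
  .seq (mapLoop 1 (.sub (.const 1) (.get 15 (.add (.reg 6) (.reg 3)))))
    (.seq (.assign 8 (.get 15 (.add (.reg 6) (.reg 1))))
      (.seq (.assign 9 (.get 15 (.add (.reg 6) (.add (.reg 1) (.const 1)))))
        (.assign 10 (.get 15 (.add (.reg 6) (.add (.reg 1) (.const 2)))))))

theorem ends_load (hΛ : Layout μ n l.length k) (h : Top l σ A K c f rest)
    (hlen : rest.length ≤ n) (hK : K ≤ k) (hc : c ≤ 2) (hf : f ≤ n)
    (hQ : ∀ σ', Loaded l σ' A K c f rest → Q σ') : Ends μ load σ Q := by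
  have hoff := offset_le (r := rest.length) (n := n) (by omega)
  have hb := hΛ.bounds
  have hst := hΛ.stack
  refine Ends.seq (ends_mapLoop_fin hΛ h.given (by omega) (fun x => if x ∈ A then 1 else 0) ?_ ?_)
  · intro x σ' hA h3
    have hx := x.isLt
    have hal := h.top.alive x
    simp only [AExpr.Ok, AExpr.eval, h3, hA.1 6 (by simp), hA.2 15 (by simp), h.sp, hal]
    by_cases hxA : x ∈ A <;> simp only [hxA, if_true, if_false, and_true] <;> omega
  · intro σ₁ hA₁ h₁
    have hT := h.agree hA₁ (by simp) (by simp)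
    refine Ends.seq (Ends.assign ?_ (Ends.seq (Ends.assign ?_ (Ends.assign ?_ ?_))))
    · simp only [AExpr.Ok, AExpr.eval, hT.sp, hT.given.n, hT.top.budget]
      omega
    · simp only [AExpr.Ok, AExpr.eval, AState.setReg_reg, AState.setReg_arr, Nat.reduceEqDiff,
        if_false, hT.sp, hT.given.n, hT.top.code]
      omega
    · simp only [AExpr.Ok, AExpr.eval, AState.setReg_reg, AState.setReg_arr, Nat.reduceEqDiff,
        if_false, hT.sp, hT.given.n, hT.top.focus]
      omega
    · refine hQ _ ⟨hT.agree (R := [8, 9, 10]) (D := [])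
        ((((Agree.refl _ _ _).setReg (by simp) _).setReg (by simp) _).setReg (by simp) _)
        (by simp) (by simp), h₁, ?_, ?_, ?_⟩
      · simp [AExpr.eval, hT.sp, hT.given.n, hT.top.budget]
      · simp [AExpr.eval, hT.sp, hT.given.n, hT.top.code]
      · simp [AExpr.eval, hT.sp, hT.given.n, hT.top.focus]

/-- The vertices with a neighbour that has another degree or another smallest vertex in its closed
neighbourhood. -/
def uneven (G : SimpleGraph (Fin n)) [DecidableRel G.Adj] (A : Finset (Fin n))
    (r : Fin n → ℕ) : Finset (Fin n) :=
  A.filter fun x => ∃ y ∈ nb G A x, ¬ ((nb G A x).card = (nb G A y).card ∧ r x = r y)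

/-- Degree one is given the key n + 1, above all degrees, so an uneven leaf always wins; if the
winner is no leaf, no uneven leaf exists. Vertices that are not uneven have the same degree as their
neighbours and cannot violate `Suitable`. -/
theorem step_of_uneven {r : Fin n → ℕ} {best : ℕ}
    (hr : ∀ x : Fin n, r x ≤ x ∧ (r x = x ∨ ∃ y ∈ nb G A x, r x = y) ∧
      (x ∈ A → ∀ y ∈ nb G A x, r x ≤ y))
    (h1 : ∀ x ∈ uneven G A r,
      (if (nb G A x).card = 1 then n + 1 else (nb G A x).card) ≤ best) :
    (best = 0 → Clus G A) ∧ (∀ v ∈ uneven G A r,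
      (if (nb G A v).card = 1 then n + 1 else (nb G A v).card) = best →
      v ∈ A ∧ (∃ x ∈ nb G A v, (hn G A v x).Nonempty) ∧ Suitable G A v) := by
  have hlt : ∀ x, (nb G A x).card < n + 1 := fun x => by
    have := Finset.card_le_univ (nb G A x)
    rw [Fintype.card_fin] at this
    omega
  have heven : ∀ x ∈ A, x ∉ uneven G A r → ∀ y ∈ nb G A x,
      (nb G A x).card = (nb G A y).card ∧ r x = r y := by
    intro x hx hxu y hy
    by_contra h
    exact hxu (Finset.mem_filter.2 ⟨hx, y, hy, h⟩)
  constructor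
  · intro h0
    refine clus_of_eq (f := Fin.val) (r := r) Fin.val_injective (fun x _ => (hr x).2.1)
      fun x hx y hy => ?_
    by_cases hxu : x ∈ uneven G A r
    · have h2 := h1 x hxu
      have h3 : 0 < (nb G A x).card := Finset.card_pos.2 ⟨y, hy⟩
      split_ifs at h2 <;> omega
    · exact heven x hx hxu y hy
  · intro v hv hbest
    obtain ⟨hvA, hvy⟩ := Finset.mem_filter.1 hv
    refine ⟨hvA, ?_, ?_⟩
    · exact hasConf_of_ne (f := Fin.val) (r := r) (fun x _ => (hr x).2.1)
        (fun x hx => ⟨(hr x).1, (hr x).2.2 hx⟩) hvA hvy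
    · by_cases hone : (nb G A v).card = 1
      · exact Or.inl hone
      · rw [if_neg hone] at hbest
        right
        constructor
        · intro x hx
          by_cases hxu : x ∈ uneven G A r
          · have h2 := h1 x hxu
            have := hlt v
            split_ifs at h2 <;> omega
          · obtain ⟨hxA, hvx⟩ := mem_nb.1 hx
            exact (heven x hxA hxu v (mem_nb.2 ⟨hvA, hvx.symm⟩)).1.le
        · intro a ha b hb h2
          by_cases hau : a ∈ uneven G A r
          · have h3 := h1 a hau
            rw [if_pos h2] at h3
            have := hlt v
            omega
          · exact (heven a ha hau b hb).1.symm.trans h2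

/-- If no vertex is uneven, the remaining graph is a cluster graph: the answer is set to 1, and the
zero in register 7 empties the stack and ends the search. -/
def freeStep : AProg :=
  .seq (countLoop 2 1) (.seq minLoop (.seq markLoop
    (.seq (maxLoop 12 (.get 4 (.reg 3)) (.get 2 (.reg 3)) (.add (.reg 1) (.const 1)))
    (.ite (.reg 12) (.seq (setCode 1) (setFocus (.reg 13)))
      (.seq (.assign 7 (.const 0)) (.assign 0 (.const 1)))))))

theorem ends_freeStep (hl : IsEdgeList G l) (hΛ : Layout μ n l.length k)
    (h : Loaded l σ A K 0 f rest) (hlen : rest.length ≤ n)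
    (hQ : ∀ σ', Next G l ⟨A, K, .free⟩ rest σ' → Q σ') : Ends μ freeStep σ Q := by
  have hb := hΛ.bounds
  have hcard : ∀ x, (nb G A x).card ≤ n := fun x => by
    have := Finset.card_le_univ (nb G A x)
    rwa [Fintype.card_fin] at this
  have hl2 := hΛ.work 2 (by omega) (by omega)
  have hl4 := hΛ.work 4 (by omega) (by omega)
  refine Ends.seq (ends_countLoop hl hΛ h.given (by omega) (by omega) (by omega) (fun x => ?_)
    fun σ₁ hA₁ h₁ => Ends.seq ?_)
  · rw [h.alive]
    split_ifs <;> omega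
  have hL₁ := h.agree hA₁ (by simp) (by simp)
  replace h₁ : ∀ x : Fin n, σ₁.arr 2 x = (nb G A x).card := by
    intro x
    rw [h₁]
    congr 1
    ext y
    simp [mem_nb, h.alive, and_comm]
  refine ends_minLoop hl hΛ hL₁.given hL₁.alive fun σ₂ hA₂ h₂ => Ends.seq ?_
  have hL₂ := hL₁.agree hA₂ (by simp) (by simp)
  have e₂ : ∀ x : Fin n, σ₂.arr 2 x = (nb G A x).card := by
    intro x
    rw [hA₂.2 2 (by simp), h₁]
  refine ends_markLoop hl hΛ hL₂.given hL₂.alive (fun x => ?_) (fun x => ?_)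
    fun σ₃ hA₃ h₃ => Ends.seq ?_
  · rw [e₂]
    exact hcard x
  · have := (h₂ x).1
    omega
  have hL₃ := hL₂.agree hA₃ (by simp) (by simp)
  set r : Fin n → ℕ := fun x => σ₂.arr 3 x with hr
  have hmark : ∀ x : Fin n, σ₃.arr 4 x = if x ∈ uneven G A r then 1 else 0 := by
    intro x
    obtain ⟨h4, h5⟩ := h₃ x
    simp only [e₂] at h5
    have h6 : σ₃.arr 4 x ≠ 0 ↔ x ∈ uneven G A r := by
      rw [h5, uneven, Finset.mem_filter]
    by_cases hx : x ∈ uneven G A r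
    · have := h6.2 hx
      rw [if_pos hx]
      omega
    · rw [if_neg hx]
      by_contra h7
      exact hx (h6.1 h7)
  refine ends_maxLoop_fin hΛ hL₃.given (by omega) (uneven G A r) (fun x => (nb G A x).card)
    (n + 1) (by omega) (fun x σ' hA h3 => ?_) (fun x _ σ' hA h3 => ?_) (fun σ' hA => ?_)
    fun σ₄ hA₄ hmax hbest => ?_
  · have hx := x.isLt
    simp only [AExpr.Ok, AExpr.eval, and_true, h3, hA.2 4 (by simp), hmark, hl4]
    by_cases hu : x ∈ uneven G A r <;> simp only [hu, if_true, if_false] <;> omega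
  · have hx := x.isLt
    have := hcard x
    simp only [AExpr.Ok, AExpr.eval, true_and, h3, hA.2 2 (by simp), hA₃.2 2 (by simp), e₂, hl2]
    omega
  · simp only [AExpr.Ok, AExpr.eval, and_true, hA.1 1 (by simp), hL₃.given.n]
    omega
  have hL₄ := hL₃.agree hA₄ (by simp) (by simp)
  obtain ⟨hclus, hpick⟩ := step_of_uneven h₂ hmax
  have hw12 : σ₄.reg 12 < μ.W := by
    by_cases h0 : σ₄.reg 12 = 0
    · omega
    · obtain ⟨x, -, -, h5⟩ := hbest h0
      have := hcard x
      split_ifs at h5 <;> omega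
  refine Ends.ite hw12 (fun h0 => ?_) fun h0 => ?_
  · obtain ⟨v, hv, h13, hv'⟩ := hbest h0
    obtain ⟨hvA, hconf, hsuit⟩ := hpick v hv hv'
    have hvn := v.isLt
    refine Ends.seq (ends_setCode hΛ hL₄.toTop (by omega) (by omega) fun σ₅ hA₅ hT₅ =>
      ends_setFocus hΛ hT₅ (by omega) (f' := v) ?_ ?_ fun σ₆ _ hT₆ => hQ σ₆ ?_)
    · simp only [AExpr.Ok, hA₅.1 13 (by simp), h13]
      omega
    · simp only [AExpr.eval, hA₅.1 13 (by simp), h13]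
    · exact Or.inl ⟨_, .pick A K v hvA hconf hsuit, hT₆.pile ⟨rfl, rfl⟩⟩
  · simp only [AExpr.eval] at h0
    refine Ends.seq (Ends.assign ?_ (Ends.assign ?_ (hQ _ ?_)))
    · simp only [AExpr.Ok]
      omega
    · simp only [AExpr.Ok]
      omega
    · exact Or.inr ⟨.accept A K (hclus h0), by simp [AExpr.eval], by simp [AExpr.eval]⟩

/-- The vertex `v`, its neighbours and the remaining vertices have been marked. -/
structure Marked (G : SimpleGraph (Fin n)) [DecidableRel G.Adj] (l : List (Fin n × Fin n))
    (σ : AState) (A : Finset (Fin n)) (K c : ℕ) (v : Fin n) (rest : List (Node (Fin n))) :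
    Prop extends Loaded l σ A K c v rest where
  ind : ∀ x : Fin n, σ.arr 5 x = if x = v then 1 else 0
  near : ∀ x : Fin n, σ.arr 7 x = if x ∈ nb G A v then 1 else 0
  far : ∀ x : Fin n, σ.arr 8 x = if x ∈ A.filter (fun y => ¬ G.Adj v y ∧ y ≠ v) then 1 else 0

theorem Marked.agree (h : Marked G l σ A K c v rest) {R D : List ℕ} (hA : Agree R D σ σ')
    (hR : ∀ i ∈ R, i ∉ [0, 1, 2, 6, 7, 8, 9, 10, 11]) (hD : ∀ j ∈ D, j ∉ [0, 1, 5, 7, 8, 15]) :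
    Marked G l σ' A K c v rest := by
  have hd : ∀ i, i ∈ [0, 1, 5, 7, 8, 15] → σ'.arr i = σ.arr i := fun i hi =>
    hA.2 i fun h => hD i h hi
  refine ⟨h.toLoaded.agree hA hR fun i hi => ?_, ?_, ?_, ?_⟩
  · have := hD i hi
    simp only [List.mem_cons] at this ⊢
    tauto
  · rw [hd 5 (by simp)]
    exact h.ind
  · rw [hd 7 (by simp)]
    exact h.near
  · rw [hd 8 (by simp)]
    exact h.far

/-- Sets the array `j` to the characteristic function of the vertex in register `r`. -/
def pointLoop (j r : ℕ) : AProg :=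
  mapLoop j (.sub (.const 1) (.add (.sub (.reg 3) (.reg r)) (.sub (.reg r) (.reg 3))))

theorem ends_pointLoop (hΛ : Layout μ n l.length k) (hσ : Given l σ) {j r : ℕ}
    (hj : 1 ≤ j ∧ j ≤ 14) (hr : 4 ≤ r) (hv : σ.reg r = v)
    (hQ : ∀ σ', Agree [3] [j] σ σ' → (∀ x : Fin n, σ'.arr j x = if x = v then 1 else 0) → Q σ') :
    Ends μ (pointLoop j r) σ Q := by
  have hb := hΛ.bounds
  refine ends_mapLoop_fin hΛ hσ hj _ (fun x σ' hA h3 => ?_) hQ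
  have hx := x.isLt
  have hv' := v.isLt
  simp only [AExpr.Ok, AExpr.eval, h3, hA.1 r (by simp; omega), hv]
  by_cases hxv : x = v
  · simp only [hxv, if_true]
    omega
  · have : (x : ℕ) ≠ v := fun h => hxv (Fin.ext h)
    simp only [hxv, if_false]
    omega

/-- Counting the neighbours in the set {v} produces the row of `v` in the adjacency matrix by a pass
over the edge list. -/
theorem card_adj_point (x : Fin n) :
    (Finset.univ.filter fun y : Fin n => G.Adj x y ∧ (if y = v then 1 else 0) ≠ 0).card =
      if G.Adj x v then 1 else 0 := by
  split_ifs with h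
  · rw [Finset.card_eq_one]
    refine ⟨v, ?_⟩
    ext y
    simp only [Finset.mem_filter, Finset.mem_univ, true_and, Finset.mem_singleton]
    constructor
    · rintro ⟨-, hy⟩
      by_contra hyv
      simp [hyv] at hy
    · rintro rfl
      simp [h]
  · rw [Finset.card_eq_zero, Finset.eq_empty_iff_forall_notMem]
    intro y hy
    simp only [Finset.mem_filter, Finset.mem_univ, true_and] at hy
    by_cases hyv : y = v
    · exact h (hyv ▸ hy.1)
    · simp [hyv] at hy

/-- Array 6 receives the adjacencies of `v`. For entries 0 and 1 a truncated a + b - 1 is a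
conjunction, and a truncated a - b - c excludes `b` and `c`. -/
def markStep : AProg :=
  .seq (pointLoop 5 10) (.seq (countLoop 6 5)
    (.seq (mapLoop 7 (.sub (.add (.get 6 (.reg 3)) (.get 1 (.reg 3))) (.const 1)))
      (mapLoop 8 (.sub (.sub (.get 1 (.reg 3)) (.get 6 (.reg 3))) (.get 5 (.reg 3))))))

theorem ends_markStep (hl : IsEdgeList G l) (hΛ : Layout μ n l.length k)
    (h : Loaded l σ A K c v rest) (hQ : ∀ σ', Marked G l σ' A K c v rest → Q σ') :
    Ends μ markStep σ Q := by
  have hb := hΛ.bounds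
  have hl1 := hΛ.work 1 (by omega) (by omega)
  have hl5 := hΛ.work 5 (by omega) (by omega)
  have hl6 := hΛ.work 6 (by omega) (by omega)
  refine Ends.seq (ends_pointLoop hΛ h.given (by omega) (by omega) h.focus fun σ₁ hA₁ h₁ =>
    Ends.seq ?_)
  have hL₁ := h.agree hA₁ (by simp) (by simp)
  refine ends_countLoop hl hΛ hL₁.given (by omega) (by omega) (by omega) (fun x => ?_)
    fun σ₂ hA₂ h₂ => Ends.seq ?_
  · rw [h₁]
    split_ifs <;> omega
  have hL₂ := hL₁.agree hA₂ (by simp) (by simp)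
  replace h₂ : ∀ x : Fin n, σ₂.arr 6 x = if G.Adj v x then 1 else 0 := by
    intro x
    rw [h₂]
    simp only [h₁]
    rw [card_adj_point]
    simp only [G.adj_comm]
  have hle : ∀ P : Prop, [Decidable P] → (if P then 1 else 0) ≤ 1 := fun P _ => by
    split_ifs <;> omega
  refine ends_mapLoop_fin hΛ hL₂.given (by omega) (fun x => if x ∈ nb G A v then 1 else 0)
    (fun x σ' hA h3 => ?_) fun σ₃ hA₃ h₃ => ?_
  · have hx := x.isLt
    simp only [AExpr.Ok, AExpr.eval, h3, hA.2 1 (by simp), hA.2 6 (by simp), hL₂.alive, h₂, hl1,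
      hl6, mem_nb]
    by_cases h1 : x ∈ A <;> by_cases h2 : G.Adj v x <;>
      simp only [h1, h2, and_self, and_true, and_false, if_true, if_false] <;> omega
  have hL₃ := hL₂.agree hA₃ (by simp) (by simp)
  refine ends_mapLoop_fin hΛ hL₃.given (by omega)
    (fun x => if x ∈ A.filter (fun y => ¬ G.Adj v y ∧ y ≠ v) then 1 else 0)
    (fun x σ' hA h3 => ?_) fun σ₄ hA₄ h₄ => hQ σ₄ ⟨hL₃.agree hA₄ (by simp) (by simp), ?_, ?_, h₄⟩
  · have hx := x.isLt
    simp only [AExpr.Ok, AExpr.eval, h3, hA.2 1 (by simp), hA.2 6 (by simp), hA.2 5 (by simp),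
      hL₃.alive, hA₃.2 6 (by simp), h₂, hA₃.2 5 (by simp), hA₂.2 5 (by simp), h₁, hl1, hl5, hl6,
      Finset.mem_filter]
    by_cases hxv : x = v
    · subst hxv
      by_cases h1 : x ∈ A <;> simp only [h1, SimpleGraph.irrefl, and_self, and_true, and_false,
        if_true, if_false, ne_eq, not_true_eq_false] <;> omega
    · by_cases h1 : x ∈ A <;> by_cases h2 : G.Adj v x <;>
        simp only [h1, h2, hxv, and_self, and_true, and_false, if_true, if_false, ne_eq,
          not_true_eq_false, not_false_eq_true] <;> omega
  · intro x
    rw [hA₄.2 5 (by simp), hA₃.2 5 (by simp), hA₂.2 5 (by simp), h₁]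
  · intro x
    rw [hA₄.2 7 (by simp), h₃]

end Body

/-! ### Counting the conflicts at the vertex in focus. -/

section Branching

variable {μ : Mach} {n k : ℕ} {l : List (Fin n × Fin n)} {σ σ' : AState} {Q : AState → Prop}
variable {G : SimpleGraph (Fin n)} [DecidableRel G.Adj]
variable {A : Finset (Fin n)} {K c f : ℕ} {rest : List (Node (Fin n))} {v w : Fin n}

/-- The conflicts at `v` have been counted. -/
structure Analysed (G : SimpleGraph (Fin n)) [DecidableRel G.Adj] (l : List (Fin n × Fin n))
    (σ : AState) (A : Finset (Fin n)) (K c : ℕ) (v : Fin n) (rest : List (Node (Fin n))) :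
    Prop extends Marked G l σ A K c v rest where
  conflicts : ∀ x ∈ nb G A v, σ.arr 11 x = hdeg G A v x
  -- Outside N(v) the entries of array 11 have no meaning; only their size matters.
  conflicts_le : ∀ x : Fin n, σ.arr 11 x ≤ n + n
  card : σ.reg 16 = (nb G A v).card
  sum : σ.reg 17 = ∑ x ∈ nb G A v, hdeg G A v x
  sum_out : σ.reg 18 = ∑ x ∈ nb G A v, hout G A v x
  twins : σ.reg 19 = (twins G A v).card
  best_le : σ.reg 12 ≤ n + 1
  max_le : σ.reg 14 ≤ n
  none : σ.reg 12 = 0 → ∀ x ∈ nb G A v, hn G A v x = ∅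
  best : σ.reg 12 ≠ 0 → ∃ w : Fin n, σ.reg 13 = w ∧ Pref G A v w
  star : esum G A v ≤ 2 * σ.reg 14 → ∃ y, Covers G A v y y
  not_star : 2 * σ.reg 14 < esum G A v → ∀ y ∈ nb G A v, ¬ Covers G A v y y

theorem hdeg_le (x : Fin n) : hdeg G A v x ≤ n := by
  have := Finset.card_le_univ (hn G A v x)
  rwa [Fintype.card_fin] at this

theorem hout_le (x : Fin n) : hout G A v x ≤ n := by
  have := Finset.card_le_univ ((hn G A v x).filter fun y => ¬ G.Adj v y)
  rwa [Fintype.card_fin] at this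

theorem card_nb_le (x : Fin n) : (nb G A x).card ≤ n := by
  have := Finset.card_le_univ (nb G A x)
  rwa [Fintype.card_fin] at this

theorem sum_nb_le {g : Fin n → ℕ} (hg : ∀ x, g x ≤ n) : ∑ x ∈ nb G A v, g x ≤ n * n :=
  (Finset.sum_le_card_nsmul _ _ n fun x _ => hg x).trans
    (Nat.mul_le_mul_right n (card_nb_le v))

theorem sum_twins : ∑ x ∈ nb G A v, (1 - hdeg G A v x) = (twins G A v).card := by
  unfold twins
  rw [Finset.card_filter]
  refine Finset.sum_congr rfl fun x _ => ?_
  split_ifs <;> omega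

theorem pref_of_best {best : ℕ} (hw : w ∈ nb G A v)
    (h1 : ∀ x ∈ nb G A v, (if hdeg G A v x = 1 then n + 1 else hdeg G A v x) ≤ best)
    (h2 : (if hdeg G A v w = 1 then n + 1 else hdeg G A v w) = best) (h0 : best ≠ 0) :
    Pref G A v w := by
  have hle := hdeg_le (G := G) (A := A) (v := v) w
  by_cases hone : hdeg G A v w = 1
  · exact ⟨hw, by omega, Or.inl hone⟩
  · rw [if_neg hone] at h2
    refine ⟨hw, by omega, Or.inr fun x hx => ?_⟩
    have h3 := h1 x hx
    split_ifs at h3 <;> omega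

/-- Arrays 9 and 10 count neighbours in N(v) and outer conflicts, and array 11 combines them as in
`hdeg_eq`. The first maximum prefers vertices with one conflict, through the key n + 1; in the
second the value 1 is replaced by itself, which gives the true maximum for the star test. -/
def countStep : AProg :=
  .seq (countLoop 9 7) (.seq (countLoop 10 8)
    (.seq (sumLoop 16 (.get 7 (.reg 3)) (.const 1))
    (.seq (mapLoop 11 (.add (.sub (.sub (.reg 16) (.const 1)) (.get 9 (.reg 3)))
      (.get 10 (.reg 3))))
    (.seq (sumLoop 17 (.get 7 (.reg 3)) (.get 11 (.reg 3)))
    (.seq (sumLoop 18 (.get 7 (.reg 3)) (.get 10 (.reg 3)))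
    (.seq (sumLoop 19 (.get 7 (.reg 3)) (.sub (.const 1) (.get 11 (.reg 3))))
    (.seq (maxLoop 12 (.get 7 (.reg 3)) (.get 11 (.reg 3)) (.add (.reg 1) (.const 1)))
      (maxLoop 14 (.get 7 (.reg 3)) (.get 11 (.reg 3)) (.const 1)))))))))

theorem Marked.ok_near (hΛ : Layout μ n l.length k) (h : Marked G l σ A K c v rest) {R D : List ℕ}
    (hA : Agree R D σ σ') (h7 : 7 ∉ D) {x : Fin n}
    (h3 : σ'.reg 3 = x) :
    (AExpr.get 7 (.reg 3)).Ok μ σ' ∧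
      (AExpr.get 7 (.reg 3)).eval σ' = if x ∈ nb G A v then 1 else 0 := by
  have hb := hΛ.bounds
  have hl7 := hΛ.work 7 (by omega) (by omega)
  have hx := x.isLt
  simp only [AExpr.Ok, AExpr.eval, h3, hA.2 7 h7, h.near, hl7]
  by_cases hxv : x ∈ nb G A v <;> simp only [hxv, if_true, if_false, and_true] <;> omega

theorem ends_countStep (hl : IsEdgeList G l) (hΛ : Layout μ n l.length k)
    (h : Marked G l σ A K c v rest) (hQ : ∀ σ', Analysed G l σ' A K c v rest → Q σ') :
    Ends μ countStep σ Q := by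
  have hb := hΛ.bounds
  have hl9 := hΛ.work 9 (by omega) (by omega)
  have hl10 := hΛ.work 10 (by omega) (by omega)
  have hl11 := hΛ.work 11 (by omega) (by omega)
  have hone : ∀ P : Prop, [Decidable P] → (if P then 1 else 0) < μ.W := fun P _ => by
    split_ifs <;> omega
  refine Ends.seq (ends_countLoop hl hΛ h.given (by omega) (by omega) (by omega)
    (fun x => by rw [h.near]; exact hone _) fun σ₁ hA₁ h₁ => Ends.seq ?_)
  have hM₁ := h.agree hA₁ (by simp) (by simp)
  replace h₁ : ∀ x : Fin n, σ₁.arr 9 x = ((nb G A v).filter (G.Adj x)).card := by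
    intro x
    rw [h₁]
    congr 1
    ext y
    simp [h.near, and_comm]
  refine ends_countLoop hl hΛ hM₁.given (by omega) (by omega) (by omega)
    (fun x => by rw [hM₁.far]; exact hone _) fun σ₂ hA₂ h₂ => Ends.seq ?_
  have hM₂ := hM₁.agree hA₂ (by simp) (by simp)
  replace h₂ : ∀ x : Fin n, σ₂.arr 10 x = hout G A v x := by
    intro x
    rw [h₂, hout_eq]
    congr 1
    ext y
    simp only [hM₁.far, Finset.mem_filter, Finset.mem_univ, true_and]
    by_cases hy : y ∈ A ∧ ¬ G.Adj v y ∧ y ≠ v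
    · simp [hy]
    · simp only [hy, if_false]
      tauto
  refine ends_sumLoop_fin hΛ hM₂.given (by omega) (nb G A v) (fun _ => 1)
    (fun x σ' hA h3 => hM₂.ok_near hΛ hA (by simp) h3) (fun x _ σ' hA h3 => ⟨?_, rfl⟩) ?_
    fun σ₃ hA₃ h₃ => Ends.seq ?_
  · simp only [AExpr.Ok]
    omega
  · have := card_nb_le (G := G) (A := A) v
    simp only [Finset.sum_const, smul_eq_mul, mul_one]
    omega
  have hM₃ := hM₂.agree hA₃ (by simp) (by simp)
  rw [Finset.sum_const, smul_eq_mul, mul_one] at h₃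
  have hcard := card_nb_le (G := G) (A := A) v
  refine ends_mapLoop_fin hΛ hM₃.given (by omega)
    (fun x => (nb G A v).card - 1 - ((nb G A v).filter (G.Adj x)).card + hout G A v x)
    (fun x σ' hA h3 => ?_) fun σ₄ hA₄ h₄ => Ends.seq ?_
  · have hx := x.isLt
    have h5 := Finset.card_filter_le (nb G A v) (G.Adj x)
    have h6 := hout_le (G := G) (A := A) (v := v) x
    simp only [AExpr.Ok, AExpr.eval, and_true, h3, hA.1 16 (by simp), h₃, hA.2 9 (by simp),
      hA.2 10 (by simp), hA₃.2 9 (by simp), hA₃.2 10 (by simp), h₂, hA₂.2 9 (by simp), h₁, hl9,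
      hl10]
    omega
  have hM₄ := hM₃.agree hA₄ (by simp) (by simp)
  have c₄ : ∀ x ∈ nb G A v, σ₄.arr 11 x = hdeg G A v x := fun x hx => by rw [h₄, hdeg_eq hx]
  have c₄' : ∀ x : Fin n, σ₄.arr 11 x ≤ n + n := fun x => by
    have := hout_le (G := G) (A := A) (v := v) x
    rw [h₄]
    omega
  have o₄ : ∀ x : Fin n, σ₄.arr 10 x = hout G A v x := fun x => by
    rw [hA₄.2 10 (by simp), hA₃.2 10 (by simp), h₂]
  have hsum := sum_nb_le (G := G) (A := A) (v := v) (hdeg_le (G := G) (A := A) (v := v))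
  have hsum' := sum_nb_le (G := G) (A := A) (v := v) (hout_le (G := G) (A := A) (v := v))
  refine ends_sumLoop_fin hΛ hM₄.given (by omega) (nb G A v) (hdeg G A v)
    (fun x σ' hA h3 => hM₄.ok_near hΛ hA (by simp) h3) (fun x hx σ' hA h3 => ?_) (by omega)
    fun σ₅ hA₅ h₅ => Ends.seq ?_
  · have hxn := x.isLt
    have := hdeg_le (G := G) (A := A) (v := v) x
    simp only [AExpr.Ok, AExpr.eval, and_true, h3, hA.2 11 (by simp), c₄ x hx, hl11]
    omega
  have hM₅ := hM₄.agree hA₅ (by simp) (by simp)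
  refine ends_sumLoop_fin hΛ hM₅.given (by omega) (nb G A v) (hout G A v)
    (fun x σ' hA h3 => hM₅.ok_near hΛ hA (by simp) h3) (fun x hx σ' hA h3 => ?_) (by omega)
    fun σ₆ hA₆ h₆ => Ends.seq ?_
  · have hxn := x.isLt
    have := hout_le (G := G) (A := A) (v := v) x
    simp only [AExpr.Ok, AExpr.eval, and_true, h3, hA.2 10 (by simp), hA₅.2 10 (by simp), o₄, hl10]
    omega
  have hM₆ := hM₅.agree hA₆ (by simp) (by simp)
  have e₆ : σ₆.arr 11 = σ₄.arr 11 := (hA₆.2 11 (by simp)).trans (hA₅.2 11 (by simp))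
  refine ends_sumLoop_fin hΛ hM₆.given (by omega) (nb G A v) (fun x => 1 - hdeg G A v x)
    (fun x σ' hA h3 => hM₆.ok_near hΛ hA (by simp) h3) (fun x hx σ' hA h3 => ?_) ?_
    fun σ₇ hA₇ h₇ => Ends.seq ?_
  · have hxn := x.isLt
    have := hdeg_le (G := G) (A := A) (v := v) x
    simp only [AExpr.Ok, AExpr.eval, and_true, h3, hA.2 11 (by simp), e₆, c₄ x hx, hl11]
    omega
  · have : (twins G A v).card ≤ (nb G A v).card := Finset.card_filter_le _ _
    rw [sum_twins]
    omega
  rw [sum_twins] at h₇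
  have hM₇ := hM₆.agree hA₇ (by simp) (by simp)
  have e₇ : σ₇.arr 11 = σ₄.arr 11 := (hA₇.2 11 (by simp)).trans e₆
  refine ends_maxLoop_fin hΛ hM₇.given (by omega) (nb G A v) (hdeg G A v) (n + 1) (by omega)
    (fun x σ' hA h3 => hM₇.ok_near hΛ hA (by simp) h3) (fun x hx σ' hA h3 => ?_)
    (fun σ' hA => ?_) fun σ₈ hA₈ hm₈ hb₈ => ?_
  · have hxn := x.isLt
    have := hdeg_le (G := G) (A := A) (v := v) x
    simp only [AExpr.Ok, AExpr.eval, true_and, h3, hA.2 11 (by simp), e₇, c₄ x hx, hl11]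
    omega
  · simp only [AExpr.Ok, AExpr.eval, and_true, hA.1 1 (by simp), hM₇.given.n]
    omega
  have hM₈ := hM₇.agree hA₈ (by simp) (by simp)
  have e₈ : σ₈.arr 11 = σ₄.arr 11 := (hA₈.2 11 (by simp)).trans e₇
  refine ends_maxLoop_fin hΛ hM₈.given (by omega) (nb G A v) (hdeg G A v) 1 (by omega)
    (fun x σ' hA h3 => hM₈.ok_near hΛ hA (by simp) h3) (fun x hx σ' hA h3 => ?_)
    (fun σ' hA => ?_) fun σ₉ hA₉ hm₉ hb₉ => hQ σ₉ ?_
  · have hxn := x.isLt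
    have := hdeg_le (G := G) (A := A) (v := v) x
    simp only [AExpr.Ok, AExpr.eval, true_and, h3, hA.2 11 (by simp), e₈, c₄ x hx, hl11]
    omega
  · simp only [AExpr.Ok, AExpr.eval, and_true]
    omega
  have hkey : ∀ x, (if hdeg G A v x = 1 then 1 else hdeg G A v x) = hdeg G A v x := fun x => by
    split_ifs <;> omega
  simp only [hkey] at hm₉ hb₉
  have r12 : σ₉.reg 12 = σ₈.reg 12 := hA₉.1 12 (by simp)
  have r13 : σ₉.reg 13 = σ₈.reg 13 := hA₉.1 13 (by simp)
  have e₉ : σ₉.arr 11 = σ₄.arr 11 := (hA₉.2 11 (by simp)).trans e₈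
  have hempty : (∀ x ∈ nb G A v, hdeg G A v x = 0) → ∀ x ∈ nb G A v, hn G A v x = ∅ :=
    fun h x hx => Finset.card_eq_zero.1 (h x hx)
  refine ⟨hM₈.agree hA₉ (by simp) (by simp), ?_, ?_, ?_, ?_, ?_, ?_, ?_, ?_, ?_, ?_, ?_, ?_⟩
  · rw [e₉]
    exact c₄
  · rw [e₉]
    exact c₄'
  · rw [hA₉.1 16 (by simp), hA₈.1 16 (by simp), hA₇.1 16 (by simp), hA₆.1 16 (by simp),
      hA₅.1 16 (by simp), hA₄.1 16 (by simp), h₃]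
  · rw [hA₉.1 17 (by simp), hA₈.1 17 (by simp), hA₇.1 17 (by simp), hA₆.1 17 (by simp), h₅]
  · rw [hA₉.1 18 (by simp), hA₈.1 18 (by simp), hA₇.1 18 (by simp), h₆]
  · rw [hA₉.1 19 (by simp), hA₈.1 19 (by simp), h₇]
  · rw [r12]
    by_cases h0 : σ₈.reg 12 = 0
    · omega
    · obtain ⟨x, -, -, hx⟩ := hb₈ h0
      have := hdeg_le (G := G) (A := A) (v := v) x
      split_ifs at hx <;> omega
  · by_cases h0 : σ₉.reg 14 = 0
    · omega
    · obtain ⟨x, -, -, hx⟩ := hb₉ h0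
      have := hdeg_le (G := G) (A := A) (v := v) x
      omega
  · rw [r12]
    refine fun h0 => hempty fun x hx => ?_
    have := hm₈ x hx
    split_ifs at this <;> omega
  · rw [r12, r13]
    intro h0
    obtain ⟨x, hx, h13, hx'⟩ := hb₈ h0
    exact ⟨x, h13, pref_of_best hx hm₈ hx' h0⟩
  · intro hstar
    by_cases h0 : σ₉.reg 14 = 0
    · refine ⟨v, fun x hx y hy => ?_⟩
      rw [hempty (fun x hx => by have := hm₉ x hx; omega) x hx] at hy
      simp at hy
    · obtain ⟨y, hy, -, hy'⟩ := hb₉ h0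
      exact ⟨y, (covers_iff hy).2 (by rwa [hy'])⟩
  · intro hstar y hy hcov
    have h5 := (covers_iff hy).1 hcov
    have h6 := hm₉ y hy
    omega

end Branching

/-! ### The steps for chosen and kept vertices. -/

section Steps

variable {μ : Mach} {n k : ℕ} {l : List (Fin n × Fin n)} {σ σ' : AState} {Q : AState → Prop}
variable {G : SimpleGraph (Fin n)} [DecidableRel G.Adj]
variable {A : Finset (Fin n)} {K c f : ℕ} {rest : List (Node (Fin n))} {v w : Fin n}

/-- The distance of two numbers. -/
def AExpr.dist (e f : AExpr) : AExpr := .add (.sub e f) (.sub f e)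

/-- Nonzero for the vertex in focus and its neighbours without conflicts. -/
def twinTest : AExpr :=
  .add (.sub (.add (.get 7 (.reg 3)) (.sub (.const 1) (.get 11 (.reg 3)))) (.const 1))
    (.get 5 (.reg 3))

/-- The lower frame already encodes the node that keeps `v`; its copy on top becomes the node
without `v`. The copy inherits the code of a kept vertex, so either the code is reset or only the
focus moves to `w`. -/
def splitStep : AProg :=
  .seq copyLoop (.seq raise (.seq (deleteLoop twinTest)
    (.seq (setBudget (.sub (.reg 8) (.add (.const 1) (.reg 19))))
      (.ite (.dist (.add (.reg 17) (.reg 18)) (.add (.reg 20) (.add (.reg 20) (.const 2))))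
        (setCode 0) (setFocus (.reg 13))))))

/-- The code is set to kept at the outset, because every outcome leaves a kept vertex in this frame:
`v` itself, or `w` for a butterfly. The inner test sums quantities that all vanish exactly for a
butterfly, and the budget test is nonzero exactly if `v` and its twins can be paid for. -/
def freshStep : AProg :=
  .seq (setCode 2) (.seq (.assign 9 (.const 2))
    (.ite (.sub (.add (.reg 17) (.reg 18)) (.add (.reg 14) (.reg 14)))
      (.seq (.assign 20 (.get 11 (.reg 13)))
        (.ite (.add (.add (.dist (.reg 16) (.const 4)) (.reg 18))
            (.add (.dist (.reg 17) (.const 8)) (.dist (.reg 20) (.const 2))))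
          (.ite (.sub (.reg 8) (.reg 19)) splitStep .nop)
          (setFocus (.reg 13)))) .nop))

theorem esum_eq_add : esum G A v =
    ∑ x ∈ nb G A v, hdeg G A v x + ∑ x ∈ nb G A v, hout G A v x :=
  Finset.sum_add_distrib

theorem ends_splitStep (hΛ : Layout μ n l.length k) (h : Analysed G l σ A K 2 v rest)
    (hlen : rest.length ≤ n) (hK : K ≤ k) (hw : σ.reg 13 = w) (h20 : σ.reg 20 = hdeg G A v w)
    (hm : ∀ m : Mode (Fin n), m = (if esum G A v = 2 * (hdeg G A v w + 1) then .kept w else .free) →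
      ∀ σ', Pile l σ' (⟨A \ insert v (twins G A v), K - (1 + (twins G A v).card), m⟩ ::
        ⟨A, K, .kept v⟩ :: rest) → Q σ') :
    Ends μ splitStep σ Q := by
  have hb := hΛ.bounds
  have hl5 := hΛ.work 5 (by omega) (by omega)
  have hl7 := hΛ.work 7 (by omega) (by omega)
  have hl11 := hΛ.work 11 (by omega) (by omega)
  have hv := v.isLt
  have hwn := w.isLt
  refine Ends.seq (ends_copy hΛ h.toTop hlen hK (by omega) (by omega) fun σ₁ hA₁ hT₁ hF₁ =>
    Ends.seq (ends_raise hΛ hT₁ hlen (m := .kept v) ⟨rfl, rfl⟩ hF₁ fun σ₂ hA₂ hT₂ => Ends.seq ?_))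
  have hlen' : (⟨A, K, .kept v⟩ :: rest : List (Node (Fin n))).length ≤ n + 1 := by
    simpa using hlen
  have ind : ∀ x : Fin n, σ₂.arr 5 x = if x = v then 1 else 0 := fun x => by
    rw [hA₂.2 5 (by simp), hA₁.2 5 (by simp), h.ind]
  have near : ∀ x : Fin n, σ₂.arr 7 x = if x ∈ nb G A v then 1 else 0 := fun x => by
    rw [hA₂.2 7 (by simp), hA₁.2 7 (by simp), h.near]
  have e11 : σ₂.arr 11 = σ.arr 11 := (hA₂.2 11 (by simp)).trans (hA₁.2 11 (by simp))
  refine ends_delete hΛ hT₂ hlen' (insert v (twins G A v)) (fun x σ' hA h3 => ?_)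
    fun σ₃ hA₃ hT₃ => Ends.seq ?_
  · have hx := x.isLt
    have hle := h.conflicts_le x
    simp only [twinTest, AExpr.Ok, AExpr.eval, h3, hA.2 5 (by simp), hA.2 7 (by simp),
      hA.2 11 (by simp), ind, near, e11, hl5, hl7, hl11]
    by_cases hxv : x = v
    · subst hxv
      have : x ∉ nb G A x := fun h => (mem_nb.1 h).2.ne rfl
      simp only [this, Finset.mem_insert, true_or, if_true, if_false]
      omega
    · by_cases hxn : x ∈ nb G A v
      · have hc := h.conflicts x hxn
        have hle' := hdeg_le (G := G) (A := A) (v := v) x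
        have : x ∈ twins G A v ↔ hdeg G A v x = 0 := by simp [twins, hxn]
        simp only [hxv, hxn, Finset.mem_insert, false_or, this, if_true, if_false, hc]
        by_cases h0 : hdeg G A v x = 0 <;> simp only [h0, if_true, if_false, and_true] <;> omega
      · have : x ∉ twins G A v := fun h => hxn (Finset.mem_filter.1 h).1
        simp only [hxv, hxn, Finset.mem_insert, false_or, this, if_false]
        omega
  have r : ∀ i, i ∉ [3, 6, 7] → σ₃.reg i = σ.reg i := fun i hi => by
    simp only [List.mem_cons, List.not_mem_nil, or_false, not_or] at hi
    rw [hA₃.1 i (by simp; omega), hA₂.1 i (by simp; omega), hA₁.1 i (by simp; omega)]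
  have hcard := card_nb_le (G := G) (A := A) v
  have htw : (twins G A v).card ≤ (nb G A v).card := Finset.card_filter_le _ _
  refine ends_setBudget hΛ hT₃ hlen' (K' := K - (1 + (twins G A v).card)) ?_ ?_
    fun σ₄ hA₄ hT₄ _ => ?_
  · simp only [AExpr.Ok, AExpr.eval, r 8 (by simp), r 19 (by simp), h.budget, h.twins]
    omega
  · simp only [AExpr.eval, r 8 (by simp), r 19 (by simp), h.budget, h.twins]
  have r' : ∀ i, i ∉ [3, 6, 7] → σ₄.reg i = σ.reg i := fun i hi =>
    (hA₄.1 i (by simp)).trans (r i hi)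
  have hsum := sum_nb_le (G := G) (A := A) (v := v) (hdeg_le (G := G) (A := A) (v := v))
  have hsum' := sum_nb_le (G := G) (A := A) (v := v) (hout_le (G := G) (A := A) (v := v))
  have hwle := hdeg_le (G := G) (A := A) (v := v) w
  rw [esum_eq_add] at hm
  refine Ends.ite ?_ (fun h0 => ?_) fun h0 => ?_
  · simp only [AExpr.dist, AExpr.Ok, AExpr.eval, r' 17 (by simp), r' 18 (by simp),
      r' 20 (by simp), h.sum, h.sum_out, h20]
    omega
  · simp only [AExpr.dist, AExpr.eval, r' 17 (by simp), r' 18 (by simp),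
      r' 20 (by simp), h.sum, h.sum_out, h20] at h0
    refine ends_setCode hΛ hT₄ hlen' (by omega) fun σ₅ hA₅ hT₅ =>
      hm _ rfl _ (hT₅.pile ?_)
    rw [if_neg (by omega)]
    exact ⟨rfl, by omega⟩
  · simp only [AExpr.dist, AExpr.eval, r' 17 (by simp), r' 18 (by simp),
      r' 20 (by simp), h.sum, h.sum_out, h20] at h0
    refine ends_setFocus hΛ hT₄ hlen' (f' := w) ?_ ?_ fun σ₅ hA₅ hT₅ =>
      hm _ rfl _ (hT₅.pile ?_)
    · simp only [AExpr.Ok, r' 13 (by simp), hw]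
      omega
    · simp only [AExpr.eval, r' 13 (by simp), hw]
    rw [if_pos (by omega)]
    exact ⟨rfl, rfl⟩

theorem Analysed.agree (h : Analysed G l σ A K c v rest) {R D : List ℕ} (hA : Agree R D σ σ')
    (hR : ∀ i ∈ R, i ∉ [8, 10, 12, 13, 14, 16, 17, 18, 19]) (hD : ∀ j ∈ D, j ∉ [1, 5, 7, 8, 11])
    {c' : ℕ} (hT : Top l σ' A K c' v rest) (h9 : σ'.reg 9 = c') :
    Analysed G l σ' A K c' v rest := by
  have hr : ∀ i, i ∈ [8, 10, 12, 13, 14, 16, 17, 18, 19] → σ'.reg i = σ.reg i := fun i hi =>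
    hA.1 i fun h => hR i h hi
  have hd : ∀ i, i ∈ [1, 5, 7, 8, 11] → σ'.arr i = σ.arr i := fun i hi =>
    hA.2 i fun h => hD i h hi
  refine ⟨⟨⟨hT, ?_, ?_, h9, ?_⟩, ?_, ?_, ?_⟩, ?_, ?_, ?_, ?_, ?_, ?_, ?_, ?_, ?_, ?_, ?_, ?_⟩
  · rw [hd 1 (by simp)]; exact h.alive
  · rw [hr 8 (by simp)]; exact h.budget
  · rw [hr 10 (by simp)]; exact h.focus
  · rw [hd 5 (by simp)]; exact h.ind
  · rw [hd 7 (by simp)]; exact h.near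
  · rw [hd 8 (by simp)]; exact h.far
  · rw [hd 11 (by simp)]; exact h.conflicts
  · rw [hd 11 (by simp)]; exact h.conflicts_le
  · rw [hr 16 (by simp)]; exact h.card
  · rw [hr 17 (by simp)]; exact h.sum
  · rw [hr 18 (by simp)]; exact h.sum_out
  · rw [hr 19 (by simp)]; exact h.twins
  · rw [hr 12 (by simp)]; exact h.best_le
  · rw [hr 14 (by simp)]; exact h.max_le
  · rw [hr 12 (by simp)]; exact h.none
  · rw [hr 12 (by simp), hr 13 (by simp)]; exact h.best
  · rw [hr 14 (by simp)]; exact h.star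
  · rw [hr 14 (by simp)]; exact h.not_star

theorem exists_split_mode (hw : w ∈ nb G A v) : ∃ m : Mode (Fin n),
    m = (if esum G A v = 2 * (hdeg G A v w + 1) then .kept w else .free) ∧
    ((m = .kept w ∧ ∃ c, Covers G A v w c) ∨
      (m = .free ∧ esum G A v ≠ 2 * (hdeg G A v w + 1))) := by
  refine ⟨_, rfl, ?_⟩
  split_ifs with h
  · exact Or.inl ⟨rfl, exists_covers_of_esum hw h⟩
  · exact Or.inr ⟨rfl, h⟩

theorem ends_freshStep (hΛ : Layout μ n l.length k) (h : Analysed G l σ A K 1 v rest)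
    (hlen : rest.length ≤ n) (hK : K ≤ k)
    (hQ : ∀ σ', Next G l ⟨A, K, .fresh v⟩ rest σ' → Q σ') : Ends μ freshStep σ Q := by
  have hb := hΛ.bounds
  have hl11 := hΛ.work 11 (by omega) (by omega)
  refine Ends.seq (ends_setCode hΛ h.toTop (by omega) (c' := 2) (by omega) fun σ₁ hA₁ hT₁ =>
    Ends.seq (Ends.assign ?_ ?_))
  · simp only [AExpr.Ok]
    omega
  have hA₂ : Agree [9] [15] σ (σ₁.setReg 9 2) :=
    (hA₁.trans (Agree.refl [] [] _) (by simp) (by simp) (by simp) (by simp)).setReg (by simp) _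
  have hT₂ : Top l (σ₁.setReg 9 2) A K 2 v rest := hT₁.agree (R := [9]) (D := [])
    ((Agree.refl _ _ _).setReg (by simp) _) (by simp) (by simp)
  have h₂ := h.agree hA₂ (by simp) (by simp) hT₂ (by simp)
  simp only [AExpr.eval]
  generalize σ₁.setReg 9 2 = σ₂ at h₂ hT₂
  have hsum := sum_nb_le (G := G) (A := A) (v := v) (hdeg_le (G := G) (A := A) (v := v))
  have hsum' := sum_nb_le (G := G) (A := A) (v := v) (hout_le (G := G) (A := A) (v := v))
  have hmax := h₂.max_le
  refine Ends.ite ?_ (fun h0 => ?_) fun h0 => ?_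
  · simp only [AExpr.Ok, AExpr.eval, h₂.sum, h₂.sum_out]
    omega
  · simp only [AExpr.eval, h₂.sum, h₂.sum_out, ← esum_eq_add] at h0
    have hstar := h₂.not_star (by omega)
    have h12 : σ₂.reg 12 ≠ 0 := by
      intro h12
      have hnone := h₂.none h12
      have : esum G A v = 0 := by
        refine Finset.sum_eq_zero fun x hx => ?_
        have h1 : hdeg G A v x = 0 := Finset.card_eq_zero.2 (hnone x hx)
        have h2 := hdeg_eq_add (G := G) (A := A) (v := v) x
        omega
      omega
    obtain ⟨w, hw, hpref⟩ := h₂.best h12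
    have hwn := w.isLt
    have hwle := hdeg_le (G := G) (A := A) (v := v) w
    have hcw := h₂.conflicts w hpref.1
    have hcard := card_nb_le (G := G) (A := A) v
    have htw : (twins G A v).card ≤ (nb G A v).card := Finset.card_filter_le _ _
    refine Ends.seq (Ends.assign ?_ ?_)
    · simp only [AExpr.Ok, AExpr.eval, hw, hcw, hl11]
      omega
    simp only [AExpr.eval, hw, hcw]
    have hA₃ : Agree [20] [] σ₂ (σ₂.setReg 20 (hdeg G A v w)) :=
      (Agree.refl _ _ _).setReg (by simp) _
    have h₃ := h₂.agree hA₃ (by simp) (by simp)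
      (hT₂.agree hA₃ (by simp) (by simp)) (by simpa using h₂.code)
    have h20 : (σ₂.setReg 20 (hdeg G A v w)).reg 20 = hdeg G A v w := by simp
    have h13 : (σ₂.setReg 20 (hdeg G A v w)).reg 13 = w := by simpa using hw
    generalize σ₂.setReg 20 (hdeg G A v w) = σ₃ at h₃ h20 h13
    have hbf := butterfly_iff hpref
    refine Ends.ite ?_ (fun h1 => ?_) fun h1 => ?_
    · simp only [AExpr.dist, AExpr.Ok, AExpr.eval, h₃.card, h₃.sum, h₃.sum_out, h20]
      omega
    · simp only [AExpr.dist, AExpr.eval, h₃.card, h₃.sum, h₃.sum_out, h20] at h1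
      have hnb : ¬ Butterfly G A v := by
        rw [hbf]
        omega
      obtain ⟨m, hm, hm'⟩ := exists_split_mode hpref.1
      refine Ends.ite ?_ (fun h4 => ?_) fun h4 => ?_
      · simp only [AExpr.Ok, h₃.budget, h₃.twins]
        omega
      · simp only [AExpr.eval, h₃.budget, h₃.twins] at h4
        refine ends_splitStep hΛ h₃ hlen hK h13 h20 fun m' hmm σ' hP => hQ σ' (Or.inl ?_)
        obtain rfl : m' = m := hmm.trans hm.symm
        refine ⟨_, .split A K v w m' hpref hstar hnb hm', ?_⟩
        rw [if_pos (by omega)]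
        exact hP
      · simp only [AExpr.eval, h₃.budget, h₃.twins] at h4
        refine Ends.nop (hQ _ (Or.inl ⟨_, .split A K v w m hpref hstar hnb hm', ?_⟩))
        rw [if_neg (by omega)]
        exact h₃.toTop.pile ⟨rfl, rfl⟩
    · simp only [AExpr.dist, AExpr.eval, h₃.card, h₃.sum, h₃.sum_out, h20] at h1
      have hbut : Butterfly G A v := by
        rw [hbf]
        omega
      refine ends_setFocus hΛ h₃.toTop (by omega) (f' := w) ?_ ?_ fun σ₄ _ hT₄ =>
        hQ _ (Or.inl ⟨_, .butterfly A K v w hbut hpref.1, hT₄.pile ⟨rfl, rfl⟩⟩)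
      · simp only [AExpr.Ok, h13]
        omega
      · simp only [AExpr.eval, h13]
  · simp only [AExpr.eval, h₂.sum, h₂.sum_out, ← esum_eq_add] at h0
    obtain ⟨y, hy⟩ := h₂.star (by omega)
    exact Ends.nop (hQ _ (Or.inl ⟨_, .star A K v y hy, hT₂.pile ⟨rfl, rfl⟩⟩))

/-- Nonzero for the vertices in conflict with the vertex in register 13. -/
def conflictExpr : AExpr :=
  .add (.sub (.sub (.get 7 (.reg 3)) (.get 13 (.reg 3))) (.get 12 (.reg 3)))
    (.sub (.add (.get 8 (.reg 3)) (.get 13 (.reg 3))) (.const 1))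

def deleteConflicts : AProg :=
  .ite (.sub (.add (.reg 8) (.const 1)) (.reg 20))
    (.seq (deleteLoop (.get 14 (.reg 3))) (setBudget (.sub (.reg 8) (.reg 20)))) pop

/-- The larger child, which only loses `w`, is written into the lower frame, and the copy above it
loses the conflicts of `w`. If the budget does not allow the latter, `deleteConflicts` drops that
frame. -/
def keptStep : AProg :=
  .ite (.reg 12)
    (.seq (.assign 20 (.get 11 (.reg 13))) (.seq (pointLoop 12 13) (.seq (countLoop 13 12)
      (.seq (mapLoop 14 conflictExpr)
        (.ite (.sub (.reg 20) (.const 1))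
          (.ite (.reg 8) (.seq copyLoop (.seq (deleteVertex 13) (.seq
            (setBudget (.sub (.reg 8) (.const 1))) (.seq raise deleteConflicts)))) deleteConflicts)
          deleteConflicts)))))
    (setCode 0)

theorem ends_deleteConflicts (hΛ : Layout μ n l.length k) (h : Top l σ A K 2 v rest)
    (hlen : rest.length ≤ n + 1) (hK : K ≤ k) (h8 : σ.reg 8 = K) (h20 : σ.reg 20 = hdeg G A v w)
    (h14 : ∀ x : Fin n, σ.arr 14 x = if x ∈ hn G A v w then 1 else 0)
    (hQ : ∀ σ', Pile l σ' ((if hdeg G A v w ≤ K then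
      [⟨A \ hn G A v w, K - hdeg G A v w, .kept v⟩] else []) ++ rest) → Q σ') :
    Ends μ deleteConflicts σ Q := by
  have hb := hΛ.bounds
  have hl14 := hΛ.work 14 (by omega) (by omega)
  have hwle := hdeg_le (G := G) (A := A) (v := v) w
  refine Ends.ite ?_ (fun h0 => ?_) fun h0 => ?_
  · simp only [AExpr.Ok, AExpr.eval, h8, h20]
    omega
  · simp only [AExpr.eval, h8, h20] at h0
    rw [if_pos (by omega)] at hQ
    refine Ends.seq (ends_delete hΛ h hlen (hn G A v w) (fun x σ' hA h3 => ?_) fun σ₁ hA₁ hT₁ =>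
      ends_setBudget hΛ hT₁ hlen (K' := K - hdeg G A v w) ?_ ?_ fun σ₂ _ hT₂ _ =>
        hQ _ (hT₂.pile ⟨rfl, rfl⟩))
    · have hx := x.isLt
      simp only [AExpr.Ok, AExpr.eval, h3, hA.2 14 (by simp), h14, hl14]
      by_cases hxw : x ∈ hn G A v w <;> simp only [hxw, if_true, if_false, and_true] <;> omega
    · simp only [AExpr.Ok, hA₁.1 8 (by simp), hA₁.1 20 (by simp), h8, h20]
      omega
    · simp only [AExpr.eval, hA₁.1 8 (by simp), hA₁.1 20 (by simp), h8, h20]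
  · simp only [AExpr.eval, h8, h20] at h0
    rw [if_neg (by omega)] at hQ
    exact ends_pop hΛ h hlen hQ

theorem mem_hn_iff (hw : w ∈ nb G A v) (x : Fin n) : x ∈ hn G A v w ↔
    (x ∈ nb G A v ∧ ¬ G.Adj x w ∧ x ≠ w) ∨
      (x ∈ A.filter (fun y => ¬ G.Adj v y ∧ y ≠ v) ∧ G.Adj x w) := by
  have hvw := (mem_nb.1 hw).2
  simp only [mem_hn, mem_nb, Finset.mem_filter, Conf, G.adj_comm x w]
  constructor
  · tauto
  · rintro (⟨⟨h1, h2⟩, h3, h4⟩ | ⟨⟨h1, h2, h3⟩, h4⟩)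
    · have := h2.ne'
      tauto
    · have := h4.ne'
      tauto

theorem ends_keptStep (hl : IsEdgeList G l) (hΛ : Layout μ n l.length k)
    (h : Analysed G l σ A K 2 v rest) (hlen : rest.length ≤ n) (hK : K ≤ k)
    (hQ : ∀ σ', Next G l ⟨A, K, .kept v⟩ rest σ' → Q σ') : Ends μ keptStep σ Q := by
  have hb := hΛ.bounds
  have hl11 := hΛ.work 11 (by omega) (by omega)
  have hl7 := hΛ.work 7 (by omega) (by omega)
  have hl8 := hΛ.work 8 (by omega) (by omega)
  have hl12 := hΛ.work 12 (by omega) (by omega)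
  have hl13 := hΛ.work 13 (by omega) (by omega)
  have hv := v.isLt
  have hbest := h.best_le
  refine Ends.ite ?_ (fun h0 => ?_) fun h0 => ?_
  · simp only [AExpr.Ok]
    omega
  · obtain ⟨w, hw, hpref⟩ := h.best h0
    have hwn := w.isLt
    have hwle := hdeg_le (G := G) (A := A) (v := v) w
    have hcw := h.conflicts w hpref.1
    refine Ends.seq (Ends.assign ?_ (Ends.seq ?_))
    · simp only [AExpr.Ok, AExpr.eval, hw, hcw, hl11]
      omega
    simp only [AExpr.eval, hw, hcw]
    have hA₁ : Agree [20] [] σ (σ.setReg 20 (hdeg G A v w)) :=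
      (Agree.refl _ _ _).setReg (by simp) _
    have h₁ := h.toMarked.agree hA₁ (by simp) (by simp)
    have h20₁ : (σ.setReg 20 (hdeg G A v w)).reg 20 = hdeg G A v w := by simp
    have h13₁ : (σ.setReg 20 (hdeg G A v w)).reg 13 = w := by simpa using hw
    generalize σ.setReg 20 (hdeg G A v w) = σ₁ at h₁ h20₁ h13₁
    refine ends_pointLoop hΛ h₁.given (by omega) (by omega) h13₁ fun σ₂ hA₂ h12₂ => Ends.seq ?_
    have h₂ := h₁.agree hA₂ (by simp) (by simp)
    refine ends_countLoop hl hΛ h₂.given (by omega) (by omega) (by omega) (fun x => ?_)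
      fun σ₃ hA₃ h13 => Ends.seq ?_
    · rw [h12₂]
      split_ifs <;> omega
    simp only [h12₂, card_adj_point] at h13
    have h₃ := h₂.agree hA₃ (by simp) (by simp)
    refine ends_mapLoop_fin hΛ h₃.given (by omega) (fun x => if x ∈ hn G A v w then 1 else 0)
      (fun x σ' hA h3 => ?_) fun σ₄ hA₄ h14 => ?_
    · have hx := x.isLt
      simp only [conflictExpr, AExpr.Ok, AExpr.eval, h3, hA.2 7 (by simp), hA.2 8 (by simp),
        hA.2 12 (by simp), hA.2 13 (by simp), h₃.near, h₃.far, hA₃.2 12 (by simp), h12₂, h13,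
        hl7, hl8, hl12, hl13, mem_hn_iff hpref.1]
      have hdisj : x ∈ nb G A v → x ∉ A.filter (fun y => ¬ G.Adj v y ∧ y ≠ v) := by
        simp only [mem_nb, Finset.mem_filter]
        tauto
      by_cases p4 : x = w
      · subst p4
        simp only [hpref.1, hdisj hpref.1, SimpleGraph.irrefl, ne_eq, not_true_eq_false, and_false,
          or_false, and_true, if_true, if_false]
        omega
      · by_cases p1 : x ∈ nb G A v
        · have p2 := hdisj p1
          by_cases p3 : G.Adj x w <;>
            simp only [p1, p2, p3, p4, ne_eq, not_true_eq_false, not_false_eq_true, and_true,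
              and_false, or_false, if_true, if_false] <;> omega
        · by_cases p2 : x ∈ A.filter (fun y => ¬ G.Adj v y ∧ y ≠ v) <;>
            by_cases p3 : G.Adj x w <;>
            simp only [p1, p2, p3, p4, ne_eq, not_true_eq_false, not_false_eq_true, and_true,
              and_false, or_false, false_or, if_true, if_false] <;> omega
    have h₄ := h₃.agree hA₄ (by simp) (by simp)
    have h20 : σ₄.reg 20 = hdeg G A v w := by
      rw [hA₄.1 20 (by simp), hA₃.1 20 (by simp), hA₂.1 20 (by simp), h20₁]
    have hw₄ : σ₄.reg 13 = w := by
      rw [hA₄.1 13 (by simp), hA₃.1 13 (by simp), hA₂.1 13 (by simp), h13₁]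
    have hsmall : ¬ (2 ≤ hdeg G A v w ∧ 1 ≤ K) → Ends μ deleteConflicts σ₄ Q := by
      intro hcond
      refine ends_deleteConflicts hΛ h₄.toTop (by omega) hK h₄.budget h20 h14 fun σ' hP =>
        hQ σ' (Or.inl ⟨_, .branch A K v w hpref, ?_⟩)
      rw [if_neg hcond, List.append_nil]
      exact hP
    refine Ends.ite ?_ (fun h5 => Ends.ite ?_ (fun h6 => ?_) fun h6 => hsmall ?_)
      fun h5 => hsmall ?_
    · simp only [AExpr.Ok, h20]
      omega
    · simp only [AExpr.Ok, h₄.budget]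
      omega
    · simp only [AExpr.eval, h20] at h5
      simp only [AExpr.eval, h₄.budget] at h6
      refine Ends.seq (ends_copy hΛ h₄.toTop hlen hK (by omega) (by omega)
        fun σ₅ hA₅ hT₅ hF₅ => Ends.seq (ends_deleteVertex hΛ hT₅ (by omega) (w := w) ?_
        fun σ₆ hA₆ hT₆ hF₆ => Ends.seq (ends_setBudget hΛ hT₆ (by omega) (K' := K - 1) ?_ ?_
        fun σ₇ hA₇ hT₇ hF₇ => Ends.seq (ends_raise hΛ hT₇ hlen (m := .kept v) ⟨rfl, rfl⟩
          (hF₅.congr fun y hy _ => ?_) fun σ₈ hA₈ hT₈ =>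
          ends_deleteConflicts (G := G) (w := w) hΛ hT₈ (by simpa using hlen) hK ?_ ?_ ?_
          fun σ' hP => hQ σ' (Or.inl ⟨_, .branch A K v w hpref, ?_⟩)))))
      · rw [hA₅.1 13 (by simp), hw₄]
      · simp only [AExpr.Ok, hA₆.1 8 (by simp), hA₅.1 8 (by simp), h₄.budget]
        omega
      · simp only [AExpr.eval, hA₆.1 8 (by simp), hA₅.1 8 (by simp), h₄.budget]
      · rw [Nat.succ_mul] at hy
        rw [hF₇ y hy, hF₆ y hy]
      · rw [hA₈.1 8 (by simp), hA₇.1 8 (by simp), hA₆.1 8 (by simp), hA₅.1 8 (by simp), h₄.budget]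
      · rw [hA₈.1 20 (by simp), hA₇.1 20 (by simp), hA₆.1 20 (by simp), hA₅.1 20 (by simp), h20]
      · rw [hA₈.2 14 (by simp), hA₇.2 14 (by simp), hA₆.2 14 (by simp), hA₅.2 14 (by simp)]
        exact h14
      · rw [if_pos (by omega : 2 ≤ hdeg G A v w ∧ 1 ≤ K), List.append_assoc]
        exact hP
    · simp only [AExpr.eval, h₄.budget] at h6
      omega
    · simp only [AExpr.eval, h20] at h5
      omega
  · exact ends_setCode hΛ h.toTop (by omega) (by omega) fun σ₁ _ hT₁ =>
      hQ _ (Or.inl ⟨_, .release A K v (h.none h0), hT₁.pile ⟨rfl, by omega⟩⟩)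

/-- One step of the search. -/
def searchStep : AProg :=
  .seq load (.ite (.reg 9)
    (.seq markStep (.seq countStep (.ite (.sub (.reg 9) (.const 1)) keptStep freshStep))) freeStep)

theorem ends_searchStep (hl : IsEdgeList G l) (hΛ : Layout μ n l.length k) {s : Node (Fin n)}
    (hP : Pile l σ (s :: rest)) (hV : Valid k (s :: rest)) :
    Ends μ searchStep σ (Next G l s rest) := by
  have hb := hΛ.bounds
  have hlen : rest.length ≤ n := by simpa using hV.length_le
  have hK := hV.budget s (by simp)
  obtain ⟨A, K, m⟩ := s
  obtain ⟨c, f, hm, hT⟩ := hP.exists_top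
  have hcf := hm.le
  refine Ends.seq (ends_load hΛ hT hlen hK hcf.1 hcf.2 fun σ₁ h₁ => Ends.ite ?_ (fun h0 => ?_)
    fun h0 => ?_)
  · simp only [AExpr.Ok, h₁.code]
    omega
  · simp only [AExpr.eval, h₁.code] at h0
    have hmark : ∀ v : Fin n, f = v → (∀ σ₂, Analysed G l σ₂ A K c v rest →
        Ends μ (.ite (.sub (.reg 9) (.const 1)) keptStep freshStep) σ₂
          (Next G l ⟨A, K, m⟩ rest)) →
        Ends μ (.seq markStep (.seq countStep (.ite (.sub (.reg 9) (.const 1)) keptStep freshStep)))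
          σ₁ (Next G l ⟨A, K, m⟩ rest) := by
      rintro v rfl h
      exact Ends.seq (ends_markStep hl hΛ h₁ fun σ₂ h₂ =>
        Ends.seq (ends_countStep hl hΛ h₂ fun σ₃ h₃ => h σ₃ h₃))
    have hok : ∀ σ₂, σ₂.reg 9 = c → (AExpr.sub (.reg 9) (.const 1)).Ok μ σ₂ := by
      intro σ₂ h9
      simp only [AExpr.Ok, h9]
      omega
    cases m with
    | free => exact absurd hm.1 h0
    | fresh v =>
      obtain ⟨rfl, hf⟩ := hm
      refine hmark v hf fun σ₂ h₂ => Ends.ite (hok σ₂ h₂.code) (fun h5 => ?_) fun _ =>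
        ends_freshStep hΛ h₂ hlen hK fun _ h => h
      simp [AExpr.eval, h₂.code] at h5
    | kept v =>
      obtain ⟨rfl, hf⟩ := hm
      refine hmark v hf fun σ₂ h₂ => Ends.ite (hok σ₂ h₂.code) (fun _ =>
        ends_keptStep hl hΛ h₂ hlen hK fun _ h => h) fun h5 => ?_
      simp [AExpr.eval, h₂.code] at h5
  · simp only [AExpr.eval, h₁.code] at h0
    subst h0
    cases m with
    | free => exact ends_freeStep hl hΛ h₁ hlen fun _ h => h
    | fresh v => simp [Mode.At] at hm
    | kept v => simp [Mode.At] at hm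

end Steps

/-! ### The root of the search tree and the original problem. -/

section Problem

variable {V : Type*} [DecidableEq V] {G : SimpleGraph V} [DecidableRel G.Adj]

/-- Without induced paths on three vertices, adjacency is transitive on distinct vertices, and an
induction along a walk makes its ends adjacent. -/
theorem isClusterGraph_induce_iff {p : V → Prop} {B : Finset V} (hB : ∀ x, x ∈ B ↔ p x) :
    IsClusterGraph (G.induce {v | p v}) ↔ Clus G B := by
  constructor
  · intro h x hx y hy z hz hxy hyz hxz
    have h1 : (G.induce {v | p v}).Adj ⟨x, (hB x).1 hx⟩ ⟨y, (hB y).1 hy⟩ := hxy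
    have h2 : (G.induce {v | p v}).Adj ⟨y, (hB y).1 hy⟩ ⟨z, (hB z).1 hz⟩ := hyz
    exact h _ _ (h1.reachable.trans h2.reachable) (by simpa using hxz)
  · rintro h u v ⟨q⟩ huv
    induction q with
    | nil => exact absurd rfl huv
    | @cons u v w huv' q ih =>
      by_cases hvw : v = w
      · exact hvw ▸ huv'
      · exact h u ((hB _).2 u.2) v ((hB _).2 v.2) w ((hB _).2 w.2) huv' (ih hvw)
          fun h => huv (Subtype.ext h)

theorem hasClusterDeletion_iff [Fintype V] (k : ℕ) :
    HasClusterDeletion G k ↔ (Node.mk Finset.univ k .free).Solvable G := by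
  rw [solvable_free]
  constructor
  · rintro ⟨S, hS, h⟩
    refine ⟨Sᶜ, Finset.subset_univ _, ?_, (isClusterGraph_induce_iff (by simp)).1 h⟩
    have := Finset.card_add_card_compl S
    rw [Finset.card_univ]
    omega
  · rintro ⟨B, -, hk, h⟩
    refine ⟨Bᶜ, ?_, (isClusterGraph_induce_iff (by simp)).2 h⟩
    rw [Finset.card_univ, ← Finset.card_add_card_compl B] at hk
    omega

theorem IsEdgeList.length_eq {n : ℕ} {G : SimpleGraph (Fin n)} {l : List (Fin n × Fin n)}
    (hl : IsEdgeList G l) : G.edgeSet.ncard = l.length := by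
  have h : G.edgeSet = ((l.map fun e => s(e.1, e.2)).toFinset : Set (Sym2 (Fin n))) := by
    ext e
    simp only [List.coe_toFinset, Set.mem_ofPred_eq]
    exact (hl.2 e).symm
  rw [h, Set.ncard_coe_finset, List.toFinset_card_of_nodup hl.1, List.length_map]

end Problem

/-! ### The words of the input. -/

section Input

variable {n : ℕ} {l : List (Fin n × Fin n)} {k : ℕ}

theorem getD_flatMap_pair (l : List (Fin n × Fin n)) :
    (∀ i (h : i < l.length),
      (l.flatMap fun e => [(e.1 : ℕ), (e.2 : ℕ)]).getD (i + i) 0 = l[i].1 ∧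
      (l.flatMap fun e => [(e.1 : ℕ), (e.2 : ℕ)]).getD (i + i + 1) 0 = l[i].2) ∧
    ∀ i, 2 * l.length ≤ i → (l.flatMap fun e => [(e.1 : ℕ), (e.2 : ℕ)]).getD i 0 = 0 := by
  induction l with
  | nil => simp
  | cons e l ih =>
    obtain ⟨h1, h2⟩ := ih
    constructor
    · intro i hi
      rcases i with _ | i
      · simp
      · have := h1 i (by simpa using hi)
        rw [show i + 1 + (i + 1) = i + i + 1 + 1 by omega]
        simpa using this
    · intro i hi
      simp only [List.length_cons] at hi
      obtain ⟨j, rfl⟩ : ∃ j, i = j + 1 + 1 := ⟨i - 2, by omega⟩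
      have := h2 j (by omega)
      simpa using this

theorem startState_fst {i : ℕ} (h : i < l.length) :
    (startState n l k).mem (3 + (i + i)) = l[i].1 := by
  have := ((getD_flatMap_pair l).1 i h).1
  rw [show 3 + (i + i) = i + i + 1 + 1 + 1 by omega]
  simpa [startState, inputWords] using this

theorem startState_snd {i : ℕ} (h : i < l.length) :
    (startState n l k).mem (4 + (i + i)) = l[i].2 := by
  have := ((getD_flatMap_pair l).1 i h).2
  rw [show 4 + (i + i) = i + i + 1 + 1 + 1 + 1 by omega]
  simpa [startState, inputWords] using this

theorem startState_eq_zero {a : ℕ} (h : 3 + 2 * l.length ≤ a) : (startState n l k).mem a = 0 := by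
  obtain ⟨i, rfl⟩ : ∃ i, a = i + 1 + 1 + 1 := ⟨a - 3, by omega⟩
  have := (getD_flatMap_pair l).2 i (by omega)
  simpa [startState, inputWords] using this

end Input

/-! ### Memory layout, initialisation and the main loop. -/

section Machine

/-- The base addresses of the arrays. -/
def arrayBase (n m j : ℕ) : ℕ := if j = 0 ∨ 15 < j then 0 else 3 + 2 * m + (j - 1) * n

/-- The lengths of the arrays. -/
def arrayLen (n m j : ℕ) : ℕ :=
  if j = 0 then 3 + 2 * m else if j ≤ 14 then n else if j = 15 then (n + 2) * (n + 3) else 0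

theorem arrayBase_add_le {n m i j : ℕ} (hij : i < j) (hj : j ≤ 15) :
    arrayBase n m i + arrayLen n m i ≤ arrayBase n m j := by
  unfold arrayBase arrayLen
  rw [if_neg (by omega : ¬ (j = 0 ∨ 15 < j))]
  by_cases hi : i = 0
  · simp [hi]
  · rw [if_neg (by omega), if_neg hi, if_pos (by omega)]
    have := Nat.mul_le_mul_right n (show i - 1 + 1 ≤ j - 1 by omega)
    rw [Nat.succ_mul] at this
    omega

/-- The exponent 6 is 2 + 4: the memory is quadratic with factor 16, and the base is at least 2, so
its fourth power absorbs the factor. -/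
theorem memory_le (n m : ℕ) :
    3 + 2 * m + 14 * n + (n + 2) * (n + 3) ≤ (n + m + 2) ^ 6 := by
  have h1 : 3 + 2 * m + 14 * n + (n + 2) * (n + 3) ≤ 16 * (n + m + 2) ^ 2 := by nlinarith
  have h2 : 2 ^ 4 ≤ (n + m + 2) ^ 4 := Nat.pow_le_pow_left (by omega) 4
  calc _ ≤ 16 * (n + m + 2) ^ 2 := h1
    _ ≤ (n + m + 2) ^ 4 * (n + m + 2) ^ 2 := Nat.mul_le_mul_right _ h2
    _ = _ := by ring

theorem word_le (n m k : ℕ) :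
    16 * ((n + m + k + 2) * (n + m + k + 2)) ≤ (n + m + k + 2) ^ 6 := by
  have h2 : 2 ^ 4 ≤ (n + m + k + 2) ^ 4 := Nat.pow_le_pow_left (by omega) 4
  calc _ ≤ (n + m + k + 2) ^ 4 * ((n + m + k + 2) * (n + m + k + 2)) := Nat.mul_le_mul_right _ h2
    _ = _ := by ring

theorem arrayBase_le (n m j : ℕ) : arrayBase n m j ≤ 3 + 2 * m + 14 * n := by
  unfold arrayBase
  split_ifs with h
  · omega
  · have := Nat.mul_le_mul_right n (show j - 1 ≤ 14 by omega)
    omega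

/-- The machine on which the search runs. -/
def searchMach (n m k : ℕ) : Mach where
  W := (n + m + k + 2) ^ 6
  M := (n + m + 2) ^ 6
  L := n + m + 3
  base := arrayBase n m
  len := arrayLen n m
  one_lt := by
    have := word_le n m k
    nlinarith
  le_word := Nat.pow_le_pow_left (by omega) 6
  base_lt j := by
    have h1 := arrayBase_le n m j
    have h2 := memory_le n m
    have h3 : (n + m + 2) ^ 6 ≤ (n + m + k + 2) ^ 6 := Nat.pow_le_pow_left (by omega) 6
    have h4 : 0 < (n + 2) * (n + 3) := by positivity
    omega
  fit j hj := by
    have h2 := memory_le n m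
    by_cases h : j < 15
    · have := arrayBase_add_le (n := n) (m := m) h le_rfl
      have := arrayBase_le n m 15
      omega
    · by_cases h15 : j = 15
      · subst h15
        have := arrayBase_le n m 15
        simp only [arrayLen, OfNat.ofNat_ne_zero, if_false, Nat.reduceLeDiff, if_true]
        omega
      · simp [arrayLen, show ¬ j ≤ 14 by omega, show j ≠ 0 by omega, h15] at hj
  disjoint i j hij x hx y hy := by
    have hle : ∀ i x, x < arrayLen n m i → i ≤ 15 := by
      intro i x hx
      by_contra h
      simp [arrayLen, show ¬ i ≤ 14 by omega, show i ≠ 0 by omega, show i ≠ 15 by omega] at hx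
    rcases Nat.lt_or_gt_of_ne hij with h | h
    · have := arrayBase_add_le (n := n) (m := m) h (hle j y hy)
      omega
    · have := arrayBase_add_le (n := n) (m := m) h (hle i x hx)
      omega

theorem searchMach_layout (n m k : ℕ) : Layout (searchMach n m k) n m k where
  input := by simp [searchMach, arrayLen]
  work j h1 h2 := by simp [searchMach, arrayLen, h2, show j ≠ 0 by omega]
  stack := by simp [searchMach, arrayLen]
  loops := rfl
  word := word_le n m k

variable {n k : ℕ} {l : List (Fin n × Fin n)} {G : SimpleGraph (Fin n)} [DecidableRel G.Adj]

/-- Induction on `Halts`, which bounds the number of rounds whichever steps the program chooses. A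
round costs at most one search step and 2 for the test of register 14, the number of frames; the
final test accounts for the last 2. -/
theorem exec_search (hl : IsEdgeList G l) {μ : Mach} (hΛ : Layout μ n l.length k)
    {L : List (Node (Fin n))} {b : ℝ} (hL : Halts G L b) {σ : AState} {s : State}
    (hP : Pile l σ L) (hV : Valid k L) (hs : Rep μ σ s) :
    ∃ t s', Exec μ.W μ.M (.loop (.reg 14) searchStep.compile) s t s' ∧
      (t : ℝ) ≤ b * (searchStep.cost μ.L + 2) + 2 ∧
      (s'.reg 0 = 1 ↔ ∃ c ∈ L, c.Solvable G) := by
  have hcost : (0 : ℝ) ≤ searchStep.cost μ.L + 2 := by positivity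
  induction hL generalizing σ s with
  | nil b hb =>
    have h14 : s.reg 14 = 0 := (hs.reg 7).trans hP.count
    have h0 : s.reg 0 = 0 := (hs.reg 0).trans hP.ans
    refine ⟨_, s, .loop_false _ _ _ ?_ h14, ?_, by simp [h0]⟩
    · simp only [Expr.Fits, h14]
      exact Nat.zero_lt_of_lt μ.one_lt
    · simp only [Expr.cost, Nat.reduceAdd, Nat.cast_ofNat]
      have := mul_nonneg hb hcost
      linarith
  | cons c rest b hb h ih =>
    have hlen := hV.length_le
    have h14 : s.reg 14 = (c :: rest).length := (hs.reg 7).trans hP.count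
    have hfit : (Expr.reg 14).Fits μ.W μ.M s := by
      simp only [Expr.Fits, h14]
      exact hΛ.lt_word (by omega)
    have hne : (Expr.reg 14).eval s ≠ 0 := by simp [Expr.eval, h14]
    obtain ⟨σ', hrun, hnext⟩ := ends_searchStep hl hΛ hP hV
    obtain ⟨t₁, s₁, hex, ht₁, hs₁⟩ := hrun s hs
    have ht₁' : (t₁ : ℝ) ≤ searchStep.cost μ.L := by exact_mod_cast ht₁
    have hwf := hV.wf c (by simp)
    rcases hnext with ⟨cs, hstep, hP'⟩ | ⟨hstep, h7, h0⟩
    · obtain ⟨t₂, s₂, hex₂, ht₂, hans⟩ := ih cs hstep hP' (hV.next hstep) hs₁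
      refine ⟨_, s₂, .loop_true _ _ _ _ _ _ _ hfit hne hex hex₂, ?_, ?_⟩
      · simp only [Expr.cost, Nat.reduceAdd, Nat.cast_add, Nat.cast_ofNat]
        linarith
      · have h1 := hstep.solvable hwf
        simp only [Option.some.injEq, forall_eq'] at h1
        rw [hans]
        simp only [List.mem_append, List.mem_cons, or_and_right, exists_or, exists_eq_left, h1]
    · have h14' : s₁.reg 14 = 0 := (hs₁.reg 7).trans h7
      have h0' : s₁.reg 0 = 1 := (hs₁.reg 0).trans h0
      refine ⟨_, s₁, .loop_true _ _ _ _ _ _ _ hfit hne hex (.loop_false _ _ _ ?_ h14'), ?_, ?_⟩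
      · simp only [Expr.Fits, h14']
        exact Nat.zero_lt_of_lt μ.one_lt
      · simp only [Expr.cost, Nat.reduceAdd, Nat.cast_add, Nat.cast_ofNat]
        nlinarith
      · have h1 := hstep.solvable hwf
        simp only [h0', true_iff]
        exact ⟨c, by simp, h1.2 (by simp)⟩

/-- Stores the base addresses of the arrays `1, …, j + 1` in registers. -/
def initBases : ℕ → Prog
  | 0 => .assign 3 (.add (.const 3) (.add (.reg 4) (.reg 4)))
  | j + 1 => .seq (initBases j) (.assign (2 * j + 5) (.add (.reg (2 * j + 3)) (.reg 2)))

theorem exec_initBases {W M n m : ℕ} {s : State} (h2 : s.reg 2 = n) (h4 : s.reg 4 = m) (j : ℕ)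
    (hW : 3 + 2 * m + (j + 1) * n < W) :
    ∃ t s', Exec W M (initBases j) s t s' ∧ t ≤ 6 + 4 * j ∧ s'.mem = s.mem ∧
      (∀ i ≤ j, s'.reg (2 * i + 3) = 3 + 2 * m + i * n) ∧
      ∀ a, (∀ i ≤ j, a ≠ 2 * i + 3) → s'.reg a = s.reg a := by
  induction j with
  | zero =>
    refine ⟨_, _, .assign _ _ _ ?_, by simp [Expr.cost], rfl, ?_, ?_⟩
    · simp only [Expr.Fits, Expr.eval, h4]
      omega
    · intro i hi
      obtain rfl : i = 0 := by omega
      simp only [Expr.eval, h4, Nat.mul_zero, Function.update_self]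
      omega
    · intro a ha
      have := ha 0 le_rfl
      exact Function.update_of_ne this _ _
  | succ j ih =>
    rw [Nat.succ_mul (j + 1)] at hW
    obtain ⟨t, s', hex, ht, hmem, hreg, hother⟩ := ih (by omega)
    have h2' : s'.reg 2 = n := (hother 2 (by omega)).trans h2
    have hj := hreg j le_rfl
    rw [Nat.succ_mul j] at hW
    refine ⟨_, _, .seq _ _ _ _ _ _ _ hex (.assign _ _ _ ?_), ?_, hmem, ?_, ?_⟩
    · simp only [Expr.Fits, Expr.eval, h2', hj]
      omega
    · simp only [Expr.cost]
      omega
    · intro i hi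
      simp only [Function.update_apply, Expr.eval, h2', hj]
      split_ifs with h
      · obtain rfl : i = j + 1 := by omega
        rw [Nat.succ_mul j]
        omega
      · exact hreg i (by omega)
    · intro a ha
      simp only
      rw [Function.update_of_ne (by have := ha (j + 1) le_rfl; omega)]
      exact hother a fun i hi => ha i (by omega)

/-- The even registers 2, 4, 22 and 14 are the registers 1, 2, 11 and 7 of the array machine: n, m,
the frame length and the number of frames. The odd ones up to 31 receive the base addresses. Of the
root frame only the budget is written, since zeros already encode all vertices and the free mode. -/
def initProg : Prog :=
  .seq (.assign 2 (.load (.const 0))) (.seq (.assign 4 (.load (.const 1)))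
    (.seq (.assign 22 (.add (.reg 2) (.const 3))) (.seq (.assign 14 (.const 1))
      (.seq (initBases 14) (.store (.add (.reg 31) (.reg 2)) (.load (.const 2)))))))

theorem exec_initProg (n : ℕ) (l : List (Fin n × Fin n)) (k : ℕ) :
    ∃ (t : ℕ) (σ : AState) (s : State), t ≤ 100 ∧
      Exec ((n + l.length + k + 2) ^ 6) ((n + l.length + 2) ^ 6) initProg (startState n l k) t s ∧
      Rep (searchMach n l.length k) σ s ∧ Pile l σ [⟨Finset.univ, k, .free⟩] := by
  have hmem := memory_le n l.length
  have hMW : (n + l.length + 2) ^ 6 ≤ (n + l.length + k + 2) ^ 6 :=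
    Nat.pow_le_pow_left (by omega) 6
  have hbounds : (n + 2) * (n + 3) + 4 * (n * n) + 8 * (n + l.length + k + 2) ≤
      (n + l.length + k + 2) ^ 6 := (searchMach_layout n l.length k).bounds
  have hstack : n + 6 ≤ (n + 2) * (n + 3) := by nlinarith
  have hpos : 0 < (n + 2) * (n + 3) := by positivity
  set s₄ : State := ⟨Function.update (Function.update (Function.update (Function.update
    (fun _ => 0) 2 n) 4 l.length) 22 (n + 3)) 14 1, (startState n l k).mem⟩ with hs₄
  have r₄ : ∀ a, s₄.reg a = if a = 14 then 1 else if a = 22 then n + 3 else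
      if a = 4 then l.length else if a = 2 then n else 0 := fun a => by
    simp only [hs₄, Function.update_apply]
  obtain ⟨t, s, hex, ht, hsm, hsr, hso⟩ := exec_initBases (W := (n + l.length + k + 2) ^ 6)
    (M := (n + l.length + 2) ^ 6) (s := s₄) (n := n) (m := l.length) (by simp [r₄]) (by simp [r₄])
    14 (by omega)
  have h31 : s.reg 31 = 3 + 2 * l.length + 14 * n := hsr 14 le_rfl
  have heven : ∀ i, s.reg (2 * i) = s₄.reg (2 * i) := fun i => hso _ (by omega)
  have h2 : s.reg 2 = n := by
    rw [heven 1, r₄]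
    simp
  have hm2 : s.mem 2 = k := by rw [hsm]; rfl
  have hmem' : ∀ a, a ≠ 3 + 2 * l.length + 14 * n + n →
      Function.update s.mem (3 + 2 * l.length + 14 * n + n) k a = (startState n l k).mem a := by
    intro a ha
    rw [Function.update_of_ne ha, hsm]
  have hb15 : arrayBase n l.length 15 = 3 + 2 * l.length + 14 * n := by simp [arrayBase]
  have hb0 : arrayBase n l.length 0 = 0 := by simp [arrayBase]
  have hst := Exec.store (W := (n + l.length + k + 2) ^ 6) (M := (n + l.length + 2) ^ 6)
      (.add (.reg 31) (.reg 2)) (.load (.const 2)) s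
      (by simp only [Expr.Fits, Expr.eval, h31, h2]; omega)
      (by simp only [Expr.Fits, Expr.eval, hm2]; omega)
      (by simp only [Expr.eval, h31, h2]; omega)
  simp only [Expr.eval, h31, h2, hm2] at hst
  refine ⟨_, ⟨fun i => s.reg (2 * i), fun j x => Function.update s.mem
    (3 + 2 * l.length + 14 * n + n) k (arrayBase n l.length j + x)⟩,
    ⟨s.reg, Function.update s.mem (3 + 2 * l.length + 14 * n + n) k⟩, ?_,
    .seq _ _ _ _ _ _ _ (.assign _ _ _ ?_) (.seq _ _ _ _ _ _ _ (.assign _ _ _ ?_)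
    (.seq _ _ _ _ _ _ _ (.assign _ _ _ ?_) (.seq _ _ _ _ _ _ _ (.assign _ _ _ ?_)
    (.seq _ _ _ _ _ _ _ hex hst)))), ⟨fun _ => rfl, fun j => ?_, fun _ _ _ => rfl⟩, ?_⟩
  rotate_left 5
  · change s.reg (2 * j + 1) = arrayBase n l.length j
    unfold arrayBase
    split_ifs with h
    · rw [hso _ (by omega), r₄, if_neg (by omega), if_neg (by omega), if_neg (by omega),
        if_neg (by omega)]
    · rw [show 2 * j + 1 = 2 * (j - 1) + 3 by omega, hsr _ (by omega)]
  · have hg : ∀ a, 3 ≤ a → a < 3 + 2 * l.length →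
        Function.update s.mem (3 + 2 * l.length + 14 * n + n) k (arrayBase n l.length 0 + a) =
          (startState n l k).mem a := by
      intro a _ ha
      rw [hb0, Nat.zero_add, hmem' a (by omega)]
    have hz : ∀ d, d ≠ n →
        Function.update s.mem (3 + 2 * l.length + 14 * n + n) k (arrayBase n l.length 15 + d) =
          0 := by
      intro d hd
      rw [hb15, hmem' _ (by omega), startState_eq_zero (by omega)]
    refine ⟨⟨?_, ?_, fun i hi => ?_, fun i hi => ?_⟩, ?_, ?_, ?_, ?_,
      ⟨0, 0, ⟨rfl, by omega⟩, ⟨fun x => ?_, ?_, ?_, ?_⟩⟩, trivial⟩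
    · exact (heven 1).trans (by simp [r₄])
    · exact (heven 2).trans (by simp [r₄])
    · exact (hg _ (by omega) (by omega)).trans (startState_fst hi)
    · exact (hg _ (by omega) (by omega)).trans (startState_snd hi)
    · exact (heven 0).trans (by simp [r₄])
    · exact (heven 6).trans (by simp [r₄])
    · exact (heven 7).trans (by simp [r₄])
    · exact (heven 11).trans (by simp [r₄])
    · simpa using hz x x.isLt.ne
    · simp [hb15]
    · simpa using hz (n + 1) (by omega)
    · simpa using hz (n + 2) (by omega)
  · simp only [Expr.cost]
    omega
  · simp only [Expr.Fits, Expr.eval]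
    exact ⟨by omega, by omega, show n < _ by omega⟩
  · simp only [Expr.Fits, Expr.eval]
    exact ⟨by omega, by omega, show l.length < _ by omega⟩
  · simp only [Expr.Fits, Expr.eval]
    exact ⟨show n < _ by omega, by omega, show n + 3 < _ by omega⟩
  · simp only [Expr.Fits]
    omega

theorem depth_searchStep : searchStep.depth = 1 := by decide

end Machine

end ClusterVD

theorem theorem1 :
    ∃ (p : ClusterVD.Prog) (C : ℝ) (c : ℕ),
      ∀ (n : ℕ) (G : SimpleGraph (Fin n)) (l : List (Fin n × Fin n)) (k : ℕ),
        ClusterVD.IsEdgeList G l →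
        ∃ (t : ℕ) (s : ClusterVD.State),
          ClusterVD.Exec ((n + G.edgeSet.ncard + k + 2) ^ c) ((n + G.edgeSet.ncard + 2) ^ c)
            p (ClusterVD.startState n l k) t s ∧
          (s.reg 0 = 1 ↔ ClusterVD.HasClusterDeletion G k) ∧
          (1 ≤ n → (t : ℝ) ≤ C * (1.9102 : ℝ) ^ k * ((n : ℝ) + (G.edgeSet.ncard : ℝ))) := by
  classical
  refine ⟨.seq ClusterVD.initProg (.loop (.reg 14) ClusterVD.searchStep.compile),
    -- The factor 1000 comes from `treeBound`; 5 from n + m + 4 ≤ 5 (n + m) for n ≥ 1; 2 from the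
    -- test in each round; and 102 from 100 steps of initialisation and the last test.
    1000 * (5 * ClusterVD.searchStep.cost 1 + 2) + 102, 6, fun n G l k hl => ?_⟩
  rw [hl.length_eq]
  obtain ⟨t₁, σ, s₁, ht₁, hex₁, hrep, hpile⟩ := ClusterVD.exec_initProg n l k
  have hΛ := ClusterVD.searchMach_layout n l.length k
  have hhalts : ClusterVD.Halts G [⟨Finset.univ, k, .free⟩] (ClusterVD.treeBound k + 0) :=
    ClusterVD.bounded_free k Finset.univ [] 0 (.nil 0 le_rfl)
  obtain ⟨t₂, s₂, hex₂, ht₂, hans⟩ := ClusterVD.exec_search hl hΛ hhalts hpile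
    ⟨by simp [ClusterVD.Node.Wf], by simp, by simp⟩ hrep
  refine ⟨_, s₂, .seq _ _ _ _ _ _ _ hex₁ hex₂, ?_, fun hn => ?_⟩
  · rw [hans, ClusterVD.hasClusterDeletion_iff]
    simp
  · have hcost := ClusterVD.AProg.cost_le_of_depth ClusterVD.depth_searchStep.le (n + l.length + 3)
    have hcost' : (ClusterVD.searchStep.cost (ClusterVD.searchMach n l.length k).L : ℝ) ≤
        ClusterVD.searchStep.cost 1 * (5 * (n + l.length)) := by
      have h : n + l.length + 3 + 1 ≤ 5 * (n + l.length) := by omega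
      exact_mod_cast hcost.trans (Nat.mul_le_mul_left _ h)
    have hP : (1 : ℝ) ≤ 1.9102 ^ k := one_le_pow₀ (by norm_num)
    have hN : (1 : ℝ) ≤ n + l.length := by
      exact_mod_cast (by omega : 1 ≤ n + l.length)
    have ht₁' : (t₁ : ℝ) ≤ 100 := by exact_mod_cast ht₁
    rw [add_zero, ClusterVD.treeBound] at ht₂
    generalize (ClusterVD.searchStep.cost (ClusterVD.searchMach n l.length k).L : ℝ) = X at *
    generalize (ClusterVD.searchStep.cost 1 : ℝ) = c at *
    generalize (1.9102 : ℝ) ^ k = P at *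
    generalize (n : ℝ) + (l.length : ℝ) = N at *
    have hPN : 1 ≤ P * N := by nlinarith
    have h1 : 1000 * P * (X + 2) ≤ 1000 * P * (c * (5 * N) + 2 * N) :=
      mul_le_mul_of_nonneg_left (by linarith) (by linarith)
    push_cast
    nlinarith
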